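/- Let $k\ge 3$ and $0\le\alpha<1$. A $k$-uniform hypergraph $G=(V,E)$ has a finite vertex set $V$ and a set $E$ of $k$-element subsets of $V$; the degree of a vertex is the number of edges containing it, and an edge is pendant if all its vertices, except at most one, have degree one. The adjacency tensor $\mathcal A(G)$ of order $k$ has the entry $\frac1{(k-1)!}$ at $(i_1,\dots,i_k)$ if $\{i_1,\dots,i_k\}\in E$ and $0$ otherwise, $\mathcal D(G)$ is the diagonal tensor of the degrees, and the $\alpha$-spectral radius $\rho_\alpha(G)$ is the largest modulus of an eigenvalue of $\mathcal A_\alpha(G)=\alpha\mathcal D(G)+(1-\alpha)\mathcal A(G)$, where $\lambda\in\mathbb C$ is an eigenvalue of a tensor $(a_{i_1\dots i_k})$ if there is a nonzero complex vector $x$ with $\sum_{i_2,\dots,i_k}a_{i i_2\dots i_k}x_{i_2}\cdots x_{i_k}=\lambda x_i^{k-1}$ for all $i$. A supertree is a connected hypergraph without cycles, where a cycle is a sequence $v_1e_1v_2e_2\cdots v_\ell e_\ell v_1$ with $\ell\ge2$, distinct vertices $v_i$ and distinct edges $e_i$, each edge containing the two vertices next to it. A supertree is a caterpillar if the removal of all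 its pendant edges (and of the vertices that become isolated) leaves a loose path, i.e. distinct edges $e_1,\dots,e_\ell$ ($\ell\ge0$) with $|e_i\cap e_j|=1$ if $|i-j|=1$ and $e_i\cap e_j=\emptyset$ if $|i-j|\ge2$. Let $NC(m,d)$ be the set of $k$-uniform supertrees with $m$ edges and diameter $d$ that are not caterpillars (if it is nonempty, then $m\ge6$ and $4\le d\le m-2$). For integers $s,t\ge0$ and $a,b\ge1$, let $S(s,t)$ be the tree obtained from an edge by attaching $s$ pendant edges at one end and $t$ pendant edges at the other end, and let $T(s,t;a,b)$ be the tree obtained from $S(s,t)$ by attaching two paths, of lengths $a$ and $b$, at its central vertex of degree $t+1$ (the end with the $t$ pendant edges). The $k$-th power of a simple graph is the $k$-uniform hypergraph obtained by adding $k-2$ new vertices to each edge. Let $H_1(m,d)$ and $H_2(m,d)$ be the $k$-th powers of $T(1,m-d-2;\lfloor d/2\rfloor,\lceil d/2\rceil)$ and $T(m-d-1,0;\lfloor d/2\rfloor,\lceil d/2\rceil)$, respectively. Theorem. For every $G\in NC(m,d)$, $$\rho_\alpha(G)\le\max\{\rho_\alpha(H_1(m,d)),\rho_\alpha(H_2(m,d))\}.$$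 Equality holds if and only if $G$ is isomorphic to one of $H_1(m,d)$, $H_2(m,d)$ whose $\alpha$-spectral radius attains this maximum, that is, if and only if either $G\cong H_1(m,d)$ and $\rho_\alpha(H_1(m,d))\ge\rho_\alpha(H_2(m,d))$, or $G\cong H_2(m,d)$ and $\rho_\alpha(H_2(m,d))\ge\rho_\alpha(H_1(m,d))$. -/

import Mathlib

/-! ### Hypergraphs

Hypergraphs are Mathlib's `Hypergraph V`.  The ones considered here have the whole (finite) type `V`
as their vertex set. -/

namespace Hypergraph

/-- `H` is `k`-uniform: every edge has exactly `k` vertices. -/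
def IsUniform {V : Type*} (H : Hypergraph V) (k : ℕ) : Prop :=
  ∀ e ∈ H.edgeSet, e.ncard = k

/-- The degree of `v`: the number of edges containing `v`. -/
noncomputable def degree {V : Type*} (H : Hypergraph V) (v : V) : ℕ :=
  {e | e ∈ H.edgeSet ∧ v ∈ e}.ncard

/-- The simple graph in which two distinct vertices are adjacent when they lie in a common edge.
A walk `v₀ e₁ v₁ … e_l v_l` of the hypergraph is, up to the choice of the edges, a walk of this
graph, so that connectedness, distance and diameter of the hypergraph are those of this graph. -/
def adjGraph {V : Type*} (H : Hypergraph V) : SimpleGraph V where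
  Adj u v := u ≠ v ∧ ∃ e ∈ H.edgeSet, u ∈ e ∧ v ∈ e
  symm := ⟨fun _ _ h => ⟨h.1.symm, h.2.imp fun _ he => ⟨he.1, he.2.2, he.2.1⟩⟩⟩
  loopless := ⟨fun _ h => h.1 rfl⟩

/-- `H` is connected: it has a vertex, and any two vertices are joined by a walk. -/
def IsConnected {V : Type*} (H : Hypergraph V) : Prop := H.adjGraph.Connected

/-- The diameter: the largest distance between two vertices. -/
noncomputable def diameter {V : Type*} (H : Hypergraph V) : ℕ := H.adjGraph.diam

/-- `H` has no cycle, a cycle being a sequence `v₀ e₀ v₁ e₁ … v_{l-1} e_{l-1} v₀` with `l ≥ 2`,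
distinct vertices `v₀, …, v_{l-1}` and distinct edges `e₀, …, e_{l-1}`, such that each edge contains
the two vertices next to it. -/
def IsAcyclic {V : Type*} (H : Hypergraph V) : Prop :=
  ¬ ∃ (l : ℕ) (v : ℕ → V) (e : ℕ → Set V), 2 ≤ l ∧
    Set.InjOn v (Set.Iio l) ∧ Set.InjOn e (Set.Iio l) ∧ v l = v 0 ∧
    ∀ i < l, e i ∈ H.edgeSet ∧ v i ∈ e i ∧ v (i + 1) ∈ e i

/-- A `k`-uniform supertree with vertex set `V`: connected and acyclic. -/
structure IsSupertree {V : Type*} (H : Hypergraph V) (k : ℕ) : Prop where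
  vertexSet_eq : H.vertexSet = Set.univ
  uniform : H.IsUniform k
  connected : H.IsConnected
  acyclic : H.IsAcyclic

/-- `e` is a pendant edge: all its vertices, except at most one, have degree one. -/
def IsPendantEdge {V : Type*} (H : Hypergraph V) (e : Set V) : Prop :=
  e ∈ H.edgeSet ∧ {v | v ∈ e ∧ H.degree v ≠ 1}.Subsingleton

/-- The set `E` consists of the edges of a loose path: it can be listed without repetition as
`e₀, …, e_{l-1}` in such a way that consecutive edges meet in exactly one vertex and
non-consecutive ones are disjoint (no edge at all, `l = 0`, is the trivial path). -/
def IsLoosePath {V : Type*} (E : Set (Set V)) : Prop :=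
  ∃ (l : ℕ) (e : Fin l → Set V), Function.Injective e ∧ Set.range e = E ∧
    ∀ i j : Fin l, i < j → (e i ∩ e j).ncard = if (i : ℕ) + 1 = j then 1 else 0

/-- The removal of all pendant edges (and of the vertices that become isolated) leaves a loose
path. -/
def IsCaterpillar {V : Type*} (H : Hypergraph V) : Prop :=
  IsLoosePath {e | e ∈ H.edgeSet ∧ ¬ H.IsPendantEdge e}

/-- `NC(m, d)`: the `k`-uniform supertrees with `m` edges and diameter `d` that are not
caterpillars. -/
structure IsNonCaterpillar {V : Type*} (H : Hypergraph V) (k m d : ℕ) : Prop where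
  supertree : H.IsSupertree k
  card_edges : H.edgeSet.ncard = m
  diameter_eq : H.diameter = d
  not_caterpillar : ¬ H.IsCaterpillar

/-- Isomorphism of hypergraphs. -/
def IsIsomorphic {V W : Type*} (G : Hypergraph V) (H : Hypergraph W) : Prop :=
  ∃ σ : V ≃ W, G.image σ = H

end Hypergraph

/-! ### Tensors and their spectral radius -/

/-- A real tensor of order `r + 1` with indices in `V`. -/
abbrev RealTensor (r : ℕ) (V : Type*) : Type _ := (Fin (r + 1) → V) → ℝ

/-- `z` is an eigenvalue of the tensor `A` of order `k = r + 1`: there is a nonzero complex vector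
`x` with `A x = z x^{[k-1]}`, that is,
`∑ a_{i j₁ … j_{k-1}} x_{j₁} ⋯ x_{j_{k-1}} = z x_i ^ (k-1)` for every index `i`. -/
def RealTensor.IsEigenvalue {r : ℕ} {V : Type*} [Fintype V] (A : RealTensor r V) (z : ℂ) : Prop :=
  ∃ x : V → ℂ, x ≠ 0 ∧ ∀ i : V,
    ∑ j : Fin r → V, (A (Fin.cons i j : Fin (r + 1) → V) : ℂ) * ∏ t, x (j t) = z * x i ^ r

/-- The spectral radius: the largest modulus of an eigenvalue. -/
noncomputable def RealTensor.spectralRadius {r : ℕ} {V : Type*} [Fintype V]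
    (A : RealTensor r V) : ℝ :=
  sSup {s : ℝ | ∃ z : ℂ, A.IsEigenvalue z ∧ s = ‖z‖}

namespace Hypergraph

open Classical in
/-- The adjacency tensor of order `k = r + 1`: the entry at `i₁ … i_k` is `1 / (k-1)!` if
`{i₁, …, i_k}` is an edge, and `0` otherwise. -/
noncomputable def adjTensor {V : Type*} (H : Hypergraph V) (r : ℕ) : RealTensor r V :=
  fun i => if Set.range i ∈ H.edgeSet then 1 / (r.factorial : ℝ) else 0

open Classical in
/-- The degree tensor of order `r + 1`: diagonal, with the degrees on the diagonal. -/
noncomputable def degreeTensor {V : Type*} (H : Hypergraph V) (r : ℕ) : RealTensor r V :=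
  fun i => if ∀ t, i t = i 0 then (H.degree (i 0) : ℝ) else 0

/-- The tensor `α D + (1 - α) A` of order `r + 1`. -/
noncomputable def alphaTensor {V : Type*} (H : Hypergraph V) (r : ℕ) (α : ℝ) : RealTensor r V :=
  fun i => α * H.degreeTensor r i + (1 - α) * H.adjTensor r i

/-- The `α`-spectral radius of a `k`-uniform hypergraph (its tensors have order `(k - 1) + 1`). -/
noncomputable def alphaSpectralRadius {V : Type*} [Fintype V] (H : Hypergraph V) (k : ℕ) (α : ℝ) :
    ℝ :=
  (H.alphaTensor (k - 1) α).spectralRadius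

end Hypergraph

/-! ### Power hypergraphs and the extremal hypertrees -/

/-- The vertices of the `k`-th power of `T`: those of `T`, and `k - 2` new ones for each edge. -/
abbrev PowerVertex {W : Type*} (T : SimpleGraph W) (k : ℕ) : Type _ := W ⊕ (T.edgeSet × Fin (k - 2))

noncomputable instance instFintypePowerVertex {W : Type*} [Finite W] (T : SimpleGraph W) (k : ℕ) :
    Fintype (PowerVertex T k) :=
  Fintype.ofFinite _

/-- The `k`-th power of a simple graph: `k - 2` new vertices are added to each edge. -/
def powerHypergraph {W : Type*} (T : SimpleGraph W) (k : ℕ) : Hypergraph (PowerVertex T k) where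
  vertexSet := Set.univ
  edgeSet := Set.range fun e : T.edgeSet =>
    Sum.inl '' {w : W | w ∈ (e : Sym2 W)} ∪ Sum.inr '' {p : T.edgeSet × Fin (k - 2) | p.1 = e}
  subset_vertexSet_of_mem_edgeSet' _ _ := Set.subset_univ _

/-- The double star `S(s, t)`: an edge with ends `inl false` and `inl true`, to which `s` pendant
edges are attached at `inl false` and `t` pendant edges at `inl true`. -/
def doubleStar (s t : ℕ) : SimpleGraph (Bool ⊕ (Fin s ⊕ Fin t)) :=
  SimpleGraph.fromRel fun x y =>
    (x = .inl false ∧ y = .inl true) ∨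
    (x = .inl false ∧ ∃ i, y = .inr (.inl i)) ∨
    (x = .inl true ∧ ∃ i, y = .inr (.inr i))

/-- The graph obtained from `T` by attaching a path of length `a` at the vertex `v`: the new
vertices `0, …, a - 1` form a path, whose first vertex `0` is joined to `v`. -/
def attachPath {W : Type*} (T : SimpleGraph W) (v : W) (a : ℕ) : SimpleGraph (W ⊕ Fin a) :=
  SimpleGraph.fromRel fun x y =>
    (∃ u w, x = .inl u ∧ y = .inl w ∧ T.Adj u w) ∨
    (x = .inl v ∧ ∃ i : Fin a, (i : ℕ) = 0 ∧ y = .inr i) ∨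
    (∃ i j : Fin a, (i : ℕ) + 1 = j ∧ x = .inr i ∧ y = .inr j)

/-- The tree `T(s, t; a, b)`: paths of length `a` and `b` are attached to `S(s, t)` at its central
vertex of degree `t + 1`. -/
def treeT (s t a b : ℕ) : SimpleGraph (((Bool ⊕ (Fin s ⊕ Fin t)) ⊕ Fin a) ⊕ Fin b) :=
  attachPath (attachPath (doubleStar s t) (.inl true) a) (.inl (.inl true)) b

/-- `H₁(m, d)`, the `k`-th power of `T(1, m-d-2; ⌊d/2⌋, ⌈d/2⌉)`, for `d + 2 ≤ m`. -/
abbrev hypertreeH1 (k m d : ℕ) :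
    Hypergraph (PowerVertex (treeT 1 (m - d - 2) (d / 2) (d - d / 2)) k) :=
  powerHypergraph (treeT 1 (m - d - 2) (d / 2) (d - d / 2)) k

/-- `H₂(m, d)`, the `k`-th power of `T(m-d-1, 0; ⌊d/2⌋, ⌈d/2⌉)`, for `d + 2 ≤ m`. -/
abbrev hypertreeH2 (k m d : ℕ) :
    Hypergraph (PowerVertex (treeT (m - d - 1) 0 (d / 2) (d - d / 2)) k) :=
  powerHypergraph (treeT (m - d - 1) 0 (d / 2) (d - d / 2)) k

/-!
The `α`-spectral radius of a connected uniform hypergraph is the maximum of the form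
`x ↦ x ⬝ A x ^ (k - 1)` of its tensor `A` over nonnegative vectors normalized by
`∑ v, x v ^ k = 1`
(`IsFormMaximizer.spectralRadius_eq`), and it is attained at a positive vector `x`, the Perron
vector. If the edges of a supertree `G` are rearranged on the same vertices so that the form at
`x` does not decrease, then the spectral radius does not decrease either; if it stays the same,
then `x` is a Perron vector of the new hypergraph too, so that the form and its gradient at `x`
are unchanged (`spectralRadius_le_of_edgeForm_le`).

Fix a geodesic path of `G` whose length is the diameter `d`, and a vertex `z` of it at which `x`
is largest among the vertices of the path. Two kinds of rearrangements are made.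

* Replacing a vertex of an edge by one at which `x` is at least as large does not decrease the
  form. If the overall maximum of `x` is attained on the path, then at `z`: as `G` is not a
  caterpillar, some edge is not attached to the path (`isCaterpillar_of_top_mem`). It is kept, and
  all other edges off the path are attached to `z` (`exists_isSpider_of_max_mem`). Otherwise the
  maximum is attained at a vertex `y` off the path only; the edge leading from the path towards
  `y` is made to contain `z` and `y`, and all other edges off the path are attached to `y`
  (`exists_isSpider_of_max_notMem`).
* The vertex `z` is moved to the middle of the path by reversing a segment of the path, an
  operation that exchanges two vertices between the edges at the ends of the segment. A suitable
  segment exists because `x` is larger at `z` than at the middle of the path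
  (`exists_isRerouting_of_lt`).

What results is a spider: a path with `z` in its middle, an edge `f` through `z` and another
vertex `w`, and edges attached to `z` or `w`, namely one edge at `w` in the first case, and none
at `z` in the second. Being connected with the right number of vertices, it is the power of the
corresponding tree `T(s, t; a, b)` (`IsSpider.isIsomorphic`), that is, one of the two extremal
supertrees. Each change that does not leave the edges as they are increases the form or changes
the gradient at some vertex, which gives the case of equality.
-/

set_option linter.unusedSectionVars false

/-! ### The form of an edge family and its gradient -/

section EdgeForm

variable {V ι : Type*} [Fintype V] [DecidableEq V] [Fintype ι]

/-- The contribution of the edge `s` to the form `x ↦ x ⬝ A x ^ r` of the tensor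
`α D + (1 - α) A` of order `r + 1`. -/
def edgeTerm (r : ℕ) (α : ℝ) (x : V → ℝ) (s : Finset V) : ℝ :=
  α * ∑ v ∈ s, x v ^ (r + 1) + (1 - α) * (r + 1) * ∏ v ∈ s, x v

/-- The contribution of the edge `s` to the component at `v` of `A x ^ r`, where `A` is the tensor
`α D + (1 - α) A` of order `r + 1`. -/
def edgeGrad (r : ℕ) (α : ℝ) (x : V → ℝ) (s : Finset V) (v : V) : ℝ :=
  if v ∈ s then α * x v ^ r + (1 - α) * ∏ u ∈ s.erase v, x u else 0

/-- The form of the tensor `α D + (1 - α) A` of the hypergraph whose edges are the `E i`. -/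
def edgeForm (r : ℕ) (α : ℝ) (E : ι → Finset V) (x : V → ℝ) : ℝ :=
  ∑ i, edgeTerm r α x (E i)

/-- Euler's identity for the homogeneous function `edgeTerm r α · s`, whose partial derivatives are
`r + 1` times the `edgeGrad r α · s v`. -/
lemma sum_mul_edgeGrad {r : ℕ} {α : ℝ} {x : V → ℝ} {s : Finset V} (hs : s.card = r + 1) :
    ∑ v, x v * edgeGrad r α x s v = edgeTerm r α x s := by
  have h : ∀ v, x v * edgeGrad r α x s v =
      if v ∈ s then α * x v ^ (r + 1) + (1 - α) * ∏ u ∈ s, x u else 0 := by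
    intro v
    unfold edgeGrad
    split_ifs with hv
    · rw [← Finset.mul_prod_erase s x hv]; ring
    · simp
  simp only [h, Finset.sum_ite_mem, Finset.univ_inter, Finset.sum_add_distrib, ← Finset.mul_sum,
    Finset.sum_const, hs, edgeTerm]
  push_cast [nsmul_eq_mul]
  ring

lemma sum_mul_sum_edgeGrad {r : ℕ} {α : ℝ} {E : ι → Finset V} (hE : ∀ i, (E i).card = r + 1)
    (x : V → ℝ) : ∑ v, x v * ∑ i, edgeGrad r α x (E i) v = edgeForm r α E x := by
  simp only [Finset.mul_sum]
  rw [Finset.sum_comm]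
  exact Finset.sum_congr rfl fun i _ => sum_mul_edgeGrad (hE i)

lemma edgeTerm_mono {V : Type*} {r : ℕ} {α : ℝ} (hα0 : 0 ≤ α) (hα1 : α ≤ 1) {x y : V → ℝ}
    (hx : ∀ v, 0 ≤ x v) (hxy : ∀ v, x v ≤ y v) (s : Finset V) :
    edgeTerm r α x s ≤ edgeTerm r α y s := by
  unfold edgeTerm
  have h1 : (0 : ℝ) ≤ (1 - α) * (r + 1) := mul_nonneg (by linarith) (by positivity)
  gcongr with v hv v hv
  · exact hx v
  · exact hxy v
  · exact fun v _ => hx v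
  · exact hxy v

/-! ### The action of the tensor of a hypergraph -/

/-- A set `s` of `r` vertices is listed by `r!` tuples. -/
lemma sum_prod_image_eq {R : Type*} [CommRing R] (r : ℕ) (s : Finset V) (hs : s.card = r)
    (x : V → R) :
    ∑ j : Fin r → V, (if Finset.univ.image j = s then ∏ t, x (j t) else 0) =
      (r.factorial : R) * ∏ v ∈ s, x v := by
  have hinj : ∀ j : Fin r → V, Finset.univ.image j = s → Function.Injective j := by
    intro j hj
    rw [← Set.injOn_univ, ← Finset.coe_univ]
    apply Finset.injOn_of_card_image_eq
    rw [hj, hs, Finset.card_univ, Fintype.card_fin]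
  rw [← Finset.sum_filter]
  have h1 : ∀ j ∈ Finset.univ.filter (fun j : Fin r → V => Finset.univ.image j = s),
      ∏ t, x (j t) = ∏ v ∈ s, x v := by
    intro j hj
    have hj' := (Finset.mem_filter.1 hj).2
    rw [← hj', Finset.prod_image fun a _ b _ h => hinj j hj' h]
  rw [Finset.sum_congr rfl h1, Finset.sum_const, nsmul_eq_mul]
  congr 2
  have hc : Fintype.card (Fin r) = Fintype.card s := by simp [hs]
  have h2 : Fintype.card (Fin r ≃ s) = r.factorial := by
    rw [Fintype.card_equiv (Fintype.equivOfCardEq hc), Fintype.card_fin]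
  rw [← h2, ← Finset.card_univ]
  symm
  refine Finset.card_bij (fun e _ t => (e t : V)) ?_ ?_ ?_
  · intro e _
    simp only [Finset.mem_filter, Finset.mem_univ, true_and]
    ext v
    simp only [Finset.mem_image, Finset.mem_univ, true_and]
    constructor
    · rintro ⟨t, rfl⟩; exact (e t).2
    · intro hv; exact ⟨e.symm ⟨v, hv⟩, by simp⟩
  · intro e _ e' _ h
    ext t
    exact congrFun h t
  · intro j hj
    have hj' := (Finset.mem_filter.1 hj).2
    have hmem : ∀ t, j t ∈ s := fun t => hj' ▸ Finset.mem_image_of_mem j (Finset.mem_univ t)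
    refine ⟨Equiv.ofBijective (fun t => (⟨j t, hmem t⟩ : s)) ?_, Finset.mem_univ _, rfl⟩
    rw [Fintype.bijective_iff_injective_and_card]
    exact ⟨fun a b h => hinj j hj' (congrArg Subtype.val h), hc⟩

lemma sum_prod_range_cons_eq {R : Type*} [CommRing R] {r : ℕ} {s : Finset V}
    (hs : s.card = r + 1) (x : V → R) (v : V) [DecidablePred fun j : Fin r → V =>
      Set.range (Fin.cons v j : Fin (r + 1) → V) = (s : Set V)] :
    ∑ j : Fin r → V, (if Set.range (Fin.cons v j : Fin (r + 1) → V) = (s : Set V) then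
      ∏ t, x (j t) else 0) =
      if v ∈ s then (r.factorial : R) * ∏ u ∈ s.erase v, x u else 0 := by
  split_ifs with hv
  · rw [← sum_prod_image_eq r (s.erase v) (by rw [Finset.card_erase_of_mem hv, hs]; rfl)]
    refine Finset.sum_congr rfl fun j _ => ?_
    refine if_congr ?_ rfl rfl
    rw [Fin.range_cons]
    have hcoe : (insert v (Set.range j) : Set V) =
        ((insert v (Finset.univ.image j) : Finset V) : Set V) := by simp
    rw [hcoe, Finset.coe_inj]
    constructor
    · intro h
      have hvj : v ∉ Finset.univ.image j := by
        intro hvj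
        rw [Finset.insert_eq_of_mem hvj] at h
        have := Finset.card_image_le (s := Finset.univ) (f := j)
        rw [h, hs, Finset.card_univ, Fintype.card_fin] at this
        omega
      rw [← h, Finset.erase_insert hvj]
    · intro h
      rw [h, Finset.insert_erase hv]
  · refine Finset.sum_eq_zero fun j _ => if_neg fun h => hv ?_
    have : v ∈ (s : Set V) := h ▸ ⟨0, by simp⟩
    exact this

/-- `E` lists the edges of the `(r + 1)`-uniform hypergraph `H`, without repetition. -/
structure IsEdgeFamily (H : Hypergraph V) (r : ℕ) (E : ι → Finset V) : Prop where
  edgeSet_eq : H.edgeSet = Set.range fun i => (E i : Set V)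
  injective : Function.Injective E
  card_eq : ∀ i, (E i).card = r + 1

/-- The action of the tensor `α D + (1 - α) A` as a sum over edges: each edge
through `v` is listed by `r!` tuples that begin with `v`, which cancels the denominator of `A`. -/
lemma sum_alphaTensor {r : ℕ} {H : Hypergraph V} {E : ι → Finset V}
    (hE : IsEdgeFamily H r E) (α : ℝ) (x : V → ℂ) (v : V) :
    ∑ j : Fin r → V, (H.alphaTensor r α (Fin.cons v j : Fin (r + 1) → V) : ℂ) * ∏ t, x (j t) =
      ∑ i, if v ∈ E i then α * x v ^ r + (1 - α) * ∏ u ∈ (E i).erase v, x u else 0 := by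
  classical
  have hdeg : H.degree v = (Finset.univ.filter fun i => v ∈ E i).card := by
    unfold Hypergraph.degree
    have : {e | e ∈ H.edgeSet ∧ v ∈ e} =
        (((Finset.univ.filter fun i => v ∈ E i).image fun i => (E i : Set V) :
          Finset (Set V)) : Set (Set V)) := by
      ext e
      simp only [hE.edgeSet_eq, Set.mem_range, Set.mem_ofPred_eq, Finset.coe_image, Set.mem_image,
        Finset.mem_coe, Finset.mem_filter, Finset.mem_univ, true_and]
      constructor
      · rintro ⟨⟨i, rfl⟩, h⟩; exact ⟨i, h, rfl⟩
      · rintro ⟨i, h, rfl⟩; exact ⟨⟨i, rfl⟩, h⟩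
    rw [this, Set.ncard_coe_finset, Finset.card_image_of_injective]
    exact fun a b h => hE.injective (Finset.coe_injective h)
  have hD : ∑ j : Fin r → V, (H.degreeTensor r (Fin.cons v j : Fin (r + 1) → V) : ℂ) *
      ∏ t, x (j t) = ∑ i, if v ∈ E i then x v ^ r else 0 := by
    rw [Finset.sum_eq_single (fun _ => v)]
    · have : ∀ t, (Fin.cons v (fun _ => v) : Fin (r + 1) → V) t =
          (Fin.cons v (fun _ => v) : Fin (r + 1) → V) 0 := by
        intro t; refine Fin.cases rfl (fun i => by simp) t
      rw [Hypergraph.degreeTensor, if_pos this, Fin.cons_zero, hdeg, ← Finset.sum_filter]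
      simp
    · intro j _ hj
      have : ¬ ∀ t, (Fin.cons v j : Fin (r + 1) → V) t = (Fin.cons v j : Fin (r + 1) → V) 0 := by
        intro h
        apply hj
        funext t
        simpa using h t.succ
      rw [Hypergraph.degreeTensor, if_neg this]
      simp
    · simp
  have hA : ∑ j : Fin r → V, (H.adjTensor r (Fin.cons v j : Fin (r + 1) → V) : ℂ) *
      ∏ t, x (j t) = ∑ i, if v ∈ E i then ∏ u ∈ (E i).erase v, x u else 0 := by
    have hfac : (r.factorial : ℂ) ≠ 0 := by exact_mod_cast r.factorial_ne_zero
    have h1 : ∀ j : Fin r → V, (H.adjTensor r (Fin.cons v j : Fin (r + 1) → V) : ℂ) *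
        ∏ t, x (j t) = (1 / (r.factorial : ℂ)) * ∑ i,
          if Set.range (Fin.cons v j : Fin (r + 1) → V) = (E i : Set V) then
            ∏ t, x (j t) else 0 := by
      intro j
      unfold Hypergraph.adjTensor
      by_cases h : ∃ i, Set.range (Fin.cons v j : Fin (r + 1) → V) = (E i : Set V)
      · obtain ⟨i, hi⟩ := h
        rw [if_pos (by rw [hE.edgeSet_eq]; exact ⟨i, hi.symm⟩),
          Finset.sum_eq_single i, if_pos hi]
        · push_cast; ring
        · intro i' _ hne
          refine if_neg fun h => hne ?_
          exact hE.injective (Finset.coe_injective (h.symm.trans hi))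
        · simp
      · push Not at h
        rw [if_neg, Finset.sum_eq_zero fun i _ => if_neg (h i)]
        · simp
        · rw [hE.edgeSet_eq]
          rintro ⟨i, hi⟩
          exact h i hi.symm
    simp only [h1]
    rw [← Finset.mul_sum, Finset.sum_comm, Finset.mul_sum]
    refine Finset.sum_congr rfl fun i _ => ?_
    rw [sum_prod_range_cons_eq (hE.card_eq i)]
    split_ifs
    · field_simp
    · simp
  have hsplit : ∀ j : Fin r → V, (H.alphaTensor r α (Fin.cons v j : Fin (r + 1) → V) : ℂ) *
      ∏ t, x (j t) = α * ((H.degreeTensor r (Fin.cons v j : Fin (r + 1) → V) : ℂ) *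
        ∏ t, x (j t)) + (1 - α) * ((H.adjTensor r (Fin.cons v j : Fin (r + 1) → V) : ℂ) *
        ∏ t, x (j t)) := by
    intro j
    unfold Hypergraph.alphaTensor
    push_cast
    ring
  simp only [hsplit]
  rw [Finset.sum_add_distrib, ← Finset.mul_sum, ← Finset.mul_sum, hD, hA, Finset.mul_sum,
    Finset.mul_sum, ← Finset.sum_add_distrib]
  refine Finset.sum_congr rfl fun i _ => ?_
  split_ifs <;> simp

end EdgeForm

/-! ### The spectral radius as the maximum of the form -/

section Maximum

variable {V ι : Type*} [Fintype V] [DecidableEq V] [Fintype ι]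

lemma edgeForm_smul {r : ℕ} {α : ℝ} {E : ι → Finset V} (hE : ∀ i, (E i).card = r + 1) (c : ℝ)
    (x : V → ℝ) : edgeForm r α E (c • x) = c ^ (r + 1) * edgeForm r α E x := by
  unfold edgeForm edgeTerm
  rw [Finset.mul_sum]
  refine Finset.sum_congr rfl fun i _ => ?_
  simp only [Pi.smul_apply, smul_eq_mul, mul_pow, ← Finset.mul_sum, Finset.prod_mul_distrib,
    Finset.prod_const, hE i]
  ring

/-- `x` is a nonzero nonnegative vector at which the form of `E`, divided by `∑ v, x v ^ (r + 1)`,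
attains its maximum `c` over such vectors. -/
structure IsFormMaximizer (r : ℕ) (α : ℝ) (E : ι → Finset V) (c : ℝ) (x : V → ℝ) : Prop where
  nonneg : ∀ v, 0 ≤ x v
  ne_zero : x ≠ 0
  form_eq : edgeForm r α E x = c * ∑ v, x v ^ (r + 1)
  form_le : ∀ y : V → ℝ, (∀ v, 0 ≤ y v) → edgeForm r α E y ≤ c * ∑ v, y v ^ (r + 1)

/-- The form attains its maximum on a compact set of normalized vectors; both sides of the
inequality `IsFormMaximizer.form_le` are homogeneous of degree `r + 1`. -/
lemma exists_isFormMaximizer [Nonempty V] (r : ℕ) (α : ℝ) {E : ι → Finset V}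
    (hE : ∀ i, (E i).card = r + 1) : ∃ c x, IsFormMaximizer r α E c x := by
  set K : Set (V → ℝ) := {y | (∀ v, 0 ≤ y v) ∧ ∑ v, y v ^ (r + 1) = 1} with hK
  have hclosed : IsClosed K := by
    apply IsClosed.inter
    · have : {y : V → ℝ | ∀ v, 0 ≤ y v} = ⋂ v, {y : V → ℝ | 0 ≤ y v} := by ext; simp
      change IsClosed {y : V → ℝ | ∀ v, 0 ≤ y v}
      rw [this]
      exact isClosed_iInter fun v => isClosed_le continuous_const (continuous_apply v)
    · exact isClosed_eq (by fun_prop) continuous_const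
  have hcomp : IsCompact K := by
    refine (isCompact_Icc (a := (0 : V → ℝ)) (b := 1)).of_isClosed_subset hclosed ?_
    rintro y ⟨hy0, hy1⟩
    refine ⟨hy0, fun v => ?_⟩
    by_contra hv
    have h1 : (1 : ℝ) < y v ^ (r + 1) := one_lt_pow₀ (not_le.1 hv) (Nat.succ_ne_zero r)
    have h2 := Finset.single_le_sum (f := fun v => y v ^ (r + 1))
      (fun v _ => pow_nonneg (hy0 v) _) (Finset.mem_univ v)
    simp only [hy1] at h2
    linarith
  have hne : K.Nonempty := by
    obtain ⟨v⟩ := ‹Nonempty V›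
    refine ⟨Pi.single v 1, fun u => ?_, ?_⟩
    · by_cases h : u = v
      · subst h; simp
      · simp [h]
    · rw [Finset.sum_eq_single v]
      · simp
      · intro u _ hu; simp [hu]
      · simp
  have hcont : Continuous (edgeForm r α E) := by
    unfold edgeForm edgeTerm
    fun_prop
  obtain ⟨x, ⟨hx0, hx1⟩, hmax⟩ := hcomp.exists_isMaxOn hne hcont.continuousOn
  refine ⟨edgeForm r α E x, x, hx0, ?_, by rw [hx1, mul_one], fun y hy => ?_⟩
  · rintro rfl
    simp at hx1
  · have hN0 : 0 ≤ ∑ v, y v ^ (r + 1) := Finset.sum_nonneg fun v _ => pow_nonneg (hy v) _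
    rcases hN0.eq_or_lt with hN | hN
    · have hy0 : y = 0 := by
        funext v
        have := (Finset.sum_eq_zero_iff_of_nonneg fun v _ => pow_nonneg (hy v) _).1 hN.symm v
          (Finset.mem_univ v)
        exact eq_zero_of_pow_eq_zero this
      rw [← hN, hy0, mul_zero]
      have := edgeForm_smul (α := α) hE 0 (0 : V → ℝ)
      simp only [smul_zero] at this
      rw [this]
      simp
    · set N := ∑ v, y v ^ (r + 1) with hNdef
      set c : ℝ := (N ^ ((1 : ℝ) / ((r + 1 : ℕ) : ℝ)))⁻¹ with hc
      have hcpow : c ^ (r + 1) = N⁻¹ := by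
        rw [hc, inv_pow, one_div, Real.rpow_inv_natCast_pow hN.le (Nat.succ_ne_zero r)]
      have hc0 : 0 ≤ c := inv_nonneg.2 (Real.rpow_nonneg hN.le _)
      have hmem : c • y ∈ K := by
        refine ⟨fun v => mul_nonneg hc0 (hy v), ?_⟩
        simp only [Pi.smul_apply, smul_eq_mul, mul_pow, ← Finset.mul_sum, hcpow]
        exact inv_mul_cancel₀ hN.ne'
      have := hmax hmem
      simp only [Set.mem_ofPred_eq, edgeForm_smul hE, hcpow] at this
      rw [inv_mul_le_iff₀ hN] at this
      linarith

variable {r : ℕ} {α : ℝ} {E : ι → Finset V} {c : ℝ} {x : V → ℝ}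

/-- If the vector vanished on some but not all vertices of an edge, raising those zeros to a small
`ε` would gain a multiple of `ε ^ z`, `z ≤ r`, in the form, against `ε ^ (r + 1)` in the norm. -/
lemma IsFormMaximizer.pos_of_mem (hα0 : 0 ≤ α) (hα1 : α < 1) (hE : ∀ i, (E i).card = r + 1)
    (hx : IsFormMaximizer r α E c x) {i : ι} {u w : V} (hu : u ∈ E i) (hw : w ∈ E i)
    (hxw : 0 < x w) : 0 < x u := by
  by_contra hxu
  have hxu0 : x u = 0 := le_antisymm (not_lt.1 hxu) (hx.nonneg u)
  set Z := (E i).filter fun v => x v = 0 with hZ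
  set C := ∏ v ∈ (E i).filter (fun v => ¬ x v = 0), x v with hC
  have hCpos : 0 < C := Finset.prod_pos fun v hv =>
    lt_of_le_of_ne (hx.nonneg v) (Ne.symm (Finset.mem_filter.1 hv).2)
  have hZr : Z.card ≤ r := by
    have : Z.card < (E i).card := by
      apply Finset.card_lt_card
      refine ⟨Finset.filter_subset _ _, fun h => ?_⟩
      have := (Finset.mem_filter.1 (h hw)).2
      linarith
    rw [hE i] at this
    omega
  have hprod : ∏ v ∈ E i, x v = 0 := Finset.prod_eq_zero hu hxu0
  have key : ∀ ε : ℝ, 0 < ε → ε < 1 → (1 - α) * (r + 1) * C ≤ c * Z.card * ε := by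
    intro ε hε hε1
    set y : V → ℝ := fun v => if v ∈ Z then ε else x v with hy
    have hxy : ∀ v, x v ≤ y v := by
      intro v
      simp only [hy]
      split_ifs with hv
      · rw [(Finset.mem_filter.1 hv).2]; exact hε.le
      · exact le_rfl
    have hN : ∑ v, y v ^ (r + 1) = ∑ v, x v ^ (r + 1) + Z.card * ε ^ (r + 1) := by
      have : ∀ v, y v ^ (r + 1) = x v ^ (r + 1) + if v ∈ Z then ε ^ (r + 1) else 0 := by
        intro v
        simp only [hy]
        split_ifs with hv
        · rw [(Finset.mem_filter.1 hv).2]; simp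
        · simp
      simp only [this, Finset.sum_add_distrib, Finset.sum_ite_mem, Finset.univ_inter,
        Finset.sum_const, nsmul_eq_mul]
    have hPy : ∏ v ∈ E i, y v = ε ^ Z.card * C := by
      rw [← Finset.prod_filter_mul_prod_filter_not (E i) (fun v => x v = 0)]
      congr 1
      · rw [← Finset.prod_const]
        exact Finset.prod_congr rfl fun v hv => if_pos hv
      · refine Finset.prod_congr rfl fun v hv => if_neg fun h => ?_
        exact (Finset.mem_filter.1 hv).2 (Finset.mem_filter.1 h).2
    have hterm : edgeTerm r α x (E i) + (1 - α) * (r + 1) * (ε ^ Z.card * C) ≤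
        edgeTerm r α y (E i) := by
      unfold edgeTerm
      rw [hprod, hPy]
      have : ∑ v ∈ E i, x v ^ (r + 1) ≤ ∑ v ∈ E i, y v ^ (r + 1) :=
        Finset.sum_le_sum fun v _ => pow_le_pow_left₀ (hx.nonneg v) (hxy v) _
      have := mul_le_mul_of_nonneg_left this hα0
      linarith
    have hform : edgeForm r α E x + (1 - α) * (r + 1) * (ε ^ Z.card * C) ≤ edgeForm r α E y := by
      unfold edgeForm
      classical
      rw [← Finset.add_sum_erase _ _ (Finset.mem_univ i),
        ← Finset.add_sum_erase _ _ (Finset.mem_univ i)]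
      have := Finset.sum_le_sum fun j (_ : j ∈ Finset.univ.erase i) =>
        edgeTerm_mono (r := r) hα0 hα1.le hx.nonneg hxy (E j)
      linarith
    have h1 := hx.form_le y fun v => (hx.nonneg v).trans (hxy v)
    rw [hN, mul_add, ← hx.form_eq] at h1
    have hc0 : 0 ≤ c * Z.card := by
      by_contra hneg
      have h2 : (1 - α) * (r + 1) * (ε ^ Z.card * C) ≤ c * Z.card * ε ^ (r + 1) := by linarith
      have h3 : 0 < (1 - α) * (r + 1) * (ε ^ Z.card * C) := by
        have : 0 < 1 - α := by linarith
        positivity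
      nlinarith [pow_pos hε (r + 1)]
    have h2 : ε ^ Z.card * ((1 - α) * (r + 1) * C) ≤ ε ^ Z.card * (c * Z.card * ε) := by
      have h3 : ε ^ (r + 1) ≤ ε ^ (Z.card + 1) :=
        pow_le_pow_of_le_one hε.le hε1.le (by omega)
      have h4 := mul_le_mul_of_nonneg_left h3 hc0
      have h5 : c * Z.card * ε ^ (Z.card + 1) = ε ^ Z.card * (c * Z.card * ε) := by ring
      linarith
    exact le_of_mul_le_mul_left h2 (pow_pos hε _)
  have hpos : 0 < (1 - α) * (r + 1) * C := by
    have : 0 < 1 - α := by linarith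
    positivity
  have hcz : 0 < c * Z.card := by
    have := key (1 / 2) (by norm_num) (by norm_num)
    linarith
  set ε := min (1 / 2) ((1 - α) * (r + 1) * C / (c * Z.card) / 2) with hεdef
  have hε : 0 < ε := by positivity
  have hε2 : ε ≤ (1 - α) * (r + 1) * C / (c * Z.card) / 2 := min_le_right _ _
  have h1 := key ε hε (lt_of_le_of_lt (min_le_left _ _) (by norm_num))
  have h2 := mul_le_mul_of_nonneg_left hε2 hcz.le
  have h3 : c * Z.card * ((1 - α) * (r + 1) * C / (c * Z.card) / 2) =
      (1 - α) * (r + 1) * C / 2 := by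
    rw [← mul_div_assoc, mul_div_cancel₀ _ hcz.ne']
  linarith

/-- The dependence of an edge's contribution to the form on a single entry of the vector. -/
lemma edgeTerm_update (v : V) (t : ℝ) (s : Finset V) :
    edgeTerm r α (Function.update x v t) s =
      (if v ∈ s then α * t ^ (r + 1) + (1 - α) * (r + 1) * (t * ∏ u ∈ s.erase v, x u) else 0) +
      (α * ∑ u ∈ s.erase v, x u ^ (r + 1) +
        if v ∈ s then 0 else (1 - α) * (r + 1) * ∏ u ∈ s, x u) := by
  have h1 : ∀ u ∈ s.erase v, Function.update x v t u = x u := fun u hu =>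
    Function.update_of_ne (Finset.ne_of_mem_erase hu) _ _
  have hs : ∑ u ∈ s.erase v, Function.update x v t u ^ (r + 1) = ∑ u ∈ s.erase v, x u ^ (r + 1) :=
    Finset.sum_congr rfl fun u hu => by rw [h1 u hu]
  have hp : ∏ u ∈ s.erase v, Function.update x v t u = ∏ u ∈ s.erase v, x u :=
    Finset.prod_congr rfl h1
  unfold edgeTerm
  split_ifs with hv
  · rw [← Finset.add_sum_erase s _ hv, ← Finset.mul_prod_erase s _ hv, hs, hp]
    simp only [Function.update_self]
    ring
  · rw [Finset.erase_eq_of_notMem hv] at hs hp ⊢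
    rw [hs, hp]
    ring

/-- A maximizer is an eigenvector: where it is positive because the partial derivatives of the
form vanish there, and where it is zero because all edges through that vertex are zero. -/
lemma IsFormMaximizer.sum_edgeGrad (hr : 1 ≤ r) (hα0 : 0 ≤ α) (hα1 : α < 1)
    (hE : ∀ i, (E i).card = r + 1) (hx : IsFormMaximizer r α E c x) (v : V) :
    ∑ i, edgeGrad r α x (E i) v = c * x v ^ r := by
  rcases (hx.nonneg v).eq_or_lt with hv | hv
  · rw [← hv, zero_pow (by omega), mul_zero]
    refine Finset.sum_eq_zero fun i _ => ?_
    unfold edgeGrad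
    split_ifs with hvi
    · have : ((E i).erase v).Nonempty := by
        rw [← Finset.card_pos, Finset.card_erase_of_mem hvi, hE i]
        omega
      obtain ⟨u, hu⟩ := this
      have hu0 : x u = 0 := by
        by_contra h
        have := hx.pos_of_mem hα0 hα1 hE hvi (Finset.mem_of_mem_erase hu)
          (lt_of_le_of_ne (hx.nonneg u) (Ne.symm h))
        linarith
      rw [Finset.prod_eq_zero hu hu0, ← hv, zero_pow (by omega)]
      ring
    · rfl
  · set A := ∑ i, (if v ∈ E i then α else 0) with hA
    set B := ∑ i, (if v ∈ E i then (1 - α) * ∏ u ∈ (E i).erase v, x u else 0) with hB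
    set D := ∑ i, (α * ∑ u ∈ (E i).erase v, x u ^ (r + 1) +
        if v ∈ E i then 0 else (1 - α) * (r + 1) * ∏ u ∈ E i, x u) with hD
    set N := ∑ u ∈ Finset.univ.erase v, x u ^ (r + 1) with hN
    have hform : ∀ t, edgeForm r α E (Function.update x v t) =
        A * t ^ (r + 1) + (r + 1) * (B * t) + D := by
      intro t
      unfold edgeForm
      rw [hA, hB, hD, Finset.sum_mul, Finset.sum_mul, Finset.mul_sum, ← Finset.sum_add_distrib,
        ← Finset.sum_add_distrib]
      refine Finset.sum_congr rfl fun i _ => ?_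
      rw [edgeTerm_update]
      split_ifs <;> ring
    have hnorm : ∀ t, ∑ u, Function.update x v t u ^ (r + 1) = t ^ (r + 1) + N := by
      intro t
      rw [← Finset.add_sum_erase _ _ (Finset.mem_univ v), Function.update_self]
      congr 1
      exact Finset.sum_congr rfl fun u hu => by
        rw [Function.update_of_ne (Finset.ne_of_mem_erase hu)]
    set f : ℝ → ℝ := fun t => c * (t ^ (r + 1) + N) - (A * t ^ (r + 1) + (r + 1) * (B * t) + D)
      with hf
    have hf0 : ∀ t, 0 ≤ t → 0 ≤ f t := by
      intro t ht
      have := hx.form_le (Function.update x v t) (fun u => by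
        by_cases h : u = v
        · subst h; simpa using ht
        · rw [Function.update_of_ne h]; exact hx.nonneg u)
      rw [hform, hnorm] at this
      simp only [hf]
      linarith
    have hfx : f (x v) = 0 := by
      have h1 := hform (x v)
      have h2 := hnorm (x v)
      rw [Function.update_eq_self] at h1 h2
      simp only [hf]
      rw [← h1, ← h2, hx.form_eq, sub_self]
    have hmin : IsLocalMin f (x v) := by
      filter_upwards [lt_mem_nhds hv] with t ht
      rw [hfx]
      exact hf0 t ht.le
    have hder : HasDerivAt f (c * ((r + 1 : ℕ) * x v ^ r) -
        (A * ((r + 1 : ℕ) * x v ^ r) + (r + 1) * B)) (x v) := by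
      have h1 : HasDerivAt (fun t : ℝ => t ^ (r + 1)) ((r + 1 : ℕ) * x v ^ r) (x v) := by
        simpa using hasDerivAt_pow (r + 1) (x v)
      have h2 : HasDerivAt (fun t : ℝ => (r + 1 : ℝ) * (B * t)) ((r + 1) * B) (x v) := by
        simpa using ((hasDerivAt_id (x v)).const_mul B).const_mul (r + 1 : ℝ)
      exact ((h1.add_const N).const_mul c).sub (((h1.const_mul A).add h2).add_const D)
    have h0 := hmin.hasDerivAt_eq_zero hder
    have hgrad : ∑ i, edgeGrad r α x (E i) v = A * x v ^ r + B := by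
      rw [hA, hB, Finset.sum_mul, ← Finset.sum_add_distrib]
      refine Finset.sum_congr rfl fun i _ => ?_
      unfold edgeGrad
      split_ifs <;> ring
    rw [hgrad]
    have hr1 : (0 : ℝ) < r + 1 := by positivity
    push_cast at h0
    have h3 : ((r : ℝ) + 1) * (c * x v ^ r) = (r + 1) * (A * x v ^ r + B) := by linarith
    exact (mul_left_cancel₀ hr1.ne' h3).symm

lemma IsFormMaximizer.bound_nonneg (hα0 : 0 ≤ α) (hα1 : α < 1) (hx : IsFormMaximizer r α E c x) :
    0 ≤ c := by
  have hN : 0 < ∑ v, x v ^ (r + 1) := by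
    refine lt_of_le_of_ne (Finset.sum_nonneg fun v _ => pow_nonneg (hx.nonneg v) _) fun h => ?_
    apply hx.ne_zero
    funext v
    exact eq_zero_of_pow_eq_zero ((Finset.sum_eq_zero_iff_of_nonneg fun v _ =>
      pow_nonneg (hx.nonneg v) _).1 h.symm v (Finset.mem_univ v))
  have hform : 0 ≤ edgeForm r α E x := Finset.sum_nonneg fun i _ => by
    unfold edgeTerm
    have h1 : (0 : ℝ) ≤ 1 - α := by linarith
    have h2 : 0 ≤ ∑ v ∈ E i, x v ^ (r + 1) :=
      Finset.sum_nonneg fun v _ => pow_nonneg (hx.nonneg v) _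
    have h3 : 0 ≤ ∏ v ∈ E i, x v := Finset.prod_nonneg fun v _ => hx.nonneg v
    positivity
  rw [hx.form_eq] at hform
  exact nonneg_of_mul_nonneg_left hform hN

/-- The maximum of the form is an eigenvalue, and it bounds the modulus of any other one, as the
moduli of the entries of an eigenvector show. -/
lemma IsFormMaximizer.spectralRadius_eq {H : Hypergraph V} (hE : IsEdgeFamily H r E) (hr : 1 ≤ r)
    (hα0 : 0 ≤ α) (hα1 : α < 1) (hx : IsFormMaximizer r α E c x) :
    (H.alphaTensor r α).spectralRadius = c := by
  have hc0 := hx.bound_nonneg hα0 hα1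
  refine IsGreatest.csSup_eq ⟨⟨(c : ℂ), ⟨fun v => (x v : ℂ), ?_, fun v => ?_⟩, ?_⟩, ?_⟩
  · intro h
    apply hx.ne_zero
    funext v
    exact Complex.ofReal_eq_zero.1 (congrFun h v)
  · refine (sum_alphaTensor hE α (fun v => (x v : ℂ)) v).trans ?_
    have := hx.sum_edgeGrad hr hα0 hα1 hE.card_eq v
    rw [← Complex.ofReal_pow, ← Complex.ofReal_mul c, ← this]
    push_cast
    refine Finset.sum_congr rfl fun i _ => ?_
    unfold edgeGrad
    split_ifs <;> push_cast <;> rfl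
  · rw [Complex.norm_real, Real.norm_of_nonneg hc0]
  · rintro s ⟨z, ⟨w, hw0, hw⟩, rfl⟩
    set y : V → ℝ := fun v => ‖w v‖ with hy
    have hy0 : ∀ v, 0 ≤ y v := fun v => norm_nonneg _
    have h1 : ∀ v, ‖z‖ * y v ^ r ≤ ∑ i, edgeGrad r α y (E i) v := by
      intro v
      have h2 := hw v
      rw [sum_alphaTensor hE] at h2
      have h3 : ‖z‖ * y v ^ r = ‖z * w v ^ r‖ := by rw [norm_mul, norm_pow]
      rw [h3, ← h2]
      refine (norm_sum_le _ _).trans (Finset.sum_le_sum fun i _ => ?_)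
      unfold edgeGrad
      split_ifs
      · refine (norm_add_le _ _).trans (le_of_eq ?_)
        rw [norm_mul, norm_mul, norm_pow, norm_prod, Complex.norm_real, Real.norm_of_nonneg hα0]
        have : (1 - (α : ℂ)) = ((1 - α : ℝ) : ℂ) := by push_cast; rfl
        rw [this, Complex.norm_real, Real.norm_of_nonneg (by linarith)]
      · simp
    have h2 : ‖z‖ * ∑ v, y v ^ (r + 1) ≤ edgeForm r α E y := by
      rw [← sum_mul_sum_edgeGrad hE.card_eq, Finset.mul_sum]
      refine Finset.sum_le_sum fun v _ => ?_
      calc ‖z‖ * y v ^ (r + 1) = y v * (‖z‖ * y v ^ r) := by ring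
        _ ≤ _ := mul_le_mul_of_nonneg_left (h1 v) (hy0 v)
    have h3 := h2.trans (hx.form_le y hy0)
    have hN : 0 < ∑ v, y v ^ (r + 1) := by
      obtain ⟨v, hv⟩ := Function.ne_iff.1 hw0
      refine Finset.sum_pos' (fun v _ => pow_nonneg (hy0 v) _) ⟨v, Finset.mem_univ v, ?_⟩
      exact pow_pos (norm_pos_iff.2 hv) _
    exact le_of_mul_le_mul_right h3 hN

end Maximum

/-! ### Comparison of spectral radii -/

section Comparison

variable {V ι : Type*} [Fintype V] [DecidableEq V] [Fintype ι]

/-- A connected hypergraph has a positive Perron vector. -/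
lemma exists_pos_isFormMaximizer {r : ℕ} {α : ℝ} (hα0 : 0 ≤ α) (hα1 : α < 1) {H : Hypergraph V}
    {E : ι → Finset V} (hE : IsEdgeFamily H r E) (hH : H.IsConnected) :
    ∃ c x, IsFormMaximizer r α E c x ∧ ∀ v, 0 < x v := by
  have : Nonempty V := hH.nonempty
  obtain ⟨c, x, hx⟩ := exists_isFormMaximizer r α hE.card_eq
  refine ⟨c, x, hx, fun v => ?_⟩
  obtain ⟨w, hw⟩ := Function.ne_iff.1 hx.ne_zero
  have hw0 : 0 < x w := lt_of_le_of_ne (hx.nonneg w) (Ne.symm hw)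
  obtain ⟨p⟩ := hH.preconnected w v
  induction p with
  | nil => exact hw0
  | cons h p ih =>
    obtain ⟨-, e, he, h1, h2⟩ := h
    rw [hE.edgeSet_eq] at he
    obtain ⟨i, rfl⟩ := he
    have := hx.pos_of_mem hα0 hα1 hE.card_eq h2 h1 hw0
    exact ih this.ne' this

/-- If the form of `E'` is at least that of `E` at a Perron vector `x` of `E`, then its
spectral radius is at least that of `E`; in case of equality, `x` is a Perron vector of `E'` too. -/
lemma spectralRadius_le_of_edgeForm_le {r : ℕ} {α : ℝ} (hr : 1 ≤ r) (hα0 : 0 ≤ α) (hα1 : α < 1)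
    {H H' : Hypergraph V} {E E' : ι → Finset V} (hE : IsEdgeFamily H r E)
    (hE' : IsEdgeFamily H' r E') {c : ℝ} {x : V → ℝ} (hx : IsFormMaximizer r α E c x)
    (hle : edgeForm r α E x ≤ edgeForm r α E' x) :
    (H.alphaTensor r α).spectralRadius ≤ (H'.alphaTensor r α).spectralRadius ∧
      ((H.alphaTensor r α).spectralRadius = (H'.alphaTensor r α).spectralRadius →
        edgeForm r α E' x = edgeForm r α E x ∧
        ∀ v, ∑ i, edgeGrad r α x (E' i) v = ∑ i, edgeGrad r α x (E i) v) := by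
  have hne : Nonempty V := by
    obtain ⟨v, -⟩ := Function.ne_iff.1 hx.ne_zero
    exact ⟨v⟩
  obtain ⟨c', x', hx'⟩ := exists_isFormMaximizer r α hE'.card_eq
  rw [hx.spectralRadius_eq hE hr hα0 hα1, hx'.spectralRadius_eq hE' hr hα0 hα1]
  have hN : 0 < ∑ v, x v ^ (r + 1) := by
    obtain ⟨v, hv⟩ := Function.ne_iff.1 hx.ne_zero
    refine Finset.sum_pos' (fun v _ => pow_nonneg (hx.nonneg v) _) ⟨v, Finset.mem_univ v, ?_⟩
    exact pow_pos (lt_of_le_of_ne (hx.nonneg v) (Ne.symm hv)) _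
  have h1 := hx'.form_le x hx.nonneg
  have h2 := hx.form_eq
  constructor
  · refine le_of_mul_le_mul_right ?_ hN
    linarith
  · rintro rfl
    have h3 : edgeForm r α E' x = edgeForm r α E x := le_antisymm (by linarith) hle
    refine ⟨h3, fun v => ?_⟩
    have hx2 : IsFormMaximizer r α E' c x :=
      ⟨hx.nonneg, hx.ne_zero, by rw [h3, h2], hx'.form_le⟩
    rw [hx.sum_edgeGrad hr hα0 hα1 hE.card_eq, hx2.sum_edgeGrad hr hα0 hα1 hE'.card_eq]

lemma RealTensor.IsEigenvalue.of_equiv {r : ℕ} {V W : Type*} [Fintype V] [Fintype W]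
    (σ : V ≃ W) {A : RealTensor r V} {B : RealTensor r W} (h : ∀ i, B (σ ∘ i) = A i) {z : ℂ}
    (hA : A.IsEigenvalue z) : B.IsEigenvalue z := by
  obtain ⟨x, hx0, hx⟩ := hA
  refine ⟨x ∘ σ.symm, fun h0 => hx0 ?_, fun i => ?_⟩
  · funext v
    simpa using congrFun h0 (σ v)
  · rw [Function.comp_apply, ← hx (σ.symm i)]
    symm
    refine Fintype.sum_equiv (Equiv.arrowCongr (Equiv.refl _) σ) _ _ fun j => ?_
    rw [← h]
    congr 2
    · congr 1
      funext t
      refine Fin.cases ?_ (fun t => ?_) t <;> simp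
    · simp

lemma Hypergraph.alphaSpectralRadius_eq_of_isIsomorphic {V W : Type*} [Fintype V] [Fintype W]
    {G : Hypergraph V} {H : Hypergraph W} (h : G.IsIsomorphic H) (k : ℕ) (α : ℝ) :
    G.alphaSpectralRadius k α = H.alphaSpectralRadius k α := by
  obtain ⟨σ, rfl⟩ := h
  have himg : ∀ s : Set V, σ '' s ∈ (G.image σ).edgeSet ↔ s ∈ G.edgeSet := by
    intro s
    constructor
    · rintro ⟨t, ht, hts⟩
      rwa [← σ.injective.image_injective hts]
    · exact fun hs => ⟨s, hs, rfl⟩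
  have hdeg : ∀ v, (G.image σ).degree (σ v) = G.degree v := by
    intro v
    unfold Hypergraph.degree
    have : {e | e ∈ (G.image σ).edgeSet ∧ σ v ∈ e} =
        Set.image σ '' {e | e ∈ G.edgeSet ∧ v ∈ e} := by
      ext e
      constructor
      · rintro ⟨⟨t, ht, rfl⟩, hv⟩
        exact ⟨t, ⟨ht, (σ.injective.mem_set_image).1 hv⟩, rfl⟩
      · rintro ⟨t, ⟨ht, hv⟩, rfl⟩
        exact ⟨⟨t, ht, rfl⟩, Set.mem_image_of_mem _ hv⟩
    rw [this, Set.ncard_image_of_injective _ σ.injective.image_injective]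
  have htensor : ∀ i : Fin (k - 1 + 1) → V,
      (G.image σ).alphaTensor (k - 1) α (σ ∘ i) = G.alphaTensor (k - 1) α i := by
    classical
    intro i
    unfold Hypergraph.alphaTensor Hypergraph.degreeTensor Hypergraph.adjTensor
    rw [Set.range_comp]
    refine congrArg₂ (· + ·) (congrArg _ (if_congr ?_ ?_ rfl))
      (congrArg _ (if_congr (himg _) rfl rfl))
    · exact forall_congr' fun t => σ.injective.eq_iff
    · rw [Function.comp_apply, hdeg]
  unfold Hypergraph.alphaSpectralRadius RealTensor.spectralRadius
  congr 1
  ext s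
  constructor
  · rintro ⟨z, hz, rfl⟩
    exact ⟨z, hz.of_equiv σ htensor, rfl⟩
  · rintro ⟨z, hz, rfl⟩
    refine ⟨z, hz.of_equiv σ.symm fun i => ?_, rfl⟩
    rw [← htensor]
    congr 1
    funext t
    simp

end Comparison

/-! ### Rooted supertrees -/

section Rooting

variable {V ι : Type*} [Fintype V] [DecidableEq V] [Fintype ι]

/-- The incidence graph of an edge family: a vertex is joined to the edges that contain it. -/
def incidenceGraph (E : ι → Finset V) : SimpleGraph (V ⊕ ι) where
  Adj a b := (∃ v i, a = .inl v ∧ b = .inr i ∧ v ∈ E i) ∨ ∃ v i, a = .inr i ∧ b = .inl v ∧ v ∈ E i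
  symm := ⟨by
    rintro a b (⟨v, i, rfl, rfl, h⟩ | ⟨v, i, rfl, rfl, h⟩)
    · exact .inr ⟨v, i, rfl, rfl, h⟩
    · exact .inl ⟨v, i, rfl, rfl, h⟩⟩
  loopless := ⟨by rintro a (⟨v, i, rfl, h, -⟩ | ⟨v, i, rfl, h, -⟩) <;> cases h⟩

lemma incidenceGraph_adj_inl_inr {E : ι → Finset V} {v : V} {i : ι} :
    (incidenceGraph E).Adj (.inl v) (.inr i) ↔ v ∈ E i := by
  constructor
  · rintro (⟨v, i, h1, h2, h⟩ | ⟨v, i, h1, h2, h⟩)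
    · cases h1; cases h2; exact h
    · cases h1
  · exact fun h => .inl ⟨v, i, rfl, rfl, h⟩

/-- Vertices and edges alternate along a cycle of the incidence graph, which is therefore a cycle of
the hypergraph. -/
lemma incidenceGraph_isAcyclic {r : ℕ} {H : Hypergraph V} {E : ι → Finset V}
    (hE : IsEdgeFamily H r E) (hH : H.IsAcyclic) : (incidenceGraph E).IsAcyclic := by
  have key : ∀ (v₀ : V) (c : (incidenceGraph E).Walk (.inl v₀) (.inl v₀)), ¬ c.IsCycle := by
    intro v₀ c hc
    apply hH
    have halt : ∀ n ≤ c.length, (n % 2 = 0 → ∃ v, c.getVert n = .inl v) ∧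
        (n % 2 = 1 → ∃ i, c.getVert n = .inr i) := by
      intro n
      induction n with
      | zero => intro _; simp
      | succ n ih =>
        intro hn
        have hadj := c.adj_getVert_succ (Nat.lt_of_succ_le hn)
        obtain ⟨h0, h1⟩ := ih (by omega)
        constructor
        · intro hpar
          obtain ⟨i, hi⟩ := h1 (by omega)
          rw [hi] at hadj
          rcases hadj with ⟨v, j, h, -⟩ | ⟨v, j, -, h, -⟩
          · cases h
          · exact ⟨v, h⟩
        · intro hpar
          obtain ⟨v, hv⟩ := h0 (by omega)
          rw [hv] at hadj
          rcases hadj with ⟨v, j, -, h, -⟩ | ⟨v, j, h, -⟩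
          · exact ⟨j, h⟩
          · cases h
    have heven : c.length % 2 = 0 := by
      by_contra h
      obtain ⟨i, hi⟩ := (halt c.length le_rfl).2 (by omega)
      rw [c.getVert_length] at hi
      cases hi
    have hlen := hc.three_le_length
    have hinj := hc.getVert_injOn'
    have hV : ∀ n, 2 * n ≤ c.length → ∃ v, c.getVert (2 * n) = .inl v :=
      fun n hn => (halt _ hn).1 (by omega)
    have hI : ∀ n, 2 * n + 1 ≤ c.length → ∃ i, c.getVert (2 * n + 1) = .inr i :=
      fun n hn => (halt _ hn).2 (by omega)
    refine ⟨c.length / 2, fun n => Sum.elim id (fun _ => v₀) (c.getVert (2 * n)),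
      fun n => Sum.elim (fun _ => ∅) (fun i => (E i : Set V)) (c.getVert (2 * n + 1)),
      by omega, ?_, ?_, ?_, ?_⟩
    · intro a ha b hb hab
      simp only [Set.mem_Iio] at ha hb
      obtain ⟨u, hu⟩ := hV a (by omega)
      obtain ⟨w, hw⟩ := hV b (by omega)
      simp only [hu, hw, Sum.elim_inl, id] at hab
      have := hinj (x₁ := 2 * a) (x₂ := 2 * b) (by simp only [Set.mem_ofPred_eq]; omega)
        (by simp only [Set.mem_ofPred_eq]; omega) (by rw [hu, hw, hab])
      omega
    · intro a ha b hb hab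
      simp only [Set.mem_Iio] at ha hb
      obtain ⟨i, hi⟩ := hI a (by omega)
      obtain ⟨j, hj⟩ := hI b (by omega)
      simp only [hi, hj, Sum.elim_inr, Finset.coe_inj] at hab
      have := hinj (x₁ := 2 * a + 1) (x₂ := 2 * b + 1) (by simp only [Set.mem_ofPred_eq]; omega)
        (by simp only [Set.mem_ofPred_eq]; omega) (by rw [hi, hj, hE.injective hab])
      omega
    · have : 2 * (c.length / 2) = c.length := by omega
      simp only [this, c.getVert_length, mul_zero, c.getVert_zero]
    · intro n hn
      obtain ⟨u, hu⟩ := hV n (by omega)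
      obtain ⟨w, hw⟩ := hV (n + 1) (by omega)
      obtain ⟨i, hi⟩ := hI n (by omega)
      have h1 := c.adj_getVert_succ (i := 2 * n) (by omega)
      have h2 := c.adj_getVert_succ (i := 2 * n + 1) (by omega)
      rw [hu, hi, incidenceGraph_adj_inl_inr] at h1
      rw [show 2 * n + 1 + 1 = 2 * (n + 1) by ring, hi, hw, SimpleGraph.adj_comm,
        incidenceGraph_adj_inl_inr] at h2
      simp only [hu, hw, hi, Sum.elim_inl, Sum.elim_inr, id, hE.edgeSet_eq]
      exact ⟨⟨i, rfl⟩, h1, h2⟩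
  classical
  rintro (v | i) c hc
  · exact key v c hc
  · have hlen := hc.three_le_length
    have hadj := c.adj_getVert_succ (i := 0) (by omega)
    rw [c.getVert_zero] at hadj
    rcases hadj with ⟨v, j, h, -⟩ | ⟨v, j, -, h, -⟩
    · cases h
    · have hmem : (.inl v : V ⊕ ι) ∈ c.support := h ▸ c.getVert_mem_support _
      exact key v (c.rotate _ hmem) (hc.rotate hmem)

lemma incidenceGraph_connected {r : ℕ} {H : Hypergraph V} {E : ι → Finset V}
    (hE : IsEdgeFamily H r E) (hH : H.IsConnected) : (incidenceGraph E).Connected := by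
  obtain ⟨y⟩ := hH.nonempty
  have hreach : ∀ v, (incidenceGraph E).Reachable (.inl y) (.inl v) := by
    intro v
    obtain ⟨p⟩ := hH.preconnected y v
    induction p with
    | nil => rfl
    | cons h p ih =>
      refine SimpleGraph.Reachable.trans ?_ ih
      obtain ⟨-, e, he, h1, h2⟩ := h
      rw [hE.edgeSet_eq] at he
      obtain ⟨i, rfl⟩ := he
      exact (incidenceGraph_adj_inl_inr.2 h1).reachable.trans
        (incidenceGraph_adj_inl_inr.2 h2).reachable.symm
  rw [SimpleGraph.connected_iff_exists_forall_reachable]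
  refine ⟨.inl y, ?_⟩
  rintro (v | i)
  · exact hreach v
  · obtain ⟨v, hv⟩ := Finset.card_pos.1 (by rw [hE.card_eq i]; omega : 0 < (E i).card)
    exact (hreach v).trans (incidenceGraph_adj_inl_inr.2 hv).reachable

/-- Counting the edges of the incidence tree bounds the number of vertices from below. -/
lemma card_mul_add_one_le {k r : ℕ} {H : Hypergraph V} {E : ι → Finset V}
    (hE : IsEdgeFamily H r E) (hH : H.IsSupertree k) :
    Fintype.card ι * r + 1 ≤ Fintype.card V := by
  classical
  have htree : (incidenceGraph E).IsTree :=
    ⟨incidenceGraph_connected hE hH.connected, incidenceGraph_isAcyclic hE hH.acyclic⟩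
  have h1 := htree.card_edgeFinset
  have h2 : (Finset.univ.sigma E).card ≤ (incidenceGraph E).edgeFinset.card := by
    refine Finset.card_le_card_of_injOn (fun p => s(.inl p.2, .inr p.1)) ?_ ?_
    · rintro ⟨i, v⟩ h
      simp only [Finset.coe_sigma, Set.mem_sigma_iff, Finset.mem_coe] at h
      simp only [SimpleGraph.coe_edgeFinset, SimpleGraph.mem_edgeSet]
      exact incidenceGraph_adj_inl_inr.2 h.2
    · rintro ⟨i, v⟩ - ⟨j, w⟩ - h
      simp only [Sym2.eq_iff, Sum.inl.injEq, Sum.inr.injEq, reduceCtorEq, and_self,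
        or_false] at h
      obtain ⟨rfl, rfl⟩ := h
      rfl
  rw [Finset.card_sigma, Finset.sum_congr rfl fun i _ => hE.card_eq i, Finset.sum_const,
    Finset.card_univ, smul_eq_mul] at h2
  rw [Fintype.card_sum] at h1
  nlinarith

/-- The edges of a tree rooted at `y`: `top i` is the vertex of `E i` closest to the root, where `D`
is the distance to the root. The sets `E i \ {top i}` partition the vertices other than `y`. -/
structure IsRooting (E : ι → Finset V) (y : V) (D : V → ℕ) (top : ι → V) : Prop where
  top_mem : ∀ i, top i ∈ E i
  exists_parent : ∀ v ≠ y, ∃ i, v ∈ E i ∧ v ≠ top i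
  parent_unique : ∀ {i j v}, v ∈ E i → v ≠ top i → v ∈ E j → v ≠ top j → i = j
  root_top : ∀ {i}, y ∈ E i → top i = y
  depth_lt : ∀ {i v}, v ∈ E i → v ≠ top i → D (top i) < D v

/-- Every vertex but the root lies in some edge below its top, so that counting the vertices shows
that these edges are unique. -/
lemma exists_isRooting {k r : ℕ} {H : Hypergraph V} {E : ι → Finset V}
    (hE : IsEdgeFamily H r E) (hH : H.IsSupertree k) (y : V) :
    ∃ D top, IsRooting E y D top := by
  classical
  set D : V → ℕ := fun v => H.adjGraph.dist y v with hD
  have hmin : ∀ i, ∃ t ∈ E i, ∀ v ∈ E i, D t ≤ D v := fun i =>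
    Finset.exists_min_image (E i) D (Finset.card_pos.1 (by rw [hE.card_eq i]; omega))
  choose top htop hle using hmin
  have hpar : ∀ v ≠ y, ∃ i, v ∈ E i ∧ v ≠ top i ∧ D (top i) < D v := by
    intro v hv
    obtain ⟨p, hp⟩ := hH.connected.exists_walk_length_eq_dist v y
    revert hp
    cases p with
    | nil => exact fun _ => absurd rfl hv
    | @cons _ u _ h p =>
      intro hp
      rw [SimpleGraph.Walk.length_cons] at hp
      obtain ⟨-, e, he, h1, h2⟩ := h
      rw [hE.edgeSet_eq] at he
      obtain ⟨i, rfl⟩ := he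
      have h3 : D u < D v := by
        have := SimpleGraph.dist_le p
        simp only [hD, H.adjGraph.dist_comm (u := y)]
        omega
      have h4 := (hle i u h2).trans_lt h3
      exact ⟨i, h1, fun h => by rw [← h] at h4; exact lt_irrefl _ h4, h4⟩
  set S : Finset (Σ _ : ι, V) := Finset.univ.sigma fun i => (E i).erase (top i) with hS
  have hSmem : ∀ i v, (⟨i, v⟩ : Σ _ : ι, V) ∈ S ↔ v ∈ E i ∧ v ≠ top i := by
    intro i v
    simp [hS, and_comm]
  have hScard : S.card = Fintype.card ι * r := by
    rw [hS, Finset.card_sigma, Finset.sum_congr rfl fun i _ => by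
      rw [Finset.card_erase_of_mem (htop i), hE.card_eq i, Nat.add_sub_cancel], Finset.sum_const,
      Finset.card_univ, smul_eq_mul]
  have hsub : Finset.univ.erase y ⊆ S.image Sigma.snd := by
    intro v hv
    obtain ⟨i, h1, h2, -⟩ := hpar v (Finset.ne_of_mem_erase hv)
    exact Finset.mem_image.2 ⟨⟨i, v⟩, (hSmem i v).2 ⟨h1, h2⟩, rfl⟩
  have hcard := card_mul_add_one_le hE hH
  have hVcard : (Finset.univ.erase y).card = Fintype.card V - 1 := by
    rw [Finset.card_erase_of_mem (Finset.mem_univ y), Finset.card_univ]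
  have himg : S.image Sigma.snd = Finset.univ.erase y := by
    refine (Finset.eq_of_subset_of_card_le hsub ?_).symm
    refine Finset.card_image_le.trans ?_
    omega
  have hinj : Set.InjOn Sigma.snd (S : Set (Σ _ : ι, V)) := by
    apply Finset.injOn_of_card_image_eq
    have h1 := Finset.card_image_le (s := S) (f := Sigma.snd)
    have h2 := Finset.card_le_card hsub
    omega
  have huniq : ∀ {i j v}, v ∈ E i → v ≠ top i → v ∈ E j → v ≠ top j → i = j := by
    intro i j v h1 h2 h3 h4
    have := hinj (Finset.mem_coe.2 ((hSmem i v).2 ⟨h1, h2⟩))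
      (Finset.mem_coe.2 ((hSmem j v).2 ⟨h3, h4⟩)) rfl
    exact congrArg Sigma.fst this
  refine ⟨D, top, htop, fun v hv => ?_, huniq, fun {i} hi => ?_, fun {i v} h1 h2 => ?_⟩
  · obtain ⟨i, h1, h2, -⟩ := hpar v hv
    exact ⟨i, h1, h2⟩
  · by_contra h
    have : y ∈ S.image Sigma.snd :=
      Finset.mem_image.2 ⟨⟨i, y⟩, (hSmem i y).2 ⟨hi, fun h' => h h'.symm⟩, rfl⟩
    rw [himg] at this
    exact Finset.ne_of_mem_erase this rfl
  · have hv : v ≠ y := by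
      rintro rfl
      have : v ∈ S.image Sigma.snd := Finset.mem_image.2 ⟨⟨i, v⟩, (hSmem i v).2 ⟨h1, h2⟩, rfl⟩
      rw [himg] at this
      exact Finset.ne_of_mem_erase this rfl
    obtain ⟨j, h3, h4, h5⟩ := hpar v hv
    rwa [huniq h1 h2 h3 h4]

/-- A supertree with `m` edges of `r + 1` vertices has `m r + 1` vertices. -/
lemma IsRooting.card_eq {r : ℕ} {E : ι → Finset V} (hcard : ∀ i, (E i).card = r + 1) {y : V}
    {D : V → ℕ} {top : ι → V} (h : IsRooting E y D top) :
    Fintype.card V = Fintype.card ι * r + 1 := by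
  have h1 : Finset.univ.erase y = Finset.univ.biUnion fun i => (E i).erase (top i) := by
    ext v
    simp only [Finset.mem_erase, Finset.mem_univ, and_true, Finset.mem_biUnion, true_and]
    constructor
    · intro hv
      obtain ⟨i, h1, h2⟩ := h.exists_parent v hv
      exact ⟨i, h2, h1⟩
    · rintro ⟨i, h2, h1⟩ rfl
      exact h2 (h.root_top h1).symm
  have h2 : (Finset.univ.biUnion fun i => (E i).erase (top i)).card = Fintype.card ι * r := by
    rw [Finset.card_biUnion]
    · rw [Finset.sum_congr rfl fun i _ => by
        rw [Finset.card_erase_of_mem (h.top_mem i), hcard i, Nat.add_sub_cancel], Finset.sum_const,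
        Finset.card_univ, smul_eq_mul]
    · intro i _ j _ hij
      rw [Function.onFun, Finset.disjoint_left]
      intro v hvi hvj
      rw [Finset.mem_erase] at hvi hvj
      exact hij (h.parent_unique hvi.2 hvi.1 hvj.2 hvj.1)
  have h3 : (Finset.univ.erase y).card + 1 = Fintype.card V :=
    Finset.card_erase_add_one (Finset.mem_univ y)
  rw [← h3, h1, h2]

end Rooting

/-! ### Loose paths -/

section Path

variable {V ι : Type*} [Fintype V] [DecidableEq V] [Fintype ι]

/-- The edges `E (ε 0), …, E (ε (d - 1))` form a loose path with joints `p 0, …, p d`. -/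
structure IsLooseEdgePath (E : ι → Finset V) (d : ℕ) (p : ℕ → V) (ε : ℕ → ι) : Prop where
  left_mem : ∀ n < d, p n ∈ E (ε n)
  right_mem : ∀ n < d, p (n + 1) ∈ E (ε n)
  ne_succ : ∀ n < d, p n ≠ p (n + 1)
  inter : ∀ {m n v}, m < n → n < d → v ∈ E (ε m) → v ∈ E (ε n) → n = m + 1 ∧ v = p n

namespace IsLooseEdgePath

variable {E : ι → Finset V} {d : ℕ} {p : ℕ → V} {ε : ℕ → ι}

lemma mem_iff (h : IsLooseEdgePath E d p ε) {m n : ℕ} (hm : m ≤ d) (hn : n < d) :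
    p m ∈ E (ε n) ↔ m = n ∨ m = n + 1 := by
  constructor
  · intro hmem
    by_contra hne
    push Not at hne
    rcases lt_or_gt_of_ne hne.1 with hlt | hgt
    · obtain ⟨h1, h2⟩ := h.inter hlt hn (h.left_mem m (by omega)) hmem
      rw [h1] at h2
      exact h.ne_succ m (by omega) h2
    · obtain ⟨k, rfl⟩ : ∃ k, m = k + 1 := ⟨m - 1, by omega⟩
      obtain ⟨h1, h2⟩ := h.inter (by omega : n < k) (by omega) hmem (h.right_mem k (by omega))
      exact h.ne_succ k (by omega) h2.symm
  · rintro (rfl | rfl)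
    · exact h.left_mem _ hn
    · exact h.right_mem _ hn

lemma label_injOn (h : IsLooseEdgePath E d p ε) : Set.InjOn ε (Set.Iio d) := by
  have key : ∀ m n, m < n → n < d → ε m ≠ ε n := by
    intro m n hmn hn he
    have h1 := h.left_mem m (by omega)
    rw [he, h.mem_iff (by omega) hn] at h1
    omega
  intro m hm n hn he
  rcases lt_trichotomy m n with h1 | h1 | h1
  · exact absurd he (key m n h1 hn)
  · exact h1
  · exact absurd he.symm (key n m h1 hm)

lemma joint_injOn (h : IsLooseEdgePath E d p ε) : Set.InjOn p (Set.Iic d) := by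
  have key : ∀ m n, m < n → n ≤ d → p m ≠ p n := by
    intro m n hmn hn he
    have h1 := h.left_mem m (by omega)
    rw [he, h.mem_iff hn (by omega)] at h1
    have h2 : n = m + 1 := by omega
    exact h.ne_succ m (by omega) (h2 ▸ he)
  intro m hm n hn he
  rcases lt_trichotomy m n with h1 | h1 | h1
  · exact absurd he (key m n h1 hn)
  · exact h1
  · exact absurd he.symm (key n m h1 hm)

/-- The path traversed from its other end. -/
lemma reverse (h : IsLooseEdgePath E d p ε) :
    IsLooseEdgePath E d (fun n => p (d - n)) fun n => ε (d - 1 - n) where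
  left_mem n hn := by
    have := h.right_mem (d - 1 - n) (by omega)
    rwa [show d - 1 - n + 1 = d - n by omega] at this
  right_mem n hn := by
    have := h.left_mem (d - 1 - n) (by omega)
    rwa [show d - (n + 1) = d - 1 - n by omega]
  ne_succ n hn := by
    have := h.ne_succ (d - 1 - n) (by omega)
    rw [show d - 1 - n + 1 = d - n by omega] at this
    rw [show d - (n + 1) = d - 1 - n by omega]
    exact this.symm
  inter {m n v} hmn hn hm hv := by
    obtain ⟨h1, h2⟩ := h.inter (by omega : d - 1 - n < d - 1 - m) (by omega) hv hm
    refine ⟨by omega, ?_⟩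
    rw [h2]
    congr 1
    omega

end IsLooseEdgePath

/-- The vertices of a path: its first joint and the vertices of its edges. -/
def pathSupport (E : ι → Finset V) (d : ℕ) (p : ℕ → V) (ε : ℕ → ι) : Finset V :=
  insert (p 0) ((Finset.range d).biUnion fun n => E (ε n))

lemma mem_pathSupport {E : ι → Finset V} {d : ℕ} {p : ℕ → V} {ε : ℕ → ι} {v : V} :
    v ∈ pathSupport E d p ε ↔ v = p 0 ∨ ∃ n < d, v ∈ E (ε n) := by
  simp [pathSupport]

/-- A geodesic between two vertices at maximal distance is a loose path. -/
lemma exists_isLooseEdgePath {k r : ℕ} {H : Hypergraph V} {E : ι → Finset V}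
    (hE : IsEdgeFamily H r E) (hH : H.IsSupertree k) [Nonempty ι] :
    ∃ p ε, IsLooseEdgePath E H.diameter p ε := by
  have hconn : H.adjGraph.Connected := hH.connected
  have hne : Nonempty V := hconn.nonempty
  obtain ⟨u, w, huw⟩ := H.adjGraph.exists_dist_eq_diam
  obtain ⟨c, hc⟩ := hconn.exists_walk_length_eq_dist u w
  set d := H.diameter with hd
  have hcd : c.length = d := hc.trans huw
  have hstep : ∀ n < d, H.adjGraph.Adj (c.getVert n) (c.getVert (n + 1)) := fun n hn =>
    c.adj_getVert_succ (by omega)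
  have hdist : ∀ a b, a + b ≤ d → H.adjGraph.dist (c.getVert a) (c.getVert (a + b)) ≤ b := by
    intro a b
    induction b with
    | zero => simp
    | succ b ih =>
      intro hb
      have h1 := hconn.dist_triangle (u := c.getVert a) (v := c.getVert (a + b))
        (w := c.getVert (a + (b + 1)))
      have h2 := SimpleGraph.dist_eq_one_iff_adj.2 (hstep (a + b) (by omega))
      have h3 := ih (by omega)
      rw [show a + b + 1 = a + (b + 1) by ring] at h2
      omega
  have hgeo : ∀ a b, a + b ≤ d → b ≤ H.adjGraph.dist (c.getVert a) (c.getVert (a + b)) := by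
    intro a b hab
    have h1 := hconn.dist_triangle (u := u) (v := c.getVert a) (w := w)
    have h2 := hconn.dist_triangle (u := c.getVert a) (v := c.getVert (a + b)) (w := w)
    have h3 := hdist 0 a (by omega)
    have h4 := hdist (a + b) (d - (a + b)) (by omega)
    rw [zero_add, c.getVert_zero] at h3
    rw [show a + b + (d - (a + b)) = c.length by omega, c.getVert_length] at h4
    omega
  have hedge : ∀ {i v v'}, v ∈ E i → v' ∈ E i → H.adjGraph.dist v v' ≤ 1 := by
    intro i v v' h1 h2
    by_cases h : v = v'
    · rw [h]; simp
    · have hadj : H.adjGraph.Adj v v' :=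
        ⟨h, (E i : Set V), by rw [hE.edgeSet_eq]; exact ⟨i, rfl⟩, h1, h2⟩
      exact (SimpleGraph.dist_eq_one_iff_adj.2 hadj).le
  have hlab : ∀ n, ∃ i, n < d → c.getVert n ∈ E i ∧ c.getVert (n + 1) ∈ E i := by
    intro n
    by_cases hn : n < d
    · obtain ⟨-, e, he, h1, h2⟩ := hstep n hn
      rw [hE.edgeSet_eq] at he
      obtain ⟨i, rfl⟩ := he
      exact ⟨i, fun _ => ⟨h1, h2⟩⟩
    · exact ⟨Classical.arbitrary ι, fun h => absurd h hn⟩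
  choose ε hε using hlab
  refine ⟨c.getVert, ε, fun n hn => (hε n hn).1, fun n hn => (hε n hn).2,
    fun n hn => (hstep n hn).ne, fun {m n v} hmn hn hm hv => ?_⟩
  have h1 := hedge (hε m (by omega)).1 hm
  have h2 := hedge hv (hε n hn).2
  have h3 := hconn.dist_triangle (u := c.getVert m) (v := v) (w := c.getVert (n + 1))
  have h4 := hgeo m (n + 1 - m) (by omega)
  rw [show m + (n + 1 - m) = n + 1 by omega] at h4
  obtain rfl : n = m + 1 := by omega
  refine ⟨rfl, ?_⟩
  by_contra hne
  -- Two common vertices of two edges form a cycle of length two.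
  have hlabne : ε m ≠ ε (m + 1) := by
    intro h
    have h5 := hedge (hε m (by omega)).1 (h ▸ (hε (m + 1) hn).2)
    omega
  refine hH.acyclic ⟨2, fun j => if j = 1 then v else c.getVert (m + 1),
    fun j => if j = 0 then (E (ε m) : Set V) else (E (ε (m + 1)) : Set V), le_rfl, ?_, ?_, ?_, ?_⟩
  · intro a ha b hb hab
    simp only [Set.mem_Iio] at ha hb
    interval_cases a <;> interval_cases b <;> simp at hab <;> first | rfl | skip
    · exact absurd hab.symm hne
    · exact absurd hab hne
  · intro a ha b hb hab
    simp only [Set.mem_Iio] at ha hb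
    have h6 : (E (ε m) : Set V) ≠ E (ε (m + 1)) := fun h =>
      hlabne (hE.injective (Finset.coe_injective h))
    interval_cases a <;> interval_cases b <;> simp only [if_true, one_ne_zero, if_false] at hab <;>
      first | rfl | skip
    · exact absurd hab h6
    · exact absurd hab.symm h6
  · simp
  · intro j hj
    rw [hE.edgeSet_eq]
    interval_cases j
    · simp only [if_true, zero_ne_one, if_false, zero_add]
      exact ⟨⟨_, rfl⟩, (hε m (by omega)).2, hm⟩
    · simp only [if_true, one_ne_zero, if_false]
      exact ⟨⟨_, rfl⟩, hv, (hε (m + 1) hn).1⟩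

variable {r d : ℕ} {E : ι → Finset V} {p : ℕ → V} {ε : ℕ → ι} {y : V} {D : V → ℕ} {top : ι → V}

/-- The vertices of a path, rooted as part of a tree, all lie below the top of an edge of the path,
with at most one exception. -/
lemma IsRooting.eq_of_mem_pathSupport (hcard : ∀ i, (E i).card = r + 1)
    (hR : IsRooting E y D top) (hp : IsLooseEdgePath E d p ε) {u w : V}
    (hu : u ∈ pathSupport E d p ε) (hw : w ∈ pathSupport E d p ε)
    (hu' : ∀ n < d, u ∈ E (ε n) → u = top (ε n)) (hw' : ∀ n < d, w ∈ E (ε n) → w = top (ε n)) :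
    u = w := by
  set U := pathSupport E d p ε with hU
  set B := (Finset.range d).biUnion fun n => (E (ε n)).erase (top (ε n)) with hB
  have hBU : B ⊆ U := by
    intro v hv
    obtain ⟨n, hn, hv⟩ := Finset.mem_biUnion.1 hv
    exact mem_pathSupport.2 (.inr ⟨n, Finset.mem_range.1 hn, Finset.mem_of_mem_erase hv⟩)
  have hBcard : B.card = d * r := by
    rw [hB, Finset.card_biUnion]
    · rw [Finset.sum_congr rfl fun n _ => by
        rw [Finset.card_erase_of_mem (hR.top_mem _), hcard, Nat.add_sub_cancel], Finset.sum_const,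
        Finset.card_range, smul_eq_mul]
    · intro m hm n hn hmn
      rw [Function.onFun, Finset.disjoint_left]
      intro v hvm hvn
      rw [Finset.mem_erase] at hvm hvn
      exact hmn (hp.label_injOn (Finset.mem_range.1 hm) (Finset.mem_range.1 hn)
        (hR.parent_unique hvm.2 hvm.1 hvn.2 hvn.1))
  have hUcard : U.card ≤ d * r + 1 := by
    have hsub : U ⊆ insert (p 0) ((Finset.range d).biUnion fun n => (E (ε n)).erase (p n)) := by
      intro v hv
      rw [Finset.mem_insert, Finset.mem_biUnion]
      rcases mem_pathSupport.1 hv with rfl | ⟨n, hn, hv⟩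
      · exact .inl rfl
      · by_cases hvn : v = p n
        · subst hvn
          rcases n with _ | n
          · exact .inl rfl
          · exact .inr ⟨n, Finset.mem_range.2 (by omega), Finset.mem_erase.2
              ⟨(hp.ne_succ n (by omega)).symm, hp.right_mem n (by omega)⟩⟩
        · exact .inr ⟨n, Finset.mem_range.2 hn, Finset.mem_erase.2 ⟨hvn, hv⟩⟩
    refine (Finset.card_le_card hsub).trans ((Finset.card_insert_le _ _).trans ?_)
    refine Nat.add_le_add_right (Finset.card_biUnion_le.trans ?_) 1
    rw [Finset.sum_congr rfl fun n hn => by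
      rw [Finset.card_erase_of_mem (hp.left_mem n (Finset.mem_range.1 hn)), hcard,
        Nat.add_sub_cancel], Finset.sum_const, Finset.card_range, smul_eq_mul]
  have hdiff : (U \ B).card ≤ 1 := by
    rw [Finset.card_sdiff_of_subset hBU]
    omega
  have hnot : ∀ v, (∀ n < d, v ∈ E (ε n) → v = top (ε n)) → v ∉ B := by
    intro v hv hvB
    obtain ⟨n, hn, hvn⟩ := Finset.mem_biUnion.1 hvB
    exact Finset.ne_of_mem_erase hvn
      (hv n (Finset.mem_range.1 hn) (Finset.mem_of_mem_erase hvn))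
  exact Finset.card_le_one.1 hdiff u (Finset.mem_sdiff.2 ⟨hu, hnot u hu'⟩) w
    (Finset.mem_sdiff.2 ⟨hw, hnot w hw'⟩)

/-- A tree rooted on a path is a caterpillar if every edge off the path is attached to the path:
those edges are pendant, and the edges of the path, except possibly its two end edges, are not. -/
lemma isCaterpillar_of_top_mem {H : Hypergraph V} (hE : IsEdgeFamily H r E)
    (hR : IsRooting E y D top) (hp : IsLooseEdgePath E d p ε) (hy : y ∈ pathSupport E d p ε)
    (hoff : ∀ i, (∀ n < d, ε n ≠ i) → top i ∈ pathSupport E d p ε) : H.IsCaterpillar := by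
  classical
  have hnotmem : ∀ i v, (∀ n < d, ε n ≠ i) → v ∈ E i → v ≠ top i → v ∉ pathSupport E d p ε := by
    intro i v hi hv hvt hvU
    have h1 : v = y := by
      refine hR.eq_of_mem_pathSupport hE.card_eq hp hvU hy (fun n hn hvn => ?_)
        fun n _ hyn => (hR.root_top hyn).symm
      by_contra h
      exact hi n hn (hR.parent_unique hvn h hv hvt)
    rw [h1] at hv hvt
    exact hvt (hR.root_top hv).symm
  have hpend : ∀ i, (∀ n < d, ε n ≠ i) → H.IsPendantEdge (E i) := by
    intro i hi
    refine ⟨by rw [hE.edgeSet_eq]; exact ⟨i, rfl⟩, ?_⟩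
    refine Set.subsingleton_of_subset_singleton (a := top i) ?_
    rintro v ⟨hv, hdeg⟩
    by_contra hvt
    apply hdeg
    unfold Hypergraph.degree
    rw [Set.ncard_eq_one]
    refine ⟨(E i : Set V), ?_⟩
    ext e
    rw [Set.mem_singleton_iff]
    constructor
    · rintro ⟨he, hve⟩
      rw [hE.edgeSet_eq] at he
      obtain ⟨j, rfl⟩ := he
      by_cases hvj : v = top j
      · exfalso
        apply hnotmem i v hi hv hvt
        by_cases hj : ∀ n < d, ε n ≠ j
        · rw [hvj]; exact hoff j hj
        · push Not at hj
          obtain ⟨n, hn, rfl⟩ := hj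
          exact mem_pathSupport.2 (.inr ⟨n, hn, hve⟩)
      · rw [hR.parent_unique hv hvt hve hvj]
    · rintro rfl
      exact ⟨by rw [hE.edgeSet_eq]; exact ⟨i, rfl⟩, hv⟩
  have hEne : ∀ m n, m < n → n < d → (E (ε m) : Set V) ≠ E (ε n) := by
    intro m n hmn hn h
    have := hp.label_injOn (show m ∈ Set.Iio d from hmn.trans hn) hn
      (hE.injective (Finset.coe_injective h))
    omega
  have hdeg : ∀ n, 0 < n → n < d → H.degree (p n) ≠ 1 := by
    intro n hn0 hn h
    obtain ⟨n, rfl⟩ : ∃ m, n = m + 1 := ⟨n - 1, by omega⟩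
    unfold Hypergraph.degree at h
    rw [Set.ncard_eq_one] at h
    obtain ⟨a, ha⟩ := h
    have h1 : (E (ε n) : Set V) ∈ ({a} : Set (Set V)) := ha ▸
      ⟨by rw [hE.edgeSet_eq]; exact ⟨_, rfl⟩, hp.right_mem n (by omega)⟩
    have h2 : (E (ε (n + 1)) : Set V) ∈ ({a} : Set (Set V)) := ha ▸
      ⟨by rw [hE.edgeSet_eq]; exact ⟨_, rfl⟩, hp.left_mem (n + 1) hn⟩
    rw [Set.mem_singleton_iff] at h1 h2
    exact hEne n (n + 1) (by omega) hn (h1.trans h2.symm)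
  have hnonpend : ∀ n, 0 < n → n + 1 < d → ¬ H.IsPendantEdge (E (ε n)) := by
    intro n hn0 hn h
    exact hp.ne_succ n (by omega) (h.2 ⟨hp.left_mem n (by omega), hdeg n hn0 (by omega)⟩
      ⟨hp.right_mem n (by omega), hdeg (n + 1) (by omega) hn⟩)
  set lo := if H.IsPendantEdge (E (ε 0)) then 1 else 0 with hlo
  set hi := if H.IsPendantEdge (E (ε (d - 1))) then d - 1 else d with hhi
  have hid : hi ≤ d := by rw [hhi]; split_ifs <;> omega
  refine ⟨hi - lo, fun j => E (ε (lo + j)), ?_, ?_, ?_⟩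
  · intro a b hab
    have := hp.label_injOn (show lo + a ∈ Set.Iio d by simp only [Set.mem_Iio]; omega)
      (show lo + b ∈ Set.Iio d by simp only [Set.mem_Iio]; omega)
      (hE.injective (Finset.coe_injective hab))
    exact Fin.ext (by omega)
  · ext e
    constructor
    · rintro ⟨j, rfl⟩
      refine ⟨by rw [hE.edgeSet_eq]; exact ⟨_, rfl⟩, fun hpe => ?_⟩
      have hj := j.2
      simp only at hpe
      by_cases h0 : lo + (j : ℕ) = 0
      · rw [h0] at hpe
        rw [if_pos hpe] at hlo
        omega
      · by_cases h1 : lo + (j : ℕ) + 1 < d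
        · exact hnonpend _ (by omega) h1 hpe
        · have h2 : lo + (j : ℕ) = d - 1 := by omega
          rw [h2] at hpe
          rw [if_pos hpe] at hhi
          omega
    · rintro ⟨he, hpe⟩
      rw [hE.edgeSet_eq] at he
      obtain ⟨i, rfl⟩ := he
      have : ∃ n < d, ε n = i := by
        by_contra h
        push Not at h
        exact hpe (hpend i h)
      obtain ⟨n, hn, rfl⟩ := this
      have h1 : lo ≤ n := by
        rw [hlo]
        split_ifs with h
        · by_contra h0
          obtain rfl : n = 0 := by omega
          exact hpe h
        · omega
      have h2 : n < hi := by
        rw [hhi]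
        split_ifs with h
        · by_contra h0
          obtain rfl : n = d - 1 := by omega
          exact hpe h
        · exact hn
      refine ⟨⟨n - lo, by omega⟩, ?_⟩
      simp only [Nat.add_sub_cancel' h1]
  · intro a b hab
    have hab' : (a : ℕ) < b := hab
    have hb := b.2
    split_ifs with h
    · rw [Set.ncard_eq_one]
      refine ⟨p (lo + b), ?_⟩
      ext v
      rw [Set.mem_singleton_iff]
      constructor
      · rintro ⟨h1, h2⟩
        exact (hp.inter (by omega) (by omega) h1 h2).2
      · rintro rfl
        refine ⟨?_, hp.left_mem _ (by omega)⟩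
        rw [← h, ← add_assoc]
        exact hp.right_mem _ (by omega)
    · rw [Set.ncard_eq_zero]
      rw [Set.eq_empty_iff_forall_notMem]
      rintro v ⟨h1, h2⟩
      have := (hp.inter (by omega) (by omega) h1 h2).1
      omega

end Path

/-! ### Replacing and exchanging vertices of edges -/

section Replace

variable {V ι : Type*} [Fintype V] [DecidableEq V] [Fintype ι]

/-- The edge `s` with its vertex `u` replaced by `w`. -/
def replaceVertex (s : Finset V) (u w : V) : Finset V := insert w (s.erase u)

lemma mem_replaceVertex {s : Finset V} {u w v : V} :
    v ∈ replaceVertex s u w ↔ v = w ∨ v ≠ u ∧ v ∈ s := by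
  simp [replaceVertex]

lemma mem_replaceVertex_of_ne {s : Finset V} {u w v : V} (hv : v ∈ s) (h : v ≠ u) :
    v ∈ replaceVertex s u w := mem_replaceVertex.2 (.inr ⟨h, hv⟩)

lemma mem_replaceVertex_self {s : Finset V} {u w : V} : w ∈ replaceVertex s u w :=
  mem_replaceVertex.2 (.inl rfl)

lemma replaceVertex_self {s : Finset V} {u : V} (hu : u ∈ s) : replaceVertex s u u = s :=
  Finset.insert_erase hu

lemma card_replaceVertex {s : Finset V} {u w : V} (hu : u ∈ s) (hw : w ∈ s → w = u) :
    (replaceVertex s u w).card = s.card := by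
  unfold replaceVertex
  rw [Finset.card_insert_of_notMem, Finset.card_erase_add_one hu]
  intro h
  exact Finset.ne_of_mem_erase h (hw (Finset.mem_of_mem_erase h))

lemma erase_replaceVertex {s : Finset V} {u w : V} (hw : w ∈ s → w = u) :
    (replaceVertex s u w).erase w = s.erase u := by
  unfold replaceVertex
  rw [Finset.erase_insert]
  intro h
  exact Finset.ne_of_mem_erase h (hw (Finset.mem_of_mem_erase h))

variable {r : ℕ} {α : ℝ} {x : V → ℝ}

lemma edgeTerm_eq_of_mem {s : Finset V} {u : V} (hu : u ∈ s) :
    edgeTerm r α x s = α * (x u ^ (r + 1) + ∑ v ∈ s.erase u, x v ^ (r + 1)) +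
      (1 - α) * (r + 1) * (x u * ∏ v ∈ s.erase u, x v) := by
  rw [Finset.add_sum_erase s (fun v => x v ^ (r + 1)) hu, Finset.mul_prod_erase s x hu]
  rfl

lemma edgeTerm_replaceVertex {s : Finset V} {u w : V} (hw : w ∈ s → w = u) :
    edgeTerm r α x (replaceVertex s u w) =
      α * (x w ^ (r + 1) + ∑ v ∈ s.erase u, x v ^ (r + 1)) +
      (1 - α) * (r + 1) * (x w * ∏ v ∈ s.erase u, x v) := by
  rw [edgeTerm_eq_of_mem mem_replaceVertex_self, erase_replaceVertex hw]

lemma edgeTerm_le_replaceVertex (hα0 : 0 ≤ α) (hα1 : α < 1) (hx : ∀ v, 0 < x v) {s : Finset V}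
    {u w : V} (hu : u ∈ s) (hw : w ∈ s → w = u) (h : x u ≤ x w) :
    edgeTerm r α x s ≤ edgeTerm r α x (replaceVertex s u w) := by
  rw [edgeTerm_eq_of_mem hu, edgeTerm_replaceVertex hw]
  have h1 : (0 : ℝ) ≤ (1 - α) * (r + 1) := mul_nonneg (by linarith) (by positivity)
  have h2 : 0 ≤ ∏ v ∈ s.erase u, x v := Finset.prod_nonneg fun v _ => (hx v).le
  have h3 : x u ^ (r + 1) ≤ x w ^ (r + 1) := pow_le_pow_left₀ (hx u).le h _
  gcongr

lemma edgeGrad_of_mem {s : Finset V} {v : V} (hv : v ∈ s) :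
    edgeGrad r α x s v = α * x v ^ r + (1 - α) * ∏ u ∈ s.erase v, x u := if_pos hv

lemma edgeGrad_of_notMem {s : Finset V} {v : V} (hv : v ∉ s) : edgeGrad r α x s v = 0 := if_neg hv

lemma edgeGrad_nonneg (hα0 : 0 ≤ α) (hα1 : α < 1) (hx : ∀ v, 0 < x v) (s : Finset V) (v : V) :
    0 ≤ edgeGrad r α x s v := by
  unfold edgeGrad
  split_ifs
  · have h1 : (0 : ℝ) ≤ 1 - α := by linarith
    have h2 : 0 ≤ ∏ u ∈ s.erase v, x u := Finset.prod_nonneg fun u _ => (hx u).le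
    have h3 := (hx v).le
    positivity
  · exact le_rfl

lemma edgeGrad_pos (hα0 : 0 ≤ α) (hα1 : α < 1) (hx : ∀ v, 0 < x v) {s : Finset V} {v : V}
    (hv : v ∈ s) : 0 < edgeGrad r α x s v := by
  rw [edgeGrad_of_mem hv]
  have h1 : (0 : ℝ) < 1 - α := by linarith
  have h2 : 0 < ∏ u ∈ s.erase v, x u := Finset.prod_pos fun u _ => hx u
  have h3 := hx v
  positivity

lemma edgeGrad_replaceVertex_self {s : Finset V} {u w : V} (hw : w ∈ s → w = u) :
    edgeGrad r α x (replaceVertex s u w) w = α * x w ^ r + (1 - α) * ∏ v ∈ s.erase u, x v := by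
  rw [edgeGrad_of_mem mem_replaceVertex_self, erase_replaceVertex hw]

lemma edgeGrad_le_replaceVertex_self (hα0 : 0 ≤ α) (hα1 : α < 1) (hx : ∀ v, 0 < x v)
    {s : Finset V} {u w : V} (hu : u ∈ s) (hw : w ∈ s → w = u) :
    edgeGrad r α x s w ≤ edgeGrad r α x (replaceVertex s u w) w := by
  by_cases h : w ∈ s
  · rw [hw h, replaceVertex_self hu]
  · rw [edgeGrad_of_notMem h]
    exact edgeGrad_nonneg hα0 hα1 hx _ _

lemma prod_erase_erase {s : Finset V} {u v : V} (hu : u ∈ s) (hv : v ≠ u) :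
    ∏ t ∈ s.erase v, x t = x u * ∏ t ∈ (s.erase u).erase v, x t := by
  rw [← Finset.mul_prod_erase (s.erase v) x (Finset.mem_erase.2 ⟨hv.symm, hu⟩),
    Finset.erase_right_comm]

lemma edgeGrad_replaceVertex_of_ne {s : Finset V} {u w v : V} (hw : w ∈ s → w = u) (hv : v ∈ s)
    (hvu : v ≠ u) (hvw : v ≠ w) : edgeGrad r α x (replaceVertex s u w) v =
      α * x v ^ r + (1 - α) * (x w * ∏ t ∈ (s.erase u).erase v, x t) := by
  rw [edgeGrad_of_mem (mem_replaceVertex_of_ne hv hvu),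
    prod_erase_erase (mem_replaceVertex_self) hvw, erase_replaceVertex hw]

lemma edgeGrad_le_replaceVertex (hα1 : α < 1) (hx : ∀ v, 0 < x v) {s : Finset V} {u w v : V}
    (hu : u ∈ s) (hw : w ∈ s → w = u) (h : x u ≤ x w) (hv : v ∈ s) (hvu : v ≠ u) (hvw : v ≠ w) :
    edgeGrad r α x s v ≤ edgeGrad r α x (replaceVertex s u w) v := by
  rw [edgeGrad_replaceVertex_of_ne hw hv hvu hvw, edgeGrad_of_mem hv, prod_erase_erase hu hvu]
  have h1 : (0 : ℝ) ≤ 1 - α := by linarith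
  have h2 : 0 ≤ ∏ t ∈ (s.erase u).erase v, x t := Finset.prod_nonneg fun t _ => (hx t).le
  gcongr

variable [DecidableEq ι]

/-- The edge family in which the vertex `u` of `E a` and the vertex `w` of `E b` are exchanged. -/
def exchangeVertices (E : ι → Finset V) (a b : ι) (u w : V) : ι → Finset V :=
  Function.update (Function.update E a (replaceVertex (E a) u w)) b (replaceVertex (E b) w u)

lemma sum_update_apply {E : ι → Finset V} (a : ι) (s : Finset V) (g : Finset V → ℝ) :
    ∑ j, g (Function.update E a s j) = ∑ j, g (E j) - g (E a) + g s := by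
  rw [← Finset.add_sum_erase _ _ (Finset.mem_univ a),
    ← Finset.add_sum_erase _ (fun j => g (E j)) (Finset.mem_univ a), Function.update_self,
    Finset.sum_congr rfl fun j hj => by rw [Function.update_of_ne (Finset.ne_of_mem_erase hj)]]
  ring

lemma sum_exchangeVertices {E : ι → Finset V} {a b : ι} (hab : a ≠ b) (u w : V)
    (g : Finset V → ℝ) : ∑ j, g (exchangeVertices E a b u w j) =
      ∑ j, g (E j) - g (E a) - g (E b) + g (replaceVertex (E a) u w) +
        g (replaceVertex (E b) w u) := by
  unfold exchangeVertices
  rw [sum_update_apply, sum_update_apply, Function.update_of_ne hab.symm]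
  ring

/-- The sums of powers in the form are not affected by an exchange, only the products are. -/
lemma edgeForm_exchangeVertices {E : ι → Finset V} {a b : ι} (hab : a ≠ b) {u w : V}
    (hua : u ∈ E a) (hwb : w ∈ E b) (hub : u ∉ E b) (hwa : w ∉ E a) :
    edgeForm r α (exchangeVertices E a b u w) x = edgeForm r α E x +
      (1 - α) * (r + 1) * ((x w - x u) *
        (∏ v ∈ (E a).erase u, x v - ∏ v ∈ (E b).erase w, x v)) := by
  unfold edgeForm
  rw [sum_exchangeVertices hab, edgeTerm_eq_of_mem hua, edgeTerm_eq_of_mem hwb,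
    edgeTerm_replaceVertex fun h => absurd h hwa, edgeTerm_replaceVertex fun h => absurd h hub]
  ring

lemma exchangeVertices_left {E : ι → Finset V} {a b : ι} (hab : a ≠ b) (u w : V) :
    exchangeVertices E a b u w a = replaceVertex (E a) u w := by
  rw [exchangeVertices, Function.update_of_ne hab, Function.update_self]

lemma exchangeVertices_right {E : ι → Finset V} {a b : ι} (u w : V) :
    exchangeVertices E a b u w b = replaceVertex (E b) w u := by
  rw [exchangeVertices, Function.update_self]

lemma exchangeVertices_of_ne {E : ι → Finset V} {a b j : ι} (ha : j ≠ a) (hb : j ≠ b) (u w : V) :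
    exchangeVertices E a b u w j = E j := by
  rw [exchangeVertices, Function.update_of_ne hb, Function.update_of_ne ha]

lemma card_exchangeVertices {E : ι → Finset V} {a b : ι} (hab : a ≠ b) {u w : V}
    (hua : u ∈ E a) (hwb : w ∈ E b) (hub : u ∉ E b) (hwa : w ∉ E a) (j : ι) :
    (exchangeVertices E a b u w j).card = (E j).card := by
  by_cases ha : j = a
  · subst ha
    rw [exchangeVertices_left hab, card_replaceVertex hua fun h => absurd h hwa]
  by_cases hb : j = b
  · subst hb
    rw [exchangeVertices_right, card_replaceVertex hwb fun h => absurd h hub]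
  rw [exchangeVertices_of_ne ha hb]

lemma exists_mem_exchangeVertices {E : ι → Finset V} {a b : ι} (hab : a ≠ b) (u w : V) {v : V}
    {j : ι} (hv : v ∈ E j) : ∃ j, v ∈ exchangeVertices E a b u w j := by
  by_cases hu : v = u
  · exact ⟨b, by rw [exchangeVertices_right, hu]; exact mem_replaceVertex_self⟩
  by_cases hw : v = w
  · exact ⟨a, by rw [exchangeVertices_left hab, hw]; exact mem_replaceVertex_self⟩
  by_cases ha : j = a
  · subst ha
    exact ⟨j, by rw [exchangeVertices_left hab]; exact mem_replaceVertex_of_ne hv hu⟩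
  by_cases hb : j = b
  · subst hb
    exact ⟨j, by rw [exchangeVertices_right]; exact mem_replaceVertex_of_ne hv hw⟩
  exact ⟨j, by rwa [exchangeVertices_of_ne ha hb]⟩

end Replace

/-! ### Balancing a path by reversing a segment -/

section Balance

variable {V ι : Type*} [Fintype V] [DecidableEq V] [Fintype ι]

/-- The edges `E (ε 0), …, E (ε (d - 1))` link `q 0, …, q d` in succession. -/
structure IsEdgeWalk (E : ι → Finset V) (d : ℕ) (q : ℕ → V) (ε : ℕ → ι) : Prop where
  left_mem : ∀ n < d, q n ∈ E (ε n)
  right_mem : ∀ n < d, q (n + 1) ∈ E (ε n)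
  ne_succ : ∀ n < d, q n ≠ q (n + 1)
  label_injOn : Set.InjOn ε (Set.Iio d)

lemma IsLooseEdgePath.isEdgeWalk {E : ι → Finset V} {d : ℕ} {p : ℕ → V} {ε : ℕ → ι}
    (h : IsLooseEdgePath E d p ε) : IsEdgeWalk E d p ε :=
  ⟨h.left_mem, h.right_mem, h.ne_succ, h.label_injOn⟩

/-- `E'` results from `E` by changing edges of the path with labels `ε 0, …, ε (d - 1)` only, so
that these edges link the vertices `q 0, …, q d`, with `z` in position `c`; the form at `x` and the
gradient at `z` do not decrease. -/
structure IsRerouting (r : ℕ) (α : ℝ) (x : V → ℝ) (d : ℕ) (E : ι → Finset V) (ε : ℕ → ι) (z : V)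
    (c : ℕ) (E' : ι → Finset V) (q : ℕ → V) (ε' : ℕ → ι) : Prop where
  walk : IsEdgeWalk E' d q ε'
  center : q c = z
  label_mem : ∀ n < d, ∃ n' < d, ε' n = ε n'
  eq_of_ne : ∀ j, (∀ n < d, ε n ≠ j) → E' j = E j
  card_eq : ∀ j, (E' j).card = (E j).card
  exists_mem : ∀ v, (∃ j, v ∈ E j) → ∃ j, v ∈ E' j
  form_le : edgeForm r α E x ≤ edgeForm r α E' x
  grad_le : ∑ j, edgeGrad r α x (E j) z ≤ ∑ j, edgeGrad r α x (E' j) z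

/-- The family `E'` is better than `E` at `x`: its form is larger at `x`, or the gradients
of the two forms at `x` differ, so that `x` is not a Perron vector of both for the same
eigenvalue. -/
def IsStrictChange (r : ℕ) (α : ℝ) (x : V → ℝ) (E E' : ι → Finset V) : Prop :=
  edgeForm r α E x < edgeForm r α E' x ∨
    ∃ v, ∑ j, edgeGrad r α x (E' j) v ≠ ∑ j, edgeGrad r α x (E j) v

variable {r d : ℕ} {α : ℝ} {x : V → ℝ} {E : ι → Finset V} {p : ℕ → V} {ε : ℕ → ι}

/-- The segment of the path between the positions `i - j` and `c + j` is reversed, where `j` is the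
first index at which this does not decrease the form. Reversing exchanges either the inner joints
`p (i - j)`, `p (c + j)` or the outer joints `p (i - j - 1)`, `p (c + j + 1)` of the two edges at
the ends of the segment. If none of the two is favourable, then the outer joints compare in the same
way as the inner ones, and `j` is increased. -/
lemma exists_isRerouting_of_lt (hα0 : 0 ≤ α) (hα1 : α < 1) (hx : ∀ v, 0 < x v)
    (hp : IsLooseEdgePath E d p ε) {i c : ℕ} (hic : i < c) (hd : i + c < d) (j : ℕ) (hj : j ≤ i)
    (hlt : x (p (c + j)) < x (p (i - j))) :
    ∃ E' q ε', IsRerouting r α x d E ε (p i) c E' q ε' ∧ IsStrictChange r α x E E' := by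
  classical
  have h1α : (0 : ℝ) < 1 - α := by linarith
  have hfac : (0 : ℝ) < (1 - α) * (r + 1) := by positivity
  have hpinj : ∀ {m n}, m ≤ d → n ≤ d → m ≠ n → p m ≠ p n := fun hm hn hmn h =>
    hmn (hp.joint_injOn hm hn h)
  have hεinj : ∀ {m n}, m < d → n < d → m ≠ n → ε m ≠ ε n := fun hm hn hmn h =>
    hmn (hp.label_injOn hm hn h)
  have hmem : ∀ {m n}, m ≤ d → n < d → (m = n ∨ m = n + 1) → p m ∈ E (ε n) :=
    fun hm hn h => (hp.mem_iff hm hn).2 h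
  have hnmem : ∀ {m n}, m ≤ d → n < d → ¬ (m = n ∨ m = n + 1) → p m ∉ E (ε n) :=
    fun hm hn h h' => h ((hp.mem_iff hm hn).1 h')
  -- The gradient at the center is not affected by an edge that does not contain it.
  have hz0 : ∀ {n}, n < d → ¬ (i = n ∨ i = n + 1) → edgeGrad r α x (E (ε n)) (p i) = 0 :=
    fun hn h => edgeGrad_of_notMem (hnmem (by omega) hn h)
  have hz0' : ∀ {n m m'}, n < d → ¬ (i = n ∨ i = n + 1) → m' ≤ d → i ≠ m' →
      edgeGrad r α x (replaceVertex (E (ε n)) (p m) (p m')) (p i) = 0 := by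
    intro n m m' hn h hm' hne
    refine edgeGrad_of_notMem fun hmem' => ?_
    rcases mem_replaceVertex.1 hmem' with h1 | ⟨-, h1⟩
    · exact hpinj (by omega) hm' hne h1
    · exact hnmem (by omega) hn h h1
  -- The vertices and labels of the path with the segment between `i - j` and `c + j` reversed.
  set q : ℕ → V := fun n => p (if i - j ≤ n ∧ n ≤ c + j then i + c - n else n) with hq
  have hqne : ∀ n < d, q n ≠ q (n + 1) := by
    intro n hn
    refine hpinj ?_ ?_ ?_ <;> split_ifs <;> omega
  have hqc : q c = p i := by
    simp only [hq]
    rw [if_pos (by omega), Nat.add_sub_cancel]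
  set ε₁ : ℕ → ι := fun n => ε (if i - j ≤ n ∧ n < c + j then i + c - 1 - n else n) with hε₁
  set ε₂ : ℕ → ι := fun n => ε (if i ≤ n + j + 1 ∧ n ≤ c + j then i + c - 1 - n else n) with hε₂
  have hε₁inj : Set.InjOn ε₁ (Set.Iio d) := by
    intro m hm n hn hmn
    simp only [Set.mem_Iio] at hm hn
    by_contra hne
    refine hεinj ?_ ?_ ?_ hmn <;> split_ifs <;> omega
  have hε₁mem : ∀ n < d, ∃ n' < d, ε₁ n = ε n' :=
    fun n hn => ⟨_, by split_ifs <;> omega, rfl⟩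
  obtain rfl | hji := hj.eq_or_lt
  · -- The segment starts at an end of the path.
    have hb : c + j < d := by omega
    have hend : p 0 ∈ E (ε (c + j)) → p 0 = p (c + j) := fun h =>
      absurd h (hnmem (by omega) hb (by omega))
    rw [Nat.sub_self] at hlt
    set E' : ι → Finset V := Function.update E (ε (c + j))
      (replaceVertex (E (ε (c + j))) (p (c + j)) (p 0)) with hE'
    have hE'b : E' (ε (c + j)) = replaceVertex (E (ε (c + j))) (p (c + j)) (p 0) :=
      Function.update_self _ _ _
    have hgen : ∀ m n, n < d → m ≤ d → ((n ≠ c + j ∧ (m = n ∨ m = n + 1)) ∨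
        (n = c + j ∧ (m = 0 ∨ m = c + j + 1))) → p m ∈ E' (ε n) := by
      rintro m n hn hm (⟨h1, h2⟩ | ⟨rfl, rfl | rfl⟩)
      · rw [hE', Function.update_of_ne (hεinj hn hb h1)]
        exact hmem hm hn h2
      · rw [hE'b]; exact mem_replaceVertex_self
      · rw [hE'b]
        exact mem_replaceVertex_of_ne (hmem hm hn (by omega)) (hpinj hm (by omega) (by omega))
    refine ⟨E', q, ε₁, ⟨⟨?_, ?_, hqne, hε₁inj⟩, hqc, hε₁mem, ?_, ?_, ?_, ?_, ?_⟩, .inr ⟨p 0, ?_⟩⟩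
    · intro n hn
      simp only [hq, hε₁]
      apply hgen <;> split_ifs <;> omega
    · intro n hn
      simp only [hq, hε₁]
      apply hgen <;> split_ifs <;> omega
    · intro k hk
      exact Function.update_of_ne (hk _ hb).symm _ _
    · intro k
      by_cases hk : k = ε (c + j)
      · rw [hk, hE'b, card_replaceVertex (hmem (by omega) hb (by omega)) hend]
      · rw [hE', Function.update_of_ne hk]
    · rintro v ⟨k, hk⟩
      by_cases hv : v = p (c + j)
      · refine ⟨ε (c + j - 1), ?_⟩
        rw [hv]
        exact hgen _ _ (by omega) (by omega) (by omega)
      · by_cases hkb : k = ε (c + j)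
        · refine ⟨k, ?_⟩
          rw [hkb, hE'b]
          exact mem_replaceVertex_of_ne (hkb ▸ hk) hv
        · exact ⟨k, by rwa [hE', Function.update_of_ne hkb]⟩
    · unfold edgeForm
      rw [hE', sum_update_apply _ _ (edgeTerm r α x)]
      have := edgeTerm_le_replaceVertex (r := r) hα0 hα1 hx (hmem (by omega) hb (by omega)) hend
        hlt.le
      linarith
    · rw [hE', sum_update_apply _ _ fun s => edgeGrad r α x s (p j)]
      have : edgeGrad r α x (E (ε (c + j))) (p j) = 0 := hz0 hb (by omega)
      have := edgeGrad_nonneg (r := r) hα0 hα1 hx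
        (replaceVertex (E (ε (c + j))) (p (c + j)) (p 0)) (p j)
      linarith
    · rw [hE', sum_update_apply _ _ fun s => edgeGrad r α x s (p 0)]
      have h1 : edgeGrad r α x (E (ε (c + j))) (p 0) = 0 :=
        edgeGrad_of_notMem (hnmem (by omega) hb (by omega))
      have h2 : 0 < edgeGrad r α x (replaceVertex (E (ε (c + j))) (p (c + j)) (p 0)) (p 0) :=
        edgeGrad_pos hα0 hα1 hx mem_replaceVertex_self
      intro h
      linarith
  · set a := i - j - 1 with ha
    have hb : c + j < d := by omega
    have ha' : i - j = a + 1 := by omega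
    have hab : ε a ≠ ε (c + j) := hεinj (by omega) hb (by omega)
    rw [ha'] at hlt
    have hu0 : p (a + 1) ∈ E (ε a) := hmem (by omega) (by omega) (by omega)
    have hu1 : p a ∈ E (ε a) := hmem (by omega) (by omega) (by omega)
    have hw0 : p (c + j) ∈ E (ε (c + j)) := hmem (by omega) (by omega) (by omega)
    have hw1 : p (c + j + 1) ∈ E (ε (c + j)) := hmem (by omega) (by omega) (by omega)
    have hu0' : p (a + 1) ∉ E (ε (c + j)) := hnmem (by omega) (by omega) (by omega)
    have hu1' : p a ∉ E (ε (c + j)) := hnmem (by omega) (by omega) (by omega)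
    have hw0' : p (c + j) ∉ E (ε a) := hnmem (by omega) (by omega) (by omega)
    have hw1' : p (c + j + 1) ∉ E (ε a) := hnmem (by omega) (by omega) (by omega)
    have hu10 : p a ≠ p (a + 1) := hpinj (by omega) (by omega) (by omega)
    have hw10 : p (c + j + 1) ≠ p (c + j) := hpinj (by omega) (by omega) (by omega)
    by_cases hQ : ∏ v ∈ (E (ε a)).erase (p (a + 1)), x v ≤
        ∏ v ∈ (E (ε (c + j))).erase (p (c + j)), x v
    · -- Exchange the inner joints.
      have hgen : ∀ m n, n < d → m ≤ d → ((n ≠ a ∧ n ≠ c + j ∧ (m = n ∨ m = n + 1)) ∨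
          (n = a ∧ (m = a ∨ m = c + j)) ∨ (n = c + j ∧ (m = a + 1 ∨ m = c + j + 1))) →
          p m ∈ exchangeVertices E (ε a) (ε (c + j)) (p (a + 1)) (p (c + j)) (ε n) := by
        rintro m n hn hm (⟨h1, h2, h3⟩ | ⟨rfl, rfl | rfl⟩ | ⟨rfl, rfl | rfl⟩)
        · rw [exchangeVertices_of_ne (hεinj hn (by omega) h1) (hεinj hn hb h2)]
          exact hmem hm hn h3
        · rw [exchangeVertices_left hab]
          exact mem_replaceVertex_of_ne hu1 hu10
        · rw [exchangeVertices_left hab]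
          exact mem_replaceVertex_self
        · rw [exchangeVertices_right]
          exact mem_replaceVertex_self
        · rw [exchangeVertices_right]
          exact mem_replaceVertex_of_ne hw1 hw10
      refine ⟨exchangeVertices E (ε a) (ε (c + j)) (p (a + 1)) (p (c + j)), q, ε₁,
        ⟨⟨?_, ?_, hqne, hε₁inj⟩, hqc, hε₁mem, ?_, ?_, ?_, ?_, ?_⟩, .inr ⟨p a, ?_⟩⟩
      · intro n hn
        simp only [hq, hε₁]
        apply hgen <;> split_ifs <;> omega
      · intro n hn
        simp only [hq, hε₁]
        apply hgen <;> split_ifs <;> omega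
      · intro k hk
        exact exchangeVertices_of_ne (hk a (by omega)).symm (hk _ hb).symm _ _
      · exact card_exchangeVertices hab hu0 hw0 hu0' hw0'
      · rintro v ⟨k, hk⟩
        exact exists_mem_exchangeVertices hab _ _ hk
      · rw [edgeForm_exchangeVertices hab hu0 hw0 hu0' hw0']
        have := mul_nonneg hfac.le (mul_nonneg_of_nonpos_of_nonpos (sub_nonpos.2 hlt.le)
          (sub_nonpos.2 hQ))
        linarith
      · rw [sum_exchangeVertices hab _ _ fun s => edgeGrad r α x s (p i)]
        rcases Nat.eq_zero_or_pos j with rfl | hj0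
        · have hia : i = a + 1 := by omega
          rw [hia, edgeGrad_of_mem hu0, edgeGrad_of_notMem hu0',
            edgeGrad_replaceVertex_self fun h => absurd h hu0']
          have := mul_le_mul_of_nonneg_left hQ h1α.le
          have := edgeGrad_nonneg (r := r) hα0 hα1 hx
            (replaceVertex (E (ε a)) (p (a + 1)) (p (c + 0))) (p (a + 1))
          linarith
        · rw [hz0 (by omega) (by omega), hz0 (by omega) (by omega),
            hz0' (by omega) (by omega) (by omega) (by omega),
            hz0' (by omega) (by omega) (by omega) (by omega)]
          simp
      · have h0 : p a ∉ replaceVertex (E (ε (c + j))) (p (c + j)) (p (a + 1)) := fun h => by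
          rcases mem_replaceVertex.1 h with h | ⟨-, h⟩
          · exact hu10 h
          · exact hu1' h
        rw [sum_exchangeVertices hab _ _ fun s => edgeGrad r α x s (p a),
          edgeGrad_of_notMem hu1', edgeGrad_of_notMem h0,
          edgeGrad_replaceVertex_of_ne (fun h => absurd h hw0') hu1 hu10 (by
            exact hpinj (by omega) (by omega) (by omega)),
          edgeGrad_of_mem hu1, prod_erase_erase hu0 hu10]
        have h1 : 0 < ∏ t ∈ ((E (ε a)).erase (p (a + 1))).erase (p a), x t :=
          Finset.prod_pos fun t _ => hx t
        have h2 := mul_lt_mul_of_pos_left (mul_lt_mul_of_pos_right hlt h1) h1α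
        intro h
        linarith
    · push Not at hQ
      rcases le_or_gt (x (p a)) (x (p (c + j + 1))) with hle | hgt
      · -- Exchange the outer joints.
        have hQ' : ∏ v ∈ (E (ε (c + j))).erase (p (c + j + 1)), x v <
            ∏ v ∈ (E (ε a)).erase (p a), x v := by
          rw [prod_erase_erase hu0 hu10, prod_erase_erase hw0 hw10]
          rw [← Finset.mul_prod_erase _ x (Finset.mem_erase.2 ⟨hu10, hu1⟩),
            ← Finset.mul_prod_erase _ x (Finset.mem_erase.2 ⟨hw10, hw1⟩)] at hQ
          set A := ∏ t ∈ ((E (ε a)).erase (p (a + 1))).erase (p a), x t with hA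
          set B := ∏ t ∈ ((E (ε (c + j))).erase (p (c + j))).erase (p (c + j + 1)), x t with hB
          have hA0 : 0 < A := Finset.prod_pos fun t _ => hx t
          have h1 : B < A := by
            by_contra h
            have := mul_le_mul hle (not_lt.1 h) hA0.le (hx _).le
            linarith
          exact mul_lt_mul'' hlt h1 (hx _).le (Finset.prod_nonneg fun t _ => (hx t).le)
        have hgen : ∀ m n, n < d → m ≤ d → ((n ≠ a ∧ n ≠ c + j ∧ (m = n ∨ m = n + 1)) ∨
            (n = a ∧ (m = a + 1 ∨ m = c + j + 1)) ∨ (n = c + j ∧ (m = a ∨ m = c + j))) →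
            p m ∈ exchangeVertices E (ε a) (ε (c + j)) (p a) (p (c + j + 1)) (ε n) := by
          rintro m n hn hm (⟨h1, h2, h3⟩ | ⟨rfl, rfl | rfl⟩ | ⟨rfl, rfl | rfl⟩)
          · rw [exchangeVertices_of_ne (hεinj hn (by omega) h1) (hεinj hn hb h2)]
            exact hmem hm hn h3
          · rw [exchangeVertices_left hab]
            exact mem_replaceVertex_of_ne hu0 hu10.symm
          · rw [exchangeVertices_left hab]
            exact mem_replaceVertex_self
          · rw [exchangeVertices_right]
            exact mem_replaceVertex_self
          · rw [exchangeVertices_right]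
            exact mem_replaceVertex_of_ne hw0 hw10.symm
        refine ⟨exchangeVertices E (ε a) (ε (c + j)) (p a) (p (c + j + 1)), q, ε₂,
          ⟨⟨?_, ?_, hqne, ?_⟩, hqc, ?_, ?_, ?_, ?_, ?_, ?_⟩, .inr ⟨p a, ?_⟩⟩
        · intro n hn
          simp only [hq, hε₂]
          apply hgen <;> split_ifs <;> omega
        · intro n hn
          simp only [hq, hε₂]
          apply hgen <;> split_ifs <;> omega
        · intro m hm n hn hmn
          simp only [Set.mem_Iio] at hm hn
          by_contra hne
          refine hεinj ?_ ?_ ?_ hmn <;> split_ifs <;> omega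
        · exact fun n hn => ⟨_, by split_ifs <;> omega, rfl⟩
        · intro k hk
          exact exchangeVertices_of_ne (hk a (by omega)).symm (hk _ hb).symm _ _
        · exact card_exchangeVertices hab hu1 hw1 hu1' hw1'
        · rintro v ⟨k, hk⟩
          exact exists_mem_exchangeVertices hab _ _ hk
        · rw [edgeForm_exchangeVertices hab hu1 hw1 hu1' hw1']
          have := mul_nonneg hfac.le (mul_nonneg (sub_nonneg.2 hle) (sub_nonneg.2 hQ'.le))
          linarith
        · rw [sum_exchangeVertices hab _ _ fun s => edgeGrad r α x s (p i)]
          rcases Nat.eq_zero_or_pos j with rfl | hj0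
          · have hia : i = a + 1 := by omega
            rw [hz0' (n := c + 0) (by omega) (by omega) (by omega) (by omega),
              hz0 (n := c + 0) (by omega) (by omega)]
            have := edgeGrad_le_replaceVertex (r := r) hα1 hx hu1 (fun h => absurd h hw1') hle
              (hia ▸ hu0) (by rw [hia]; exact hu10.symm) (hpinj (by omega) (by omega) (by omega))
            linarith
          · rw [hz0 (by omega) (by omega), hz0 (by omega) (by omega),
              hz0' (by omega) (by omega) (by omega) (by omega),
              hz0' (by omega) (by omega) (by omega) (by omega)]
            simp
        · rw [sum_exchangeVertices hab _ _ fun s => edgeGrad r α x s (p a),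
            edgeGrad_of_notMem hu1', edgeGrad_of_mem hu1,
            edgeGrad_replaceVertex_self fun h => absurd h hu1',
            edgeGrad_of_notMem (fun h => by
              rcases mem_replaceVertex.1 h with h | ⟨h, -⟩
              · exact hpinj (by omega) (by omega) (by omega) h
              · exact h rfl)]
          have := mul_lt_mul_of_pos_left hQ' h1α
          intro h
          linarith
      · refine exists_isRerouting_of_lt hα0 hα1 hx hp hic hd (j + 1) (by omega) ?_
        rw [show i - (j + 1) = a by omega, ← add_assoc]
        exact hgt
termination_by i - j

end Balance

section Center

variable {V ι : Type*} [Fintype V] [DecidableEq V] [Fintype ι]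
  {r d : ℕ} {α : ℝ} {x : V → ℝ} {E : ι → Finset V} {p : ℕ → V} {ε : ℕ → ι}

lemma IsEdgeWalk.isRerouting_self (hw : IsEdgeWalk E d p ε) (c : ℕ) :
    IsRerouting r α x d E ε (p c) c E p ε :=
  ⟨hw, rfl, fun n hn => ⟨n, hn, rfl⟩, fun _ _ => rfl, fun _ => rfl, fun _ h => h, le_rfl, le_rfl⟩

lemma IsRerouting.of_reverse {z : V} {c : ℕ} {E' : ι → Finset V} {q : ℕ → V} {ε' : ℕ → ι}
    (h : IsRerouting r α x d E (fun n => ε (d - 1 - n)) z c E' q ε') :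
    IsRerouting r α x d E ε z c E' q ε' where
  walk := h.walk
  center := h.center
  label_mem n hn := by
    obtain ⟨n', hn', he⟩ := h.label_mem n hn
    exact ⟨d - 1 - n', by omega, he⟩
  eq_of_ne j hj := h.eq_of_ne j fun n hn => hj _ (by omega)
  card_eq := h.card_eq
  exists_mem := h.exists_mem
  form_le := h.form_le
  grad_le := h.grad_le

/-- A vertex at which `x` is larger than at the middle joints of the path can be moved to the middle
of the path. -/
lemma exists_isRerouting (hα0 : 0 ≤ α) (hα1 : α < 1) (hx : ∀ v, 0 < x v)
    (hp : IsLooseEdgePath E d p ε) {i : ℕ} (hi : i ≤ d)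
    (hmid : i = d / 2 ∨ i = d - d / 2 ∨
      (x (p (d / 2)) < x (p i) ∧ x (p (d - d / 2)) < x (p i))) :
    ∃ E' q ε', IsRerouting r α x d E ε (p i) (d / 2) E' q ε' ∧
      (E' = E ∨ IsStrictChange r α x E E') := by
  by_cases h1 : i = d / 2
  · subst h1
    exact ⟨E, p, ε, hp.isEdgeWalk.isRerouting_self _, .inl rfl⟩
  by_cases h2 : i = d - d / 2
  · have h := hp.reverse.isEdgeWalk.isRerouting_self (r := r) (α := α) (x := x) (d / 2)
    simp only [← h2] at h
    exact ⟨E, _, _, h.of_reverse, .inl rfl⟩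
  obtain ⟨h3, h4⟩ := (hmid.resolve_left h1).resolve_left h2
  by_cases h5 : i < d / 2
  · obtain ⟨E', q, ε', h, h'⟩ := exists_isRerouting_of_lt (r := r) hα0 hα1 hx hp h5 (by omega) 0
      (by omega) (by simpa using h3)
    exact ⟨E', q, ε', h, .inr h'⟩
  · obtain ⟨E', q, ε', h, h'⟩ := exists_isRerouting_of_lt (r := r) hα0 hα1 hx hp.reverse
      (i := d - i) (c := d / 2) (by omega) (by omega) 0 (by omega) (by
        simp only [add_zero, Nat.sub_zero]
        rwa [show d - (d - i) = i by omega])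
    simp only [show d - (d - i) = i by omega] at h
    exact ⟨E', q, ε', h.of_reverse, .inr h'⟩

lemma IsRerouting.image_label [DecidableEq ι] {z : V} {c : ℕ} {E' : ι → Finset V} {q : ℕ → V}
    {ε' : ℕ → ι} (h : IsRerouting r α x d E ε z c E' q ε') :
    (Finset.range d).image ε' = (Finset.range d).image ε := by
  refine Finset.eq_of_subset_of_card_le ?_ ?_
  · intro j hj
    obtain ⟨n, hn, rfl⟩ := Finset.mem_image.1 hj
    obtain ⟨n', hn', he⟩ := h.label_mem n (Finset.mem_range.1 hn)
    exact Finset.mem_image.2 ⟨n', Finset.mem_range.2 hn', he.symm⟩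
  · rw [Finset.card_image_of_injOn (s := Finset.range d) (f := ε') (by
      rw [Finset.coe_range]; exact h.walk.label_injOn)]
    exact Finset.card_image_le

/-! ### The center of a path -/

/-- The edge `t` is `s`, or results from `s` by replacing a vertex by the vertex `z`, at which `x`
is at least as large. -/
def IsPull (x : V → ℝ) (z : V) (s t : Finset V) : Prop :=
  t = s ∨ ∃ u ∈ s, z ∉ s ∧ x u ≤ x z ∧ t = replaceVertex s u z

lemma isPull_replaceVertex {z : V} {s : Finset V} {u : V} (hu : u ∈ s) (hz : z ∈ s → z = u)
    (h : x u ≤ x z) : IsPull x z s (replaceVertex s u z) := by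
  by_cases hzs : z ∈ s
  · rw [hz hzs, replaceVertex_self hu]
    exact .inl rfl
  · exact .inr ⟨u, hu, hzs, h, rfl⟩

lemma IsPull.card_eq {z : V} {s t : Finset V} (h : IsPull x z s t) : t.card = s.card := by
  rcases h with rfl | ⟨u, hu, hz, -, rfl⟩
  · rfl
  · exact card_replaceVertex hu fun h => absurd h hz

lemma IsPull.edgeTerm_le (hα0 : 0 ≤ α) (hα1 : α < 1) (hx : ∀ v, 0 < x v) {z : V} {s t : Finset V}
    (h : IsPull x z s t) : edgeTerm r α x s ≤ edgeTerm r α x t := by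
  rcases h with rfl | ⟨u, hu, hz, hle, rfl⟩
  · exact le_rfl
  · exact edgeTerm_le_replaceVertex hα0 hα1 hx hu (fun h => absurd h hz) hle

lemma IsPull.edgeGrad_le (hα0 : 0 ≤ α) (hα1 : α < 1) (hx : ∀ v, 0 < x v) {z : V} {s t : Finset V}
    (h : IsPull x z s t) : edgeGrad r α x s z ≤ edgeGrad r α x t z := by
  rcases h with rfl | ⟨u, hu, hz, hle, rfl⟩
  · exact le_rfl
  · exact edgeGrad_le_replaceVertex_self hα0 hα1 hx hu fun h => absurd h hz

lemma IsPull.eq_of_edgeGrad_eq (hα0 : 0 ≤ α) (hα1 : α < 1) (hx : ∀ v, 0 < x v) {z : V}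
    {s t : Finset V} (h : IsPull x z s t) (he : edgeGrad r α x s z = edgeGrad r α x t z) :
    t = s := by
  rcases h with rfl | ⟨u, hu, hz, hle, rfl⟩
  · rfl
  · rw [edgeGrad_of_notMem hz] at he
    have := edgeGrad_pos (r := r) hα0 hα1 hx (mem_replaceVertex_self (s := s) (u := u) (w := z))
    linarith

/-- A path has a center: a vertex `z` at which `x` is maximal on the path and which, after replacing
at most one vertex of one edge by `z`, is a joint of the path; it is a middle joint unless `x` is
smaller than `x z` at both middle joints. -/
lemma exists_center (hp : IsLooseEdgePath E d p ε) :
    ∃ z ∈ pathSupport E d p ε, (∀ v ∈ pathSupport E d p ε, x v ≤ x z) ∧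
      ∃ i p' F, i ≤ d ∧ p' i = z ∧ IsLooseEdgePath F d p' ε ∧
        (i = d / 2 ∨ i = d - d / 2 ∨
          (x (p' (d / 2)) < x (p' i) ∧ x (p' (d - d / 2)) < x (p' i))) ∧
        (∀ n < d, IsPull x z (E (ε n)) (F (ε n))) ∧
        ∀ v, (∃ n < d, v ∈ E (ε n)) → ∃ n < d, v ∈ F (ε n) := by
  have hjoint : ∀ n ≤ d, p n ∈ pathSupport E d p ε := by
    intro n hn
    rw [mem_pathSupport]
    rcases n with _ | n
    · exact .inl rfl
    · exact .inr ⟨n, by omega, hp.right_mem n (by omega)⟩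
  obtain ⟨z, hzU, hzmax⟩ := Finset.exists_max_image (pathSupport E d p ε) x
    ⟨p 0, hjoint 0 (by omega)⟩
  by_cases h1 : x (p (d / 2)) = x z
  · exact ⟨p (d / 2), hjoint _ (by omega), fun v hv => (hzmax v hv).trans h1.ge, d / 2, p, E,
      by omega, rfl, hp, .inl rfl, fun n _ => .inl rfl, fun v h => h⟩
  by_cases h2 : x (p (d - d / 2)) = x z
  · exact ⟨p (d - d / 2), hjoint _ (by omega), fun v hv => (hzmax v hv).trans h2.ge, d - d / 2, p,
      E, by omega, rfl, hp, .inr (.inl rfl), fun n _ => .inl rfl, fun v h => h⟩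
  have h1' : x (p (d / 2)) < x z := lt_of_le_of_ne (hzmax _ (hjoint _ (by omega))) h1
  have h2' : x (p (d - d / 2)) < x z := lt_of_le_of_ne (hzmax _ (hjoint _ (by omega))) h2
  refine ⟨z, hzU, hzmax, ?_⟩
  by_cases hz : ∃ i ≤ d, p i = z
  · obtain ⟨i, hi, rfl⟩ := hz
    exact ⟨i, p, E, hi, rfl, hp, .inr (.inr ⟨h1', h2'⟩), fun n _ => .inl rfl, fun v h => h⟩
  push Not at hz
  obtain ⟨n, hn, hzn⟩ : ∃ n < d, z ∈ E (ε n) := by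
    rcases mem_pathSupport.1 hzU with rfl | h
    · exact absurd rfl (hz 0 (by omega))
    · exact h
  -- `z` is not a joint, and takes the role of the joint `p (n + 1)`.
  have huniq : ∀ m < d, z ∈ E (ε m) → m = n := by
    intro m hm hzm
    rcases lt_trichotomy m n with h | h | h
    · exact absurd (hp.inter h hn hzm hzn).2.symm (hz n hn.le)
    · exact h
    · exact absurd (hp.inter h hm hzn hzm).2.symm (hz m hm.le)
  classical
  set F : ι → Finset V := fun j => if n + 1 < d ∧ j = ε (n + 1) then
    replaceVertex (E j) (p (n + 1)) z else E j with hF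
  set p' : ℕ → V := fun m => if m = n + 1 then z else p m with hp'
  have hF1 : n + 1 < d → F (ε (n + 1)) = replaceVertex (E (ε (n + 1))) (p (n + 1)) z :=
    fun h => if_pos ⟨h, rfl⟩
  have hF2 : ∀ m < d, m ≠ n + 1 → F (ε m) = E (ε m) := by
    intro m hm hne
    refine if_neg ?_
    rintro ⟨h, he⟩
    exact hne (hp.label_injOn hm h he)
  have hp'1 : p' (n + 1) = z := if_pos rfl
  have hp'2 : ∀ m, m ≠ n + 1 → p' m = p m := fun m hm => if_neg hm
  have hmemF : ∀ m < d, ∀ v, v ∈ F (ε m) → (v = z ∧ (m = n ∨ m = n + 1)) ∨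
      (v ≠ z ∧ v ∈ E (ε m) ∧ (m = n + 1 → v ≠ p (n + 1))) := by
    intro m hm v hv
    by_cases hmn : m = n + 1
    · subst hmn
      rw [hF1 hm, mem_replaceVertex] at hv
      by_cases hvz : v = z
      · exact .inl ⟨hvz, .inr rfl⟩
      · exact .inr ⟨hvz, (hv.resolve_left hvz).2, fun _ => (hv.resolve_left hvz).1⟩
    · rw [hF2 m hm hmn] at hv
      by_cases hvz : v = z
      · exact .inl ⟨hvz, .inl (huniq m hm (hvz ▸ hv))⟩
      · exact .inr ⟨hvz, hv, fun h => absurd h hmn⟩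
  refine ⟨n + 1, p', F, by omega, hp'1, ⟨?_, ?_, ?_, ?_⟩, ?_, ?_, ?_⟩
  · intro m hm
    by_cases hmn : m = n + 1
    · subst hmn
      rw [hF1 hm, hp'1]
      exact mem_replaceVertex_self
    · rw [hF2 m hm hmn, hp'2 m hmn]
      exact hp.left_mem m hm
  · intro m hm
    by_cases hmn : m = n
    · subst hmn
      rw [hF2 m hm (by omega), hp'1]
      exact hzn
    · rw [hp'2 _ (by omega)]
      by_cases hmn' : m = n + 1
      · subst hmn'
        rw [hF1 hm]
        exact mem_replaceVertex_of_ne (hp.right_mem _ hm) (hp.ne_succ _ hm).symm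
      · rw [hF2 m hm hmn']
        exact hp.right_mem m hm
  · intro m hm
    by_cases hmn : m = n
    · subst hmn
      rw [hp'1, hp'2 _ (by omega)]
      exact hz m hm.le
    · rw [hp'2 (m + 1) (by omega)]
      by_cases hmn' : m = n + 1
      · subst hmn'
        rw [hp'1]
        exact (hz _ (by omega)).symm
      · rw [hp'2 m hmn']
        exact hp.ne_succ m hm
  · intro m l v hml hl hvm hvl
    rcases hmemF m (by omega) v hvm with ⟨h3, h4⟩ | ⟨h3, h4, h5⟩ <;>
      rcases hmemF l hl v hvl with ⟨h6, h7⟩ | ⟨h6, h7, h8⟩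
    · have h9 : m = n := by omega
      have h10 : l = n + 1 := by omega
      exact ⟨by omega, by rw [h10, hp'1, h3]⟩
    · exact absurd h3 h6
    · exact absurd h6 h3
    · obtain ⟨h9, h10⟩ := hp.inter hml hl h4 h7
      refine ⟨h9, ?_⟩
      by_cases hln : l = n + 1
      · exact absurd (hln ▸ h10) (h8 hln)
      · rw [hp'2 l hln, h10]
  · by_cases h3 : n + 1 = d / 2
    · exact .inl h3
    by_cases h4 : n + 1 = d - d / 2
    · exact .inr (.inl h4)
    refine .inr (.inr ?_)
    rw [hp'1, hp'2 _ (Ne.symm h3), hp'2 _ (Ne.symm h4)]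
    exact ⟨h1', h2'⟩
  · intro m hm
    by_cases hmn : m = n + 1
    · subst hmn
      rw [hF1 hm]
      refine isPull_replaceVertex (hp.left_mem _ hm) (fun h => ?_) (hzmax _ (hjoint _ hm.le))
      exact absurd (huniq _ hm h) (by omega)
    · rw [hF2 m hm hmn]
      exact .inl rfl
  · rintro v ⟨m, hm, hv⟩
    by_cases hmn : m = n + 1
    · subst hmn
      by_cases hvp : v = p (n + 1)
      · exact ⟨n, hn, by rw [hF2 n hn (by omega), hvp]; exact hp.right_mem n hn⟩
      · exact ⟨_, hm, by rw [hF1 hm]; exact mem_replaceVertex_of_ne hv hvp⟩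
    · exact ⟨m, hm, by rwa [hF2 m hm hmn]⟩

end Center

/-! ### Concentrating the edges off a path -/

section Spider

variable {V ι : Type*} [Fintype V] [DecidableEq V] [Fintype ι]

/-- The edges form a path with a vertex `z` in position `c`, an edge `f` with vertices `z` and `w`,
edges with labels in `S` that contain `w`, and further edges that contain `z`. -/
structure IsSpider (r d c : ℕ) (E : ι → Finset V) (q : ℕ → V) (ε : ℕ → ι) (z w : V) (f : ι)
    (S : Finset ι) : Prop where
  walk : IsEdgeWalk E d q ε
  center : q c = z
  off : ∀ n < d, ε n ≠ f
  center_mem : z ∈ E f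
  mem : w ∈ E f
  ne : w ≠ z
  off_of_mem : ∀ j ∈ S, ∀ n < d, ε n ≠ j
  ne_of_mem : ∀ j ∈ S, j ≠ f
  mem_of_mem : ∀ j ∈ S, w ∈ E j
  mem_of_notMem : ∀ j, (∀ n < d, ε n ≠ j) → j ≠ f → j ∉ S → z ∈ E j
  card_eq : ∀ j, (E j).card = r + 1
  exists_mem : ∀ v, ∃ j, v ∈ E j

variable {r d : ℕ} {α : ℝ} {x : V → ℝ} {E : ι → Finset V} {p : ℕ → V} {ε : ℕ → ι}

lemma IsLooseEdgePath.congr {F : ι → Finset V} (hp : IsLooseEdgePath E d p ε)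
    (h : ∀ n < d, F (ε n) = E (ε n)) : IsLooseEdgePath F d p ε where
  left_mem n hn := h n hn ▸ hp.left_mem n hn
  right_mem n hn := h n hn ▸ hp.right_mem n hn
  ne_succ := hp.ne_succ
  inter {m n v} hmn hn hm hv :=
    hp.inter hmn hn (h m (by omega) ▸ hm) (h n hn ▸ hv)

/-- A spider remains after moving its center to the middle of its path. -/
lemma IsRerouting.isSpider {c c' : ℕ} {E₁ E₂ : ι → Finset V} {p q : ℕ → V} {ε' : ℕ → ι} {z w : V}
    {f : ι} {S : Finset ι} (h : IsRerouting r α x d E₁ ε z c E₂ q ε')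
    (hs : IsSpider r d c' E₁ p ε z w f S) : IsSpider r d c E₂ q ε' z w f S := by
  classical
  have himg := h.image_label
  have hoff : ∀ j, (∀ n < d, ε' n ≠ j) ↔ ∀ n < d, ε n ≠ j := by
    intro j
    have h1 : j ∈ (Finset.range d).image ε' ↔ j ∈ (Finset.range d).image ε := by rw [himg]
    simp only [Finset.mem_image, Finset.mem_range] at h1
    constructor
    · intro h2 n hn he
      obtain ⟨n', hn', he'⟩ := h1.2 ⟨n, hn, he⟩
      exact h2 n' hn' he'
    · intro h2 n hn he
      obtain ⟨n', hn', he'⟩ := h1.1 ⟨n, hn, he⟩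
      exact h2 n' hn' he'
  have heq := h.eq_of_ne
  exact ⟨h.walk, h.center, (hoff f).2 hs.off, heq f hs.off ▸ hs.center_mem, heq f hs.off ▸ hs.mem,
    hs.ne, fun j hj => (hoff j).2 (hs.off_of_mem j hj), hs.ne_of_mem,
    fun j hj => heq j (hs.off_of_mem j hj) ▸ hs.mem_of_mem j hj,
    fun j hj hjf hjS => heq j ((hoff j).1 hj) ▸ hs.mem_of_notMem j ((hoff j).1 hj) hjf hjS,
    fun j => (h.card_eq j).trans (hs.card_eq j), fun v => h.exists_mem v (hs.exists_mem v)⟩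

lemma edgeForm_le_of_isPull (hα0 : 0 ≤ α) (hα1 : α < 1) (hx : ∀ v, 0 < x v) {E₁ : ι → Finset V}
    {z : V} (h : ∀ j, IsPull x z (E j) (E₁ j)) : edgeForm r α E x ≤ edgeForm r α E₁ x :=
  Finset.sum_le_sum fun j _ => (h j).edgeTerm_le hα0 hα1 hx

/-- Attaching edges to `z` increases the gradient at `z`, unless nothing is changed. -/
lemma eq_of_isPull (hα0 : 0 ≤ α) (hα1 : α < 1) (hx : ∀ v, 0 < x v) {E₁ : ι → Finset V} {z : V}
    (h : ∀ j, IsPull x z (E j) (E₁ j))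
    (hle : ∑ j, edgeGrad r α x (E₁ j) z ≤ ∑ j, edgeGrad r α x (E j) z) : E₁ = E := by
  have h1 : ∀ j ∈ Finset.univ, edgeGrad r α x (E j) z ≤ edgeGrad r α x (E₁ j) z :=
    fun j _ => (h j).edgeGrad_le hα0 hα1 hx
  have h2 := (Finset.sum_eq_sum_iff_of_le h1).1 (le_antisymm (Finset.sum_le_sum h1) hle)
  funext j
  exact (h j).eq_of_edgeGrad_eq hα0 hα1 hx (h2 j (Finset.mem_univ j))

lemma isStrictChange_or {E' : ι → Finset V} (hle : edgeForm r α E x ≤ edgeForm r α E' x) :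
    IsStrictChange r α x E E' ∨ (edgeForm r α E' x = edgeForm r α E x ∧
      ∀ v, ∑ j, edgeGrad r α x (E' j) v = ∑ j, edgeGrad r α x (E j) v) := by
  by_cases h : IsStrictChange r α x E E'
  · exact .inl h
  · unfold IsStrictChange at h
    push Not at h
    exact .inr ⟨le_antisymm h.1 hle, h.2⟩

lemma IsStrictChange.of_eq {E₁ E₂ : ι → Finset V} (h : E₂ = E₁ ∨ IsStrictChange r α x E₁ E₂)
    (h₁ : E₁ = E) (hf : edgeForm r α E₂ x = edgeForm r α E x)
    (hg : ∀ v, ∑ j, edgeGrad r α x (E₂ j) v = ∑ j, edgeGrad r α x (E j) v) : E₂ = E := by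
  subst h₁
  rcases h with rfl | h | ⟨v, hv⟩
  · rfl
  · exact absurd hf h.ne'
  · exact absurd (hg v) hv

/-- The largest entry of `x` is attained on the path, at its center `z`: one edge `f'` that is not
attached to the path is kept, and all other edges off the path are attached to `z`. The edge above
`f'` becomes the edge `f` of a spider. -/
lemma exists_isSpider_of_max_mem {H : Hypergraph V} {k : ℕ} (hα0 : 0 ≤ α) (hα1 : α < 1)
    (hx : ∀ v, 0 < x v) (hE : IsEdgeFamily H r E) (hH : H.IsSupertree k)
    (hcat : ¬ H.IsCaterpillar) (hp : IsLooseEdgePath E d p ε) {z : V}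
    (hzU : z ∈ pathSupport E d p ε) (hz : ∀ v, x v ≤ x z) {i : ℕ} {p' : ℕ → V} {F : ι → Finset V}
    (hi : i ≤ d) (hp'i : p' i = z) (hp' : IsLooseEdgePath F d p' ε)
    (hmid : i = d / 2 ∨ i = d - d / 2 ∨
      (x (p' (d / 2)) < x (p' i) ∧ x (p' (d - d / 2)) < x (p' i)))
    (hF : ∀ n < d, IsPull x z (E (ε n)) (F (ε n)))
    (hFcov : ∀ v, (∃ n < d, v ∈ E (ε n)) → ∃ n < d, v ∈ F (ε n)) :
    ∃ E₂ q ε₂ w f S, IsSpider r d (d / 2) E₂ q ε₂ z w f S ∧ S.card = 1 ∧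
      edgeForm r α E x ≤ edgeForm r α E₂ x ∧ (E₂ = E ∨ IsStrictChange r α x E E₂) := by
  classical
  obtain ⟨D, top, hR⟩ := exists_isRooting hE hH z
  obtain ⟨f', hf'off, hf'⟩ : ∃ f', (∀ n < d, ε n ≠ f') ∧ top f' ∉ pathSupport E d p ε := by
    by_contra h
    push Not at h
    exact hcat (isCaterpillar_of_top_mem hE hR hp hzU h)
  have hne : top f' ≠ z := fun h => hf' (h ▸ hzU)
  obtain ⟨f, hwf, hwtop⟩ := hR.exists_parent (top f') hne
  have hfoff : ∀ n < d, ε n ≠ f := fun n hn h =>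
    hf' (mem_pathSupport.2 (.inr ⟨n, hn, h ▸ hwf⟩))
  have hff' : f ≠ f' := by
    rintro rfl
    exact hwtop rfl
  set E₁ : ι → Finset V := fun j => if ∃ n < d, ε n = j then F j else
    if j = f' then E j else replaceVertex (E j) (top j) z with hE₁
  have hE₁path : ∀ n < d, E₁ (ε n) = F (ε n) := fun n hn => if_pos ⟨n, hn, rfl⟩
  have hE₁off : ∀ j, (∀ n < d, ε n ≠ j) → j ≠ f' → E₁ j = replaceVertex (E j) (top j) z := by
    intro j hj hjf
    simp only [hE₁]
    rw [if_neg (by push Not; exact hj), if_neg hjf]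
  have hE₁f' : E₁ f' = E f' := by
    simp only [hE₁]
    rw [if_neg (by push Not; exact hf'off), if_pos trivial]
  have hpull : ∀ j, IsPull x z (E j) (E₁ j) := by
    intro j
    by_cases hj : ∀ n < d, ε n ≠ j
    · by_cases hjf : j = f'
      · rw [hjf, hE₁f']
        exact .inl rfl
      · rw [hE₁off j hj hjf]
        exact isPull_replaceVertex (hR.top_mem j) (fun h => (hR.root_top h).symm) (hz _)
    · push Not at hj
      obtain ⟨n, hn, rfl⟩ := hj
      rw [hE₁path n hn]
      exact hF n hn
  have hp₁ : IsLooseEdgePath E₁ d p' ε := hp'.congr hE₁path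
  obtain ⟨E₂, q, ε₂, hre, hre'⟩ := exists_isRerouting (r := r) hα0 hα1 hx hp₁ hi hmid
  rw [hp'i] at hre
  have hle₁ : edgeForm r α E x ≤ edgeForm r α E₁ x := edgeForm_le_of_isPull hα0 hα1 hx hpull
  have hle : edgeForm r α E x ≤ edgeForm r α E₂ x := hle₁.trans hre.form_le
  have hspider : IsSpider r d i E₁ p' ε z (top f') f {f'} := by
    refine ⟨hp₁.isEdgeWalk, hp'i, hfoff, ?_, ?_, hne, ?_, ?_, ?_, ?_, ?_, ?_⟩
    · rw [hE₁off f hfoff hff']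
      exact mem_replaceVertex_self
    · rw [hE₁off f hfoff hff']
      exact mem_replaceVertex_of_ne hwf hwtop
    · intro j hj
      rw [Finset.mem_singleton] at hj
      exact hj ▸ hf'off
    · intro j hj
      rw [Finset.mem_singleton] at hj
      exact hj ▸ hff'.symm
    · intro j hj
      rw [Finset.mem_singleton] at hj
      rw [hj, hE₁f']
      exact hR.top_mem f'
    · intro j hj _ hjS
      rw [hE₁off j hj (fun h => hjS (Finset.mem_singleton.2 h))]
      exact mem_replaceVertex_self
    · exact fun j => (hpull j).card_eq.trans (hE.card_eq j)
    · intro v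
      by_cases hv : v = z
      · exact ⟨f, by rw [hE₁off f hfoff hff', hv]; exact mem_replaceVertex_self⟩
      · obtain ⟨j, hvj, hvt⟩ := hR.exists_parent v hv
        by_cases hj : ∀ n < d, ε n ≠ j
        · by_cases hjf : j = f'
          · exact ⟨j, by rw [hjf, hE₁f']; exact hjf ▸ hvj⟩
          · exact ⟨j, by rw [hE₁off j hj hjf]; exact mem_replaceVertex_of_ne hvj hvt⟩
        · push Not at hj
          obtain ⟨n, hn, rfl⟩ := hj
          obtain ⟨n', hn', hv'⟩ := hFcov v ⟨n, hn, hvj⟩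
          exact ⟨_, by rwa [hE₁path n' hn']⟩
  refine ⟨E₂, q, ε₂, top f', f, {f'}, hre.isSpider hspider, Finset.card_singleton _, hle, ?_⟩
  rcases isStrictChange_or hle with h | ⟨h1, h2⟩
  · exact .inr h
  · have h3 : E₁ = E := eq_of_isPull hα0 hα1 hx hpull (hre.grad_le.trans (h2 z).le)
    exact .inl (IsStrictChange.of_eq hre' h3 h1 h2)

/-- The largest entry of `x` is attained off the path only, at `y`: the edge `f` leading from the
path towards `y` is attached to the center `z` of the path and to `y`, and all other edges off the
path are attached to `y`. -/
lemma exists_isSpider_of_max_notMem {H : Hypergraph V} {k : ℕ} (hα0 : 0 ≤ α) (hα1 : α < 1)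
    (hx : ∀ v, 0 < x v) (hE : IsEdgeFamily H r E) (hH : H.IsSupertree k)
    (hp : IsLooseEdgePath E d p ε) {y z : V} (hy : ∀ v, x v ≤ x y)
    (hyU : y ∉ pathSupport E d p ε) (hzU : z ∈ pathSupport E d p ε)
    (hz : ∀ v ∈ pathSupport E d p ε, x v ≤ x z) {i : ℕ} {p' : ℕ → V} {F : ι → Finset V}
    (hi : i ≤ d) (hp'i : p' i = z) (hp' : IsLooseEdgePath F d p' ε)
    (hmid : i = d / 2 ∨ i = d - d / 2 ∨
      (x (p' (d / 2)) < x (p' i) ∧ x (p' (d - d / 2)) < x (p' i)))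
    (hF : ∀ n < d, IsPull x z (E (ε n)) (F (ε n)))
    (hFcov : ∀ v, (∃ n < d, v ∈ E (ε n)) → ∃ n < d, v ∈ F (ε n)) :
    ∃ E₂ q ε₂ w f S, IsSpider r d (d / 2) E₂ q ε₂ z w f S ∧
      (∀ j, (∀ n < d, ε₂ n ≠ j) → j ≠ f → j ∈ S) ∧
      edgeForm r α E x ≤ edgeForm r α E₂ x ∧ (E₂ = E ∨ IsStrictChange r α x E E₂) := by
  classical
  obtain ⟨D, top, hR⟩ := exists_isRooting hE hH y
  -- The vertex `t` of the path closest to `y`, and the edge `f` above it.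
  obtain ⟨t, htU, htmin⟩ := Finset.exists_min_image (pathSupport E d p ε) D ⟨z, hzU⟩
  have hty : t ≠ y := fun h => hyU (h ▸ htU)
  have hyz : y ≠ z := fun h => hyU (h ▸ hzU)
  obtain ⟨f, htf, httop⟩ := hR.exists_parent t hty
  have htopU : top f ∉ pathSupport E d p ε := fun h => by
    have h1 := htmin _ h
    have h2 := hR.depth_lt htf httop
    omega
  have hfoff : ∀ n < d, ε n ≠ f := fun n hn h =>
    htopU (mem_pathSupport.2 (.inr ⟨n, hn, by rw [h]; exact hR.top_mem f⟩))
  have hexc : ∀ v, v ∈ E f → v ≠ top f → ∀ n < d, v ∈ E (ε n) → v = top (ε n) := by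
    intro v hv hvt n hn hvn
    by_contra h
    exact hfoff n hn (hR.parent_unique hvn h hv hvt)
  have hft : ∀ v ∈ pathSupport E d p ε, v ∈ E f → v = t := by
    intro v hvU hv
    have hvt : v ≠ top f := fun h => htopU (h ▸ hvU)
    exact hR.eq_of_mem_pathSupport hE.card_eq hp hvU htU (hexc v hv hvt) (hexc t htf httop)
  set s := replaceVertex (E f) (top f) y with hs
  have hys : y ∈ E f → y = top f := fun h => (hR.root_top h).symm
  have hts : t ∈ s := mem_replaceVertex_of_ne htf httop
  have hzs : z ∈ s → z = t := by
    intro h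
    rcases mem_replaceVertex.1 h with h | ⟨-, h⟩
    · exact absurd h.symm hyz
    · exact hft z hzU h
  set E₁ : ι → Finset V := fun j => if ∃ n < d, ε n = j then F j else
    if j = f then replaceVertex s t z else replaceVertex (E j) (top j) y with hE₁
  have hE₁path : ∀ n < d, E₁ (ε n) = F (ε n) := fun n hn => if_pos ⟨n, hn, rfl⟩
  have hE₁off : ∀ j, (∀ n < d, ε n ≠ j) → j ≠ f → E₁ j = replaceVertex (E j) (top j) y := by
    intro j hj hjf
    simp only [hE₁]
    rw [if_neg (by push Not; exact hj), if_neg hjf]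
  have hE₁f : E₁ f = replaceVertex s t z := by
    simp only [hE₁]
    rw [if_neg (by push Not; exact hfoff), if_pos trivial]
  have hpully : ∀ j, IsPull x y (E j) (replaceVertex (E j) (top j) y) := fun j =>
    isPull_replaceVertex (hR.top_mem j) (fun h => (hR.root_top h).symm) (hy _)
  have hpullz : IsPull x z s (replaceVertex s t z) := isPull_replaceVertex hts hzs (hz t htU)
  have hyE₁f : y ∈ E₁ f := by
    rw [hE₁f]
    exact mem_replaceVertex_of_ne mem_replaceVertex_self hty.symm
  have hp₁ : IsLooseEdgePath E₁ d p' ε := hp'.congr hE₁path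
  obtain ⟨E₂, q, ε₂, hre, hre'⟩ := exists_isRerouting (r := r) hα0 hα1 hx hp₁ hi hmid
  rw [hp'i] at hre
  have hle₁ : edgeForm r α E x ≤ edgeForm r α E₁ x := by
    refine Finset.sum_le_sum fun j _ => ?_
    by_cases hj : ∀ n < d, ε n ≠ j
    · by_cases hjf : j = f
      · rw [hjf, hE₁f]
        exact ((hpully f).edgeTerm_le hα0 hα1 hx).trans (hpullz.edgeTerm_le hα0 hα1 hx)
      · rw [hE₁off j hj hjf]
        exact (hpully j).edgeTerm_le hα0 hα1 hx
    · push Not at hj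
      obtain ⟨n, hn, rfl⟩ := hj
      rw [hE₁path n hn]
      exact (hF n hn).edgeTerm_le hα0 hα1 hx
  have hle : edgeForm r α E x ≤ edgeForm r α E₂ x := hle₁.trans hre.form_le
  set S : Finset ι := Finset.univ.filter fun j => (∀ n < d, ε n ≠ j) ∧ j ≠ f with hS
  have hSmem : ∀ j, j ∈ S ↔ (∀ n < d, ε n ≠ j) ∧ j ≠ f := fun j => by simp [hS]
  have hspider : IsSpider r d i E₁ p' ε z y f S := by
    refine ⟨hp₁.isEdgeWalk, hp'i, hfoff, ?_, hyE₁f, hyz, fun j hj => ((hSmem j).1 hj).1,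
      fun j hj => ((hSmem j).1 hj).2, ?_, ?_, ?_, ?_⟩
    · rw [hE₁f]
      exact mem_replaceVertex_self
    · intro j hj
      obtain ⟨h1, h2⟩ := (hSmem j).1 hj
      rw [hE₁off j h1 h2]
      exact mem_replaceVertex_self
    · exact fun j h1 h2 h3 => absurd ((hSmem j).2 ⟨h1, h2⟩) h3
    · intro j
      by_cases hj : ∀ n < d, ε n ≠ j
      · by_cases hjf : j = f
        · rw [hjf, hE₁f, hpullz.card_eq, (hpully f).card_eq, hE.card_eq]
        · rw [hE₁off j hj hjf, (hpully j).card_eq, hE.card_eq]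
      · push Not at hj
        obtain ⟨n, hn, rfl⟩ := hj
        rw [hE₁path n hn, (hF n hn).card_eq, hE.card_eq]
    · have hcovU : ∀ v ∈ pathSupport E d p ε, ∃ j, v ∈ E₁ j := by
        intro v hv
        have : v = z ∨ ∃ n < d, v ∈ E (ε n) := by
          rcases Nat.eq_zero_or_pos d with hd | hd
          · left
            rcases mem_pathSupport.1 hv with h1 | ⟨n, hn, -⟩
            · rcases mem_pathSupport.1 hzU with h2 | ⟨n, hn, -⟩
              · rw [h1, h2]
              · omega
            · omega
          · right
            rcases mem_pathSupport.1 hv with h1 | h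
            · exact ⟨0, hd, h1 ▸ hp.left_mem 0 hd⟩
            · exact h
        rcases this with rfl | h
        · exact ⟨f, by rw [hE₁f]; exact mem_replaceVertex_self⟩
        · obtain ⟨n, hn, h⟩ := hFcov v h
          exact ⟨_, by rwa [hE₁path n hn]⟩
      intro v
      by_cases hv : v = y
      · exact ⟨f, hv ▸ hyE₁f⟩
      · obtain ⟨j, hvj, hvt⟩ := hR.exists_parent v hv
        by_cases hj : ∀ n < d, ε n ≠ j
        · by_cases hjf : j = f
          · subst hjf
            by_cases hvt' : v = t
            · exact hcovU v (hvt' ▸ htU)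
            · refine ⟨j, ?_⟩
              rw [hE₁f]
              exact mem_replaceVertex_of_ne (mem_replaceVertex_of_ne hvj hvt) hvt'
          · exact ⟨j, by rw [hE₁off j hj hjf]; exact mem_replaceVertex_of_ne hvj hvt⟩
        · push Not at hj
          obtain ⟨n, hn, rfl⟩ := hj
          exact hcovU v (mem_pathSupport.2 (.inr ⟨n, hn, hvj⟩))
  have hspider₂ := hre.isSpider hspider
  refine ⟨E₂, q, ε₂, y, f, S, hspider₂, ?_, hle, ?_⟩
  · intro j hj hjf
    refine (hSmem j).2 ⟨fun n hn he => ?_, hjf⟩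
    have h1 : j ∈ (Finset.range d).image ε₂ := by
      rw [hre.image_label]
      exact Finset.mem_image.2 ⟨n, Finset.mem_range.2 hn, he⟩
    obtain ⟨n', hn', he'⟩ := Finset.mem_image.1 h1
    exact hj n' (Finset.mem_range.1 hn') he'
  rcases isStrictChange_or hle with h | ⟨h1, h2⟩
  · exact .inr h
  left
  -- Comparing the gradients at `y` shows that no edge was attached to `y` that did not contain it.
  have hgradf : edgeGrad r α x (E f) y ≤ edgeGrad r α x (E₁ f) y := by
    refine ((hpully f).edgeGrad_le hα0 hα1 hx).trans ?_
    rw [hE₁f]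
    exact edgeGrad_le_replaceVertex hα1 hx hts hzs (hz t htU) mem_replaceVertex_self hty.symm hyz
  have hgrad : ∀ j ∈ Finset.univ, edgeGrad r α x (E j) y ≤ edgeGrad r α x (E₂ j) y := by
    intro j _
    by_cases hj : ∀ n < d, ε n ≠ j
    · rw [hre.eq_of_ne j hj]
      by_cases hjf : j = f
      · rw [hjf]
        exact hgradf
      · rw [hE₁off j hj hjf]
        exact (hpully j).edgeGrad_le hα0 hα1 hx
    · push Not at hj
      obtain ⟨n, hn, rfl⟩ := hj
      rw [edgeGrad_of_notMem fun h => hyU (mem_pathSupport.2 (.inr ⟨n, hn, h⟩))]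
      exact edgeGrad_nonneg hα0 hα1 hx _ _
  have hgeq := fun j => (Finset.sum_eq_sum_iff_of_le hgrad).1 (h2 y).symm j (Finset.mem_univ j)
  have hyf : y ∈ E f := by
    by_contra h
    have h3 := hgeq f
    rw [edgeGrad_of_notMem h, hre.eq_of_ne f hfoff] at h3
    have := edgeGrad_pos (r := r) hα0 hα1 hx hyE₁f
    linarith
  have hsf : s = E f := by
    rw [hs, ← hys hyf]
    exact replaceVertex_self hyf
  -- Hence all changes replaced vertices by `z`, and comparing the gradients at `z` excludes them.
  have hpull : ∀ j, IsPull x z (E j) (E₁ j) := by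
    intro j
    by_cases hj : ∀ n < d, ε n ≠ j
    · by_cases hjf : j = f
      · rw [hjf, hE₁f, ← hsf]
        exact hpullz
      · left
        have h3 := hgeq j
        rw [hre.eq_of_ne j hj] at h3
        rw [hE₁off j hj hjf] at h3 ⊢
        exact (hpully j).eq_of_edgeGrad_eq hα0 hα1 hx h3
    · push Not at hj
      obtain ⟨n, hn, rfl⟩ := hj
      rw [hE₁path n hn]
      exact hF n hn
  have h3 : E₁ = E := eq_of_isPull hα0 hα1 hx hpull (hre.grad_le.trans (h2 z).le)
  exact IsStrictChange.of_eq hre' h3 h1 h2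

/-- The edges of a supertree that is not a caterpillar can be rearranged to a spider with its center
in the middle of its path, so that the form at `x` does not decrease, and the form or its gradient
at `x` changes if the edges do. -/
lemma exists_isSpider {H : Hypergraph V} {k : ℕ} (hα0 : 0 ≤ α) (hα1 : α < 1)
    (hx : ∀ v, 0 < x v) (hE : IsEdgeFamily H r E) (hH : H.IsSupertree k)
    (hcat : ¬ H.IsCaterpillar) (hp : IsLooseEdgePath E d p ε) :
    ∃ E₂ q ε₂ z w f S, IsSpider r d (d / 2) E₂ q ε₂ z w f S ∧
      (S.card = 1 ∨ ∀ j, (∀ n < d, ε₂ n ≠ j) → j ≠ f → j ∈ S) ∧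
      edgeForm r α E x ≤ edgeForm r α E₂ x ∧ (E₂ = E ∨ IsStrictChange r α x E E₂) := by
  obtain ⟨z, hzU, hz, i, p', F, hi, hp'i, hp', hmid, hF, hFcov⟩ := exists_center (x := x) hp
  have : Nonempty V := ⟨z⟩
  obtain ⟨y, hy⟩ := Finite.exists_max x
  by_cases hyz : x y ≤ x z
  · obtain ⟨E₂, q, ε₂, w, f, S, h1, h2, h3⟩ := exists_isSpider_of_max_mem hα0 hα1 hx hE hH hcat hp
      hzU (fun v => (hy v).trans hyz) hi hp'i hp' hmid hF hFcov
    exact ⟨E₂, q, ε₂, z, w, f, S, h1, .inl h2, h3⟩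
  · obtain ⟨E₂, q, ε₂, w, f, S, h1, h2, h3⟩ := exists_isSpider_of_max_notMem hα0 hα1 hx hE hH hp
      hy (fun h => hyz (hz y h)) hzU hz hi hp'i hp' hmid hF hFcov
    exact ⟨E₂, q, ε₂, z, w, f, S, h1, .inr h2, h3⟩

end Spider

/-! ### Spiders and powers of trees -/

section Power

/-- The edges of the graph `T` are those joining each vertex `w ≠ ρ` to its parent `par w`, which
has smaller rank. -/
structure IsParentFunction {W : Type*} (T : SimpleGraph W) (ρ : W) (par : W → W)
    (rank : W → ℕ) : Prop where
  adj_iff : ∀ u v, T.Adj u v ↔ (u ≠ ρ ∧ par u = v) ∨ (v ≠ ρ ∧ par v = u)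
  rank_lt : ∀ u ≠ ρ, rank (par u) < rank u

/-- The vertices of a path attached at the root have their predecessors on the path as parents. -/
lemma IsParentFunction.attachPath {W : Type*} {T : SimpleGraph W} {ρ : W} {par : W → W}
    {rank : W → ℕ} (h : IsParentFunction T ρ par rank) (a : ℕ) :
    IsParentFunction (attachPath T ρ a) (.inl ρ)
      (Sum.elim (fun u => .inl (par u)) fun n : Fin a =>
        if (n : ℕ) = 0 then .inl ρ else .inr ⟨n - 1, by omega⟩)
      (Sum.elim rank fun n => rank ρ + n + 1) where
  adj_iff := by
    rintro (u | i) (v | j)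
    · simp only [_root_.attachPath, SimpleGraph.fromRel_adj, Sum.elim_inl, Sum.inl.injEq, ne_eq,
        reduceCtorEq, and_false, exists_false, or_false, ← h.adj_iff u v]
      constructor
      · rintro ⟨-, ⟨u', v', rfl, rfl, h⟩ | ⟨u', v', rfl, rfl, h⟩⟩
        · exact h
        · exact h.symm
      · exact fun h => ⟨h.ne, .inl ⟨u, v, rfl, rfl, h⟩⟩
    · simp only [_root_.attachPath, SimpleGraph.fromRel_adj, Sum.elim_inl, Sum.elim_inr,
        Sum.inl.injEq, Sum.inr.injEq, ne_eq, reduceCtorEq, false_and, and_false, exists_false,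
        or_false, false_or, not_false_eq_true, true_and]
      constructor
      · rintro ⟨rfl, i, hi, rfl⟩
        rw [if_pos hi]
      · intro hu
        split_ifs at hu with hj
        exact ⟨(Sum.inl_injective hu).symm, j, hj, rfl⟩
    · simp only [_root_.attachPath, SimpleGraph.fromRel_adj, Sum.elim_inl, Sum.elim_inr,
        Sum.inl.injEq, Sum.inr.injEq, ne_eq, reduceCtorEq, false_and, and_false, exists_false,
        or_false, false_or, not_false_eq_true, true_and]
      constructor
      · rintro ⟨rfl, j, hj, rfl⟩
        rw [if_pos hj]
      · intro hu
        split_ifs at hu with hj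
        exact ⟨(Sum.inl_injective hu).symm, i, hj, rfl⟩
    · simp only [_root_.attachPath, SimpleGraph.fromRel_adj, Sum.elim_inr,
        Sum.inr.injEq, ne_eq, reduceCtorEq, false_and, and_false, exists_false,
        false_or, not_false_eq_true, true_and]
      constructor
      · rintro ⟨-, ⟨i', j', hij, rfl, rfl⟩ | ⟨i', j', hij, rfl, rfl⟩⟩
        · right
          rw [if_neg (by omega)]
          exact congrArg _ (Fin.ext (by simp only; omega))
        · left
          rw [if_neg (by omega)]
          exact congrArg _ (Fin.ext (by simp only; omega))
      · rintro (hij | hij) <;> split_ifs at hij with h0 <;> have h1 := Sum.inr_injective hij <;>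
          rw [Fin.ext_iff] at h1 <;> simp only at h1
        · refine ⟨fun h => ?_, .inr ⟨j, i, by omega, rfl, rfl⟩⟩
          rw [h] at h1 h0
          omega
        · refine ⟨fun h => ?_, .inl ⟨i, j, by omega, rfl, rfl⟩⟩
          rw [h] at h1
          omega
  rank_lt := by
    rintro (u | n) hu
    · exact h.rank_lt u fun h => hu (congrArg _ h)
    · simp only [Sum.elim_inr]
      split_ifs with h0
      · simp only [Sum.elim_inl]; omega
      · simp only [Sum.elim_inr]; omega

lemma isParentFunction_doubleStar (s t : ℕ) :
    IsParentFunction (doubleStar s t) (.inl true)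
      (Sum.elim (fun _ => .inl true) (Sum.elim (fun _ => .inl false) fun _ => .inl true))
      (Sum.elim (fun b => if b then 0 else 1) (Sum.elim (fun _ => 2) fun _ => 1)) where
  adj_iff := by
    rintro (_ | _ | i) (_ | _ | j) <;> simp [doubleStar]
    rintro (⟨rfl, rfl⟩ | ⟨rfl, rfl⟩) <;> simp
  rank_lt := by
    rintro ((_ | _) | _ | i) hu <;> simp at hu ⊢

/-- The edges of `H` are put in correspondence with the vertices `w ≠ ρ` of a rooted tree, in such a
way that consecutive edges share a vertex as those of the tree do. A map from the power of the tree
to `H` is then surjective on vertices, and bijective because both have the same number of them. -/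
lemma isIsomorphic_powerHypergraph {V ι W : Type*} [Fintype V] [DecidableEq V] [Fintype ι]
    [Fintype W] {T : SimpleGraph W} {ρ : W} {par : W → W} {rank : W → ℕ}
    (hT : IsParentFunction T ρ par rank) {r : ℕ} (hr : 2 ≤ r) {E : ι → Finset V}
    (hcard : ∀ j, (E j).card = r + 1) (hcov : ∀ v, ∃ j, v ∈ E j)
    (hV : Fintype.card V = Fintype.card ι * r + 1) (hW : Fintype.card W = Fintype.card ι + 1)
    {lab : W → ι} (hlab : Set.InjOn lab {w | w ≠ ρ}) {φ : W → V}
    (hφ : ∀ w ≠ ρ, φ w ∈ E (lab w) ∧ φ (par w) ∈ E (lab w) ∧ φ w ≠ φ (par w)) :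
    Function.Injective E ∧ ∀ H : Hypergraph V, H.vertexSet = Set.univ →
      (H.edgeSet = Set.range fun j => (E j : Set V)) →
        H.IsIsomorphic (powerHypergraph T (r + 1)) := by
  classical
  -- Edges of the tree correspond to vertices other than the root, and these to the labels.
  set e : {w // w ≠ ρ} → T.edgeSet := fun w =>
    ⟨s(w.1, par w.1), (hT.adj_iff _ _).2 (.inl ⟨w.2, rfl⟩)⟩ with he
  have hebij : Function.Bijective e := by
    constructor
    · rintro ⟨u, hu⟩ ⟨v, hv⟩ huv
      have h := congrArg Subtype.val huv
      simp only [he, Sym2.eq_iff] at h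
      rcases h with ⟨rfl, -⟩ | ⟨h1, h2⟩
      · rfl
      · have h3 := hT.rank_lt u hu
        have h4 := hT.rank_lt v hv
        rw [h2] at h3
        rw [← h1] at h4
        omega
    · rintro ⟨s, hs⟩
      induction s with
      | _ u v =>
        rcases (hT.adj_iff u v).1 hs with ⟨hu, rfl⟩ | ⟨hv, rfl⟩
        · exact ⟨⟨u, hu⟩, rfl⟩
        · exact ⟨⟨v, hv⟩, Subtype.ext Sym2.eq_swap⟩
  have hsub : Fintype.card {w // w ≠ ρ} = Fintype.card ι := by
    rw [Fintype.card_subtype_compl, hW, Fintype.card_subtype_eq, Nat.add_sub_cancel]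
  have hlabbij : Function.Bijective fun w : {w // w ≠ ρ} => lab w := by
    rw [Fintype.bijective_iff_injective_and_card]
    exact ⟨fun u v h => Subtype.ext (hlab u.2 v.2 h), hsub⟩
  set ee := Equiv.ofBijective e hebij with hee
  have hg : ∀ w : {w // w ≠ ρ}, ∃ g : Fin (r + 1 - 2) → V,
      Set.range g = (((E (lab w)).erase (φ w)).erase (φ (par w)) : Finset V) := by
    intro w
    obtain ⟨h1, h2, h3⟩ := hφ w w.2
    have hc : (((E (lab w)).erase (φ w)).erase (φ (par w))).card = r + 1 - 2 := by
      rw [Finset.card_erase_of_mem (Finset.mem_erase.2 ⟨h3.symm, h2⟩),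
        Finset.card_erase_of_mem h1, hcard]
      omega
    refine ⟨fun i => ((Finset.equivFinOfCardEq hc).symm i : V), ?_⟩
    ext v
    constructor
    · rintro ⟨i, rfl⟩
      exact ((Finset.equivFinOfCardEq hc).symm i).2
    · intro hv
      exact ⟨Finset.equivFinOfCardEq hc ⟨v, hv⟩, by simp⟩
  choose g hg using hg
  set Φ : PowerVertex T (r + 1) → V := Sum.elim φ fun p => g (ee.symm p.1) p.2 with hΦ
  set edge : T.edgeSet → Set (PowerVertex T (r + 1)) := fun s =>
    Sum.inl '' {w : W | w ∈ (s : Sym2 W)} ∪ Sum.inr '' {p : T.edgeSet × Fin (r + 1 - 2) | p.1 = s}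
    with hedge
  have hΦedge : ∀ w : {w // w ≠ ρ}, Φ '' edge (e w) = E (lab w) := by
    intro w
    obtain ⟨h1, h2, h3⟩ := hφ w w.2
    have hinr : Φ '' (Sum.inr '' {p : T.edgeSet × Fin (r + 1 - 2) | p.1 = e w}) =
        Set.range (g w) := by
      ext v
      constructor
      · rintro ⟨_, ⟨⟨s, i⟩, hs, rfl⟩, rfl⟩
        obtain rfl : s = e w := hs
        refine ⟨i, ?_⟩
        simp only [hΦ, Sum.elim_inr]
        rw [show ee.symm (e w) = w from ee.symm_apply_apply w]
      · rintro ⟨i, rfl⟩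
        refine ⟨_, ⟨(e w, i), rfl, rfl⟩, ?_⟩
        simp only [hΦ, Sum.elim_inr]
        rw [show ee.symm (e w) = w from ee.symm_apply_apply w]
    rw [hedge, Set.image_union, hinr, hg]
    ext v
    simp only [he, hΦ, Sym2.mem_iff, Set.mem_union, Set.mem_image, Set.mem_ofPred_eq,
      exists_exists_and_eq_and, Sum.elim_inl, Finset.coe_erase, Set.mem_sdiff, Finset.mem_coe,
      Set.mem_singleton_iff]
    constructor
    · rintro (⟨u, rfl | rfl, rfl⟩ | h)
      · exact h1
      · exact h2
      · exact h.1.1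
    · intro hv
      by_cases hv1 : v = φ w
      · exact .inl ⟨w, .inl rfl, hv1.symm⟩
      by_cases hv2 : v = φ (par w)
      · exact .inl ⟨par w, .inr rfl, hv2.symm⟩
      exact .inr ⟨⟨hv, hv1⟩, hv2⟩
  have hΦbij : Function.Bijective Φ := by
    rw [Fintype.bijective_iff_surjective_and_card]
    constructor
    · intro v
      obtain ⟨j, hj⟩ := hcov v
      obtain ⟨w, rfl⟩ := hlabbij.2 j
      have : v ∈ Φ '' edge (e w) := by
        rw [hΦedge]
        exact hj
      obtain ⟨u, -, hu⟩ := this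
      exact ⟨u, hu⟩
    · have hE : Fintype.card T.edgeSet = Fintype.card ι := by
        rw [← hsub]
        exact (Fintype.card_congr ee).symm
      have h1 : Fintype.card (PowerVertex T (r + 1)) =
          Fintype.card W + Fintype.card T.edgeSet * (r + 1 - 2) := by
        rw [← Nat.card_eq_fintype_card, Nat.card_sum, Nat.card_prod]
        simp
      rw [h1, hE, hW, hV]
      obtain ⟨r, rfl⟩ : ∃ r', r = r' + 1 := ⟨r - 1, by omega⟩
      rw [show r + 1 + 1 - 2 = r by omega]
      ring
  constructor
  · intro i j hij
    obtain ⟨u, rfl⟩ := hlabbij.2 i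
    obtain ⟨v, rfl⟩ := hlabbij.2 j
    have h1 : Φ '' edge (e u) = Φ '' edge (e v) := by rw [hΦedge, hΦedge, hij]
    have h2 := hΦbij.1.image_injective h1
    have h3 : (Sum.inr (e u, ⟨0, by omega⟩) : PowerVertex T (r + 1)) ∈ edge (e v) :=
      h2 ▸ .inr ⟨_, rfl, rfl⟩
    rcases h3 with ⟨_, -, h⟩ | ⟨p, hp, h⟩
    · cases h
    · have h4 := congrArg Prod.fst (Sum.inr_injective h)
      rw [show p.1 = e v from hp] at h4
      exact congrArg (fun w : {w // w ≠ ρ} => lab w) (hebij.1 h4.symm)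
  · intro H hHV hHE
    set σ := Equiv.ofBijective Φ hΦbij with hσ
    have hσedge : ∀ w : {w // w ≠ ρ}, σ.symm '' (E (lab w) : Set V) = edge (e w) := by
      intro w
      rw [← hΦedge]
      exact σ.symm_image_image _
    refine ⟨σ.symm, ?_⟩
    refine Hypergraph.ext ?_ ?_
    · rw [Hypergraph.image_vertexSet, hHV, Set.image_univ, σ.symm.surjective.range_eq]
      rfl
    · rw [Hypergraph.image_edgeSet, hHE]
      ext A
      constructor
      · rintro ⟨_, ⟨j, rfl⟩, rfl⟩
        obtain ⟨w, rfl⟩ := hlabbij.2 j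
        exact ⟨e w, (hσedge w).symm⟩
      · rintro ⟨s, rfl⟩
        obtain ⟨w, rfl⟩ := hebij.2 s
        exact ⟨_, ⟨lab w, rfl⟩, hσedge w⟩

end Power

section SpiderPower

variable {V ι : Type*} [Fintype V] [DecidableEq V] [Fintype ι]

/-- The edges of a spider are those of its path, the edge `f`, the ones in `S`, and the rest. -/
lemma IsSpider.card_eq_add {r d c : ℕ} {E : ι → Finset V} {q : ℕ → V}
    {ε : ℕ → ι} {z w : V} {f : ι} {S R : Finset ι} (h : IsSpider r d c E q ε z w f S)
    (hR : ∀ j, j ∈ R ↔ (∀ n < d, ε n ≠ j) ∧ j ≠ f ∧ j ∉ S) :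
    Fintype.card ι = d + 1 + S.card + R.card := by
  classical
  have h1 : (Finset.univ : Finset ι) = (((Finset.range d).image ε) ∪ {f}) ∪ (S ∪ R) := by
    ext j
    simp only [Finset.mem_univ, Finset.mem_union, Finset.mem_image, Finset.mem_range,
      Finset.mem_singleton, hR, true_iff]
    by_cases hj : ∃ n < d, ε n = j
    · exact .inl (.inl hj)
    · push Not at hj
      tauto
  have h2 : Disjoint ((Finset.range d).image ε) {f} := by
    rw [Finset.disjoint_singleton_right]
    intro hf
    obtain ⟨n, hn, he⟩ := Finset.mem_image.1 hf
    exact h.off n (Finset.mem_range.1 hn) he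
  have h3 : Disjoint S R := Finset.disjoint_left.2 fun j hj hj' => ((hR j).1 hj').2.2 hj
  have h4 : Disjoint (((Finset.range d).image ε) ∪ {f}) (S ∪ R) := by
    rw [Finset.disjoint_left]
    intro j hj hj'
    have h5 : (∀ n < d, ε n ≠ j) ∧ j ≠ f := by
      rcases Finset.mem_union.1 hj' with h5 | h5
      · exact ⟨h.off_of_mem j h5, h.ne_of_mem j h5⟩
      · exact ⟨((hR j).1 h5).1, ((hR j).1 h5).2.1⟩
    rcases Finset.mem_union.1 hj with h6 | h6
    · obtain ⟨n, hn, he⟩ := Finset.mem_image.1 h6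
      exact h5.1 n (Finset.mem_range.1 hn) he
    · exact h5.2 (Finset.mem_singleton.1 h6)
  rw [← Finset.card_univ, h1, Finset.card_union_of_disjoint h4, Finset.card_union_of_disjoint h2,
    Finset.card_union_of_disjoint h3, Finset.card_image_of_injOn (by
      rw [Finset.coe_range]; exact h.walk.label_injOn), Finset.card_range,
    Finset.card_singleton]
  ring

/-- A spider in which `s` edges contain `w`, and `t` edges off the path and other than `f` do not
belong to these, is the power of `T(s, t; c, d - c)`. -/
lemma IsSpider.isIsomorphic {r d c : ℕ} (hr : 2 ≤ r) (hcd : c ≤ d) {E : ι → Finset V} {q : ℕ → V}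
    {ε : ℕ → ι} {z w : V} {f : ι} {S R : Finset ι} (h : IsSpider r d c E q ε z w f S)
    (hR : ∀ j, j ∈ R ↔ (∀ n < d, ε n ≠ j) ∧ j ≠ f ∧ j ∉ S)
    (hV : Fintype.card V = Fintype.card ι * r + 1) {s t : ℕ} (hs : S.card = s) (ht : R.card = t) :
    Function.Injective E ∧ ∀ H : Hypergraph V, H.vertexSet = Set.univ →
      (H.edgeSet = Set.range fun j => (E j : Set V)) →
        H.IsIsomorphic (powerHypergraph (treeT s t c (d - c)) (r + 1)) := by
  classical
  have hm := h.card_eq_add hR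
  rw [hs, ht] at hm
  have hleaf : ∀ (j : ι) (v : V), ∃ u ∈ E j, u ≠ v := fun j v =>
    Finset.exists_mem_ne (by rw [h.card_eq j]; omega) v
  choose leaf hleaf hleafne using hleaf
  set A : Fin s → ι := fun i => ((Finset.equivFinOfCardEq hs).symm i : ι) with hA
  set B : Fin t → ι := fun i => ((Finset.equivFinOfCardEq ht).symm i : ι) with hB
  have hAS : ∀ i, A i ∈ S := fun i => ((Finset.equivFinOfCardEq hs).symm i).2
  have hBR : ∀ i, B i ∈ R := fun i => ((Finset.equivFinOfCardEq ht).symm i).2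
  have hAinj : Function.Injective A :=
    Subtype.val_injective.comp (Finset.equivFinOfCardEq hs).symm.injective
  have hBinj : Function.Injective B :=
    Subtype.val_injective.comp (Finset.equivFinOfCardEq ht).symm.injective
  have hAf : ∀ i, A i ≠ f := fun i => h.ne_of_mem _ (hAS i)
  have hBf : ∀ i, B i ≠ f := fun i => ((hR _).1 (hBR i)).2.1
  have hAB : ∀ i j, A i ≠ B j := fun i j he => ((hR _).1 (hBR j)).2.2 (he ▸ hAS i)
  have hεA : ∀ n < d, ∀ i, ε n ≠ A i := fun n hn i => h.off_of_mem _ (hAS i) n hn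
  have hεB : ∀ n < d, ∀ i, ε n ≠ B i := fun n hn i => ((hR _).1 (hBR i)).1 n hn
  have hεinj : ∀ m < d, ∀ n < d, ε m = ε n → m = n := fun m hm n hn he =>
    h.walk.label_injOn hm hn he
  have hT := ((isParentFunction_doubleStar s t).attachPath c).attachPath (d - c)
  refine isIsomorphic_powerHypergraph hT hr h.card_eq h.exists_mem hV ?_
    (lab := Sum.elim (Sum.elim (Sum.elim (fun _ => f) (Sum.elim A B)) fun n => ε (c - 1 - n))
      fun n => ε (c + n))
    (φ := Sum.elim (Sum.elim (Sum.elim (fun b => if b then z else w)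
      (Sum.elim (fun i => leaf (A i) w) fun i => leaf (B i) z)) fun n => q (c - 1 - n))
      fun n => q (c + 1 + n)) ?_ ?_
  · simp only [Fintype.card_sum, Fintype.card_bool, Fintype.card_fin, hm]
    omega
  · rintro ((((_ | _) | (i | i)) | n) | n) hu ((((_ | _) | (j | j)) | m) | m) hv huv <;>
      simp only [Sum.elim_inl, Sum.elim_inr, Set.mem_ofPred_eq, ne_eq, not_true] at hu hv huv ⊢
    all_goals first
      | exact absurd huv (hAf _)
      | exact absurd huv.symm (hAf _)
      | exact absurd huv (hBf _)
      | exact absurd huv.symm (hBf _)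
      | exact absurd huv (hAB _ _)
      | exact absurd huv.symm (hAB _ _)
      | exact absurd huv (hεA _ (by omega) _)
      | exact absurd huv.symm (hεA _ (by omega) _)
      | exact absurd huv (hεB _ (by omega) _)
      | exact absurd huv.symm (hεB _ (by omega) _)
      | exact absurd huv (h.off _ (by omega))
      | exact absurd huv.symm (h.off _ (by omega))
      | rw [hAinj huv]
      | rw [hBinj huv]
      | rfl
      | skip
    · exact congrArg _ (congrArg _ (Fin.ext (by
        have := hεinj _ (by omega) _ (by omega) huv
        omega)))
    · exact absurd (hεinj _ (by omega) _ (by omega) huv) (by omega)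
    · exact absurd (hεinj _ (by omega) _ (by omega) huv) (by omega)
    · exact congrArg _ (Fin.ext (by
        have := hεinj _ (by omega) _ (by omega) huv
        omega))
  · have hwalk : ∀ m n, n < d → (m = n ∨ m = n + 1) → q m ∈ E (ε n) := by
      rintro m n hn (rfl | rfl)
      · exact h.walk.left_mem _ hn
      · exact h.walk.right_mem _ hn
    rintro ((((_ | _) | (i | i)) | n) | n) hu
    · exact ⟨h.mem, h.center_mem, h.ne⟩
    · exact absurd rfl hu
    · exact ⟨hleaf _ _, h.mem_of_mem _ (hAS i), hleafne _ _⟩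
    · obtain ⟨h1, h2, h3⟩ := (hR _).1 (hBR i)
      exact ⟨hleaf _ _, h.mem_of_notMem _ h1 h2 h3, hleafne _ _⟩
    · have hpar : (Sum.elim (Sum.elim (Sum.elim (fun b => if b then z else w)
          (Sum.elim (fun i => leaf (A i) w) fun i => leaf (B i) z)) fun n : Fin c => q (c - 1 - n))
          (fun n : Fin (d - c) => q (c + 1 + n)) : _ → V) (Sum.inl
            (if (n : ℕ) = 0 then .inl (.inl true) else .inr ⟨n - 1, by omega⟩)) = q (c - n) := by
        split_ifs with h0
        · simp only [Sum.elim_inl, if_true, h0, Nat.sub_zero, h.center]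
        · simp only [Sum.elim_inl, Sum.elim_inr]
          congr 1
          omega
      simp only [Sum.elim_inl, Sum.elim_inr] at hpar ⊢
      rw [hpar]
      have hn := n.2
      refine ⟨hwalk _ _ (by omega) (by omega), hwalk _ _ (by omega) (by omega), ?_⟩
      have := h.walk.ne_succ (c - 1 - n) (by omega)
      rwa [show c - 1 - n + 1 = c - (n : ℕ) by omega] at this
    · have hpar : (Sum.elim (Sum.elim (Sum.elim (fun b => if b then z else w)
          (Sum.elim (fun i => leaf (A i) w) fun i => leaf (B i) z)) fun n : Fin c => q (c - 1 - n))
          (fun n : Fin (d - c) => q (c + 1 + n)) : _ → V)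
            (if (n : ℕ) = 0 then .inl (.inl (.inl true)) else .inr ⟨n - 1, by omega⟩) =
              q (c + n) := by
        split_ifs with h0
        · simp only [Sum.elim_inl, if_true, h0, Nat.add_zero, h.center]
        · simp only [Sum.elim_inr]
          congr 1
          omega
      simp only [Sum.elim_inr] at hpar ⊢
      rw [hpar]
      have hn := n.2
      refine ⟨hwalk _ _ (by omega) (by omega), hwalk _ _ (by omega) (by omega), ?_⟩
      have := (h.walk.ne_succ (c + n) (by omega)).symm
      rwa [show c + (n : ℕ) + 1 = c + 1 + n by omega] at this

end SpiderPower

/-! ### The extremal supertrees -/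

/-- The edges of a uniform hypergraph, as a family indexed by the edge set. -/
lemma Hypergraph.IsUniform.exists_isEdgeFamily {V : Type*} [Fintype V] {G : Hypergraph V} {r : ℕ}
    (hG : G.IsUniform (r + 1)) : ∃ E : G.edgeSet → Finset V, IsEdgeFamily G r E := by
  classical
  refine ⟨fun e => (e : Set V).toFinset, ?_, fun e e' h => ?_, fun e => ?_⟩
  · simp
  · exact Subtype.ext (Set.toFinset_inj.1 h)
  · rw [← hG e e.2, Set.ncard_eq_toFinset_card']

/-- A hypergraph without edges is a caterpillar. -/
lemma Hypergraph.isCaterpillar_of_isEmpty {V : Type*} {G : Hypergraph V} [IsEmpty G.edgeSet] :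
    G.IsCaterpillar := by
  refine ⟨0, Fin.elim0, fun i => i.elim0, ?_, fun i => i.elim0⟩
  rw [Set.range_eq_empty]
  exact (Set.eq_empty_of_forall_notMem fun e he => IsEmpty.false (⟨e, he.1⟩ : G.edgeSet)).symm

/-- On the vertices of a supertree `G` that is not a caterpillar there is an extremal supertree
whose spectral radius is larger than that of `G`, unless it is `G` itself. -/
lemma exists_isIsomorphic_extremal {V : Type*} [Fintype V] {r m d : ℕ} (hr : 2 ≤ r) {α : ℝ}
    (hα0 : 0 ≤ α) (hα1 : α < 1) {G : Hypergraph V} (hG : G.IsNonCaterpillar (r + 1) m d) :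
    ∃ H : Hypergraph V,
      (H.IsIsomorphic (hypertreeH1 (r + 1) m d) ∨ H.IsIsomorphic (hypertreeH2 (r + 1) m d)) ∧
      G.alphaSpectralRadius (r + 1) α ≤ H.alphaSpectralRadius (r + 1) α ∧
      (G.alphaSpectralRadius (r + 1) α = H.alphaSpectralRadius (r + 1) α → G = H) := by
  classical
  obtain ⟨hT, rfl, rfl, hcat⟩ := hG
  obtain ⟨E, hE⟩ := hT.uniform.exists_isEdgeFamily
  have : Fintype G.edgeSet := Fintype.ofFinite _
  have : Nonempty G.edgeSet := by
    by_contra h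
    rw [not_nonempty_iff] at h
    exact hcat Hypergraph.isCaterpillar_of_isEmpty
  obtain ⟨c, x, hx, hxpos⟩ := exists_pos_isFormMaximizer hα0 hα1 hE hT.connected
  obtain ⟨p, ε, hp⟩ := exists_isLooseEdgePath hE hT
  obtain ⟨E₂, q, ε₂, z, w, f, S, hS, hcase, hle, hstrict⟩ :=
    exists_isSpider hα0 hα1 hxpos hE hT hcat hp
  obtain ⟨D, top, hR⟩ := exists_isRooting hE hT z
  have hV := hR.card_eq hE.card_eq
  set R : Finset G.edgeSet :=
    Finset.univ.filter fun j => (∀ n < G.diameter, ε₂ n ≠ j) ∧ j ≠ f ∧ j ∉ S with hRdef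
  have hRmem : ∀ j, j ∈ R ↔ (∀ n < G.diameter, ε₂ n ≠ j) ∧ j ≠ f ∧ j ∉ S := fun j => by
    simp [hRdef]
  obtain ⟨hinj, hiso⟩ := hS.isIsomorphic hr (Nat.div_le_self _ 2) hRmem hV rfl rfl
  have hm : G.edgeSet.ncard = G.diameter + 1 + S.card + R.card := by
    rw [← hS.card_eq_add hRmem, ← Nat.card_eq_fintype_card]
    rfl
  let H : Hypergraph V :=
    { vertexSet := Set.univ
      edgeSet := Set.range fun j => (E₂ j : Set V)
      subset_vertexSet_of_mem_edgeSet' := fun _ _ => Set.subset_univ _ }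
  have hE₂ : IsEdgeFamily H r E₂ := ⟨rfl, hinj, hS.card_eq⟩
  obtain ⟨hρ, hρeq⟩ := spectralRadius_le_of_edgeForm_le (by omega) hα0 hα1 hE hE₂ hx hle
  refine ⟨H, ?_, hρ, fun heq => ?_⟩
  · have hH := hiso H rfl rfl
    rcases hcase with h1 | h0
    · left
      have h2 : G.edgeSet.ncard - G.diameter - 2 = R.card := by omega
      unfold hypertreeH1
      rw [h2]
      rwa [h1] at hH
    · right
      have h3 : R.card = 0 := by
        rw [Finset.card_eq_zero]
        refine Finset.eq_empty_of_forall_notMem fun j hj => ?_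
        obtain ⟨h4, h5, h6⟩ := (hRmem j).1 hj
        exact h6 (h0 j h4 h5)
      have h2 : G.edgeSet.ncard - G.diameter - 1 = S.card := by omega
      unfold hypertreeH2
      rw [h2]
      rwa [h3] at hH
  · obtain ⟨hform, hgrad⟩ := hρeq heq
    rcases hstrict with rfl | hlt | ⟨v, hv⟩
    · exact Hypergraph.ext hT.vertexSet_eq hE.edgeSet_eq
    · exact absurd hform hlt.ne'
    · exact absurd (hgrad v) hv

theorem mainTheorem3 {V : Type*} [Fintype V] (k m d : ℕ) (hk : 3 ≤ k)
    (α : ℝ) (hα0 : 0 ≤ α) (hα1 : α < 1)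
    (G : Hypergraph V) (hG : G.IsNonCaterpillar k m d) :
    G.alphaSpectralRadius k α ≤
        max ((hypertreeH1 k m d).alphaSpectralRadius k α)
          ((hypertreeH2 k m d).alphaSpectralRadius k α) ∧
      (G.alphaSpectralRadius k α =
          max ((hypertreeH1 k m d).alphaSpectralRadius k α)
            ((hypertreeH2 k m d).alphaSpectralRadius k α) ↔
        (G.IsIsomorphic (hypertreeH1 k m d) ∧
          (hypertreeH2 k m d).alphaSpectralRadius k α ≤
            (hypertreeH1 k m d).alphaSpectralRadius k α) ∨
        (G.IsIsomorphic (hypertreeH2 k m d) ∧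
          (hypertreeH1 k m d).alphaSpectralRadius k α ≤
            (hypertreeH2 k m d).alphaSpectralRadius k α)) := by
  obtain ⟨r, rfl⟩ : ∃ r, k = r + 1 := ⟨k - 1, by omega⟩
  obtain ⟨H, hH, hle, heq⟩ := exists_isIsomorphic_extremal (by omega) hα0 hα1 hG
  have hmax : H.alphaSpectralRadius (r + 1) α ≤
      max ((hypertreeH1 (r + 1) m d).alphaSpectralRadius (r + 1) α)
        ((hypertreeH2 (r + 1) m d).alphaSpectralRadius (r + 1) α) := by
    rcases hH with h | h
    · exact (Hypergraph.alphaSpectralRadius_eq_of_isIsomorphic h _ _).trans_le (le_max_left _ _)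
    · exact (Hypergraph.alphaSpectralRadius_eq_of_isIsomorphic h _ _).trans_le (le_max_right _ _)
  refine ⟨hle.trans hmax, fun h => ?_, ?_⟩
  · obtain rfl := heq (le_antisymm hle (h ▸ hmax))
    rcases hH with h1 | h1
    · refine .inl ⟨h1, ?_⟩
      rw [← Hypergraph.alphaSpectralRadius_eq_of_isIsomorphic h1, h]
      exact le_max_right _ _
    · refine .inr ⟨h1, ?_⟩
      rw [← Hypergraph.alphaSpectralRadius_eq_of_isIsomorphic h1, h]
      exact le_max_left _ _
  · rintro (⟨h1, h2⟩ | ⟨h1, h2⟩)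
    · rw [max_eq_left h2, Hypergraph.alphaSpectralRadius_eq_of_isIsomorphic h1]
    · rw [max_eq_right h2, Hypergraph.alphaSpectralRadius_eq_of_isIsomorphic h1]
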